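/- Let $p$ be an odd prime and let $E/F$ be a ramified quadratic extension of $p$-adic fields, with nontrivial automorphism $c=\overline{\phantom{x}}$ and a uniformizer $\varpi$ of $E$. Let $r\ge 0$, let $V=E^{2r}$ with standard basis $e_1,\dots,e_{2r}$ and the hermitian form with $(e_i,e_{2r+1-i})=1$ for all $i$ and $(e_i,e_j)=0$ for all other pairs. Let $G_r=\mathrm U(V)$ be its unitary group and $L_r\subset G_r$ the stabilizer of the lattice $\bigoplus_i\mathcal O_E e_i$ (a compact open subgroup, which is not special for $r\ge 1$). Let $T_r\subset B_r=T_rN_r$ be the subgroups of diagonal and of upper triangular matrices in $G_r$, where $N_r$ consists of the upper triangular matrices with $1$ on the diagonal. Let $T_r^\circ=T_r\cap L_r$ be the maximal compact subgroup of $T_r$, $\Lambda=T_r/T_r^\circ$, and $\mathfrak W_r=N_{G_r}(T_r)/T_r\cong\{\pm1\}^r\rtimes S_r$ the finite Weyl group. For $\lambda\in\mathbf Z^r$ put $\varpi^\lambda=\mathrm{diag}(\varpi^{\lambda_1},\dots,\varpi^{\lambda_r},\overline\varpi^{-\lambda_r},\dots,\overline\varpi^{-\lambda_1})\in T_r$,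 and call $\lambda$ dominant if $\lambda_1\ge\dots\ge\lambda_r\ge0$. For a compact open subgroup $K$ of a locally compact group $G$, let $\mathcal H(G,K)$ be the algebra of compactly supported $K$-bi-invariant functions $G\to\mathbf C$ under convolution for the left Haar measure giving $K$ volume $1$. Then: (1) (Cartan decomposition) $G_r=\bigsqcup_{\lambda\ \mathrm{dominant}}L_r\varpi^\lambda L_r$, a disjoint union. (2) (Satake isomorphism) The Satake transform $$(\mathcal Sf)(t)=\delta_{B_r}^{1/2}(t)\int_{N_r}f(tn)\,dn,\qquad f\in\mathcal H(G_r,L_r),\ t\in T_r,$$ where $\delta_{B_r}$ is the modular character of $B_r$ (so $d(tnt^{-1})=\delta_{B_r}(t)\,dn$) and $dn$ is the Haar measure on $N_r$ giving $N_r\cap L_r$ volume $1$, defines an isomorphism of $\mathbf C$-algebras $\mathcal S:\mathcal H(G_r,L_r)\to\mathcal H(T_r,T_r^\circ)^{\mathfrak W_r}$. Moreover there are isomorphisms of $\mathbf C$-algebras $$\mathcal H(T_r,T_r^\circ)^{\mathfrak W_r}\cong\mathbf C[\Lambda]^{\mathfrak W_r}\cong\mathbf C[T_1^{\pm1},\dots,T_r^{\pm1}]^{\mathfrak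 W_r},$$ the first sending $f$ to the element whose coefficient at the class of $t$ is $f(t)$, the second identifying the class of $\varpi^\lambda$ with $T_1^{\lambda_1}\cdots T_r^{\lambda_r}$, where $\mathfrak W_r$ acts on Laurent polynomials by permuting the variables and by $T_i\mapsto T_i^{-1}$. -/

import Mathlib

noncomputable section

namespace LocalHecke

set_option linter.unusedSectionVars false

open MeasureTheory
open scoped Pointwise

section Hecke

variable {G : Type*} [Group G] [TopologicalSpace G]

/-- An open subgroup that is compact, as a compact set with non-empty interior. -/
def positiveCompacts (K : OpenSubgroup G) [CompactSpace K] : TopologicalSpace.PositiveCompacts G where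
  carrier := K
  isCompact' := isCompact_iff_compactSpace.mpr inferInstance
  interior_nonempty' := ⟨1, by rw [K.isOpen.interior_eq]; exact K.one_mem⟩

/-- The left Haar measure for which the compact open subgroup `K` has volume `1`. -/
def haarOf [IsTopologicalGroup G] [MeasurableSpace G] [BorelSpace G]
    (K : OpenSubgroup G) [CompactSpace K] : Measure G :=
  Measure.haarMeasure (positiveCompacts K)

/-- The space of compactly supported `K`-bi-invariant functions `G → ℂ`. -/
def heckeSubmodule (K : OpenSubgroup G) : Submodule ℂ (G → ℂ) where
  carrier := {f | (∀ k ∈ K, ∀ x, f (k * x) = f x) ∧ (∀ k ∈ K, ∀ x, f (x * k) = f x) ∧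
    HasCompactSupport f}
  add_mem' := by
    rintro f g ⟨h1, h2, h3⟩ ⟨h1', h2', h3'⟩
    exact ⟨fun k hk x => by simp [h1 k hk, h1' k hk], fun k hk x => by simp [h2 k hk, h2' k hk],
      h3.add h3'⟩
  zero_mem' := ⟨fun _ _ _ => rfl, fun _ _ _ => rfl, HasCompactSupport.zero⟩
  smul_mem' := by
    rintro a f ⟨h1, h2, h3⟩
    exact ⟨fun k hk x => by simp [h1 k hk], fun k hk x => by simp [h2 k hk],
      h3.comp_left (g := fun z => a • z) (smul_zero a)⟩

/-- The underlying vector space of the Hecke algebra `H(G, K)`. -/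
def HeckeAlgebra (K : OpenSubgroup G) : Type _ := heckeSubmodule K

namespace HeckeAlgebra

instance (K : OpenSubgroup G) : AddCommGroup (HeckeAlgebra K) :=
  inferInstanceAs (AddCommGroup (heckeSubmodule K))

instance (K : OpenSubgroup G) : Module ℂ (HeckeAlgebra K) :=
  inferInstanceAs (Module ℂ (heckeSubmodule K))

instance (K : OpenSubgroup G) : FunLike (HeckeAlgebra K) G ℂ where
  coe f := f.1
  coe_injective _ _ h := Subtype.ext h

variable {K : OpenSubgroup G}

theorem left_invariant (f : HeckeAlgebra K) {k : G} (hk : k ∈ K) (x : G) : f (k * x) = f x := f.2.1 k hk x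
theorem right_invariant (f : HeckeAlgebra K) {k : G} (hk : k ∈ K) (x : G) : f (x * k) = f x :=
  f.2.2.1 k hk x
theorem hasCompactSupport (f : HeckeAlgebra K) : HasCompactSupport f := f.2.2.2
theorem add_apply (f g : HeckeAlgebra K) (x : G) : (f + g) x = f x + g x := rfl
theorem smul_apply (a : ℂ) (f : HeckeAlgebra K) (x : G) : (a • f) x = a * f x := rfl
theorem zero_apply (x : G) : (0 : HeckeAlgebra K) x = 0 := rfl

variable [IsTopologicalGroup G]

theorem continuous_of_right_invariant {f : G → ℂ} (h : ∀ k ∈ K, ∀ x, f (x * k) = f x) :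
    Continuous f := by
  rw [continuous_iff_continuousAt]
  intro x
  have : f =ᶠ[nhds x] fun _ => f x := by
    have hx : (fun y => x⁻¹ * y) ⁻¹' (K : Set G) ∈ nhds x :=
      (K.isOpen.preimage (continuous_const_mul x⁻¹)).mem_nhds (by simp)
    filter_upwards [hx] with y hy
    have := h _ hy x
    simpa using this
  exact continuousAt_const.congr this.symm

theorem continuous (f : HeckeAlgebra K) : Continuous f := continuous_of_right_invariant f.2.2.1

variable [CompactSpace K]

theorem isCompact_K : IsCompact (K : Set G) := isCompact_iff_compactSpace.mpr inferInstance

open scoped Classical in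
/-- The characteristic function of `K`. -/
def one' (K : OpenSubgroup G) [CompactSpace K] : HeckeAlgebra K :=
  ⟨fun x => if x ∈ K then 1 else 0,
    fun k hk x => by simp [mul_mem_cancel_left hk],
    fun k hk x => by simp [mul_mem_cancel_right hk],
    HasCompactSupport.intro (isCompact_K (K := K)) fun x hx => if_neg hx⟩

theorem one'_of_mem {x : G} (hx : x ∈ K) : one' K x = 1 := if_pos hx
theorem one'_of_notMem {x : G} (hx : x ∉ K) : one' K x = 0 := if_neg hx

variable [MeasurableSpace G] [BorelSpace G]

instance : (haarOf K).IsHaarMeasure := Measure.isHaarMeasure_haarMeasure _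

theorem haarOf_self : haarOf K (K : Set G) = 1 := Measure.haarMeasure_self (K₀ := positiveCompacts K)

theorem hasCompactSupport_integrand (f g : HeckeAlgebra K) (x : G) :
    HasCompactSupport fun y => f y * g (y⁻¹ * x) := f.hasCompactSupport.mul_right

theorem continuous_integrand (f g : HeckeAlgebra K) (x : G) :
    Continuous fun y => f y * g (y⁻¹ * x) := by
  have := f.continuous
  have := g.continuous
  fun_prop

theorem integrable_integrand (f g : HeckeAlgebra K) (x : G) :
    Integrable (fun y => f y * g (y⁻¹ * x)) (haarOf K) :=
  (continuous_integrand f g x).integrable_of_hasCompactSupport (hasCompactSupport_integrand f g x)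

/-- Convolution with respect to the Haar measure giving `K` volume `1`. -/
def mul' (f g : HeckeAlgebra K) : HeckeAlgebra K :=
  ⟨fun x => ∫ y, f y * g (y⁻¹ * x) ∂(haarOf K), by
    have hl : ∀ k ∈ K, ∀ x, ∫ y, f y * g (y⁻¹ * (k * x)) ∂(haarOf K) =
        ∫ y, f y * g (y⁻¹ * x) ∂(haarOf K) := by
      intro k hk x
      rw [← integral_mul_left_eq_self _ k]
      congr 1
      ext y
      rw [f.left_invariant hk]
      congr 2
      group
    have hr : ∀ k ∈ K, ∀ x, ∫ y, f y * g (y⁻¹ * (x * k)) ∂(haarOf K) =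
        ∫ y, f y * g (y⁻¹ * x) ∂(haarOf K) := by
      intro k hk x
      congr 1
      ext y
      rw [← mul_assoc, g.right_invariant hk]
    refine ⟨hl, hr, ?_⟩
    refine HasCompactSupport.intro (f.hasCompactSupport.isCompact.mul g.hasCompactSupport.isCompact) ?_
    intro x hx
    by_contra hx0
    apply hx
    obtain ⟨y, hy⟩ : ∃ y, f y * g (y⁻¹ * x) ≠ 0 := by
      by_contra! h
      exact hx0 (by simp [h])
    exact ⟨y, subset_tsupport _ (left_ne_zero_of_mul hy), y⁻¹ * x,
      subset_tsupport _ (right_ne_zero_of_mul hy), by simp⟩⟩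

theorem mul'_apply (f g : HeckeAlgebra K) (x : G) :
    mul' f g x = ∫ y, f y * g (y⁻¹ * x) ∂(haarOf K) := rfl

theorem one'_mul' (f : HeckeAlgebra K) : mul' (one' K) f = f := by
  refine DFunLike.ext _ _ fun x => ?_
  rw [mul'_apply]
  have : (fun y => one' K y * f (y⁻¹ * x)) = (K : Set G).indicator fun _ => f x := by
    ext y
    by_cases hy : y ∈ K
    · have : f (y⁻¹ * x) = f x := f.left_invariant (K.inv_mem hy) x
      simp [one'_of_mem hy, hy, this]
    · simp [one'_of_notMem hy, hy]
  rw [this, integral_indicator_const _ K.isOpen.measurableSet, Measure.real, haarOf_self]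
  simp

theorem mul'_one' (f : HeckeAlgebra K) : mul' f (one' K) = f := by
  refine DFunLike.ext _ _ fun x => ?_
  rw [mul'_apply, ← integral_mul_left_eq_self _ x]
  have : (fun y => f (x * y) * one' K ((x * y)⁻¹ * x)) = (K : Set G).indicator fun _ => f x := by
    ext y
    have h1 : (x * y)⁻¹ * x = y⁻¹ := by group
    rw [h1]
    by_cases hy : y ∈ K
    · have : f (x * y) = f x := f.right_invariant hy x
      simp [one'_of_mem (K.inv_mem hy), hy, this]
    · have hy' : y⁻¹ ∉ K := fun h => hy (by simpa using K.inv_mem h)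
      simp [one'_of_notMem hy', hy]
  rw [this, integral_indicator_const _ K.isOpen.measurableSet, Measure.real, haarOf_self]
  simp

theorem mul'_assoc (f g h : HeckeAlgebra K) : mul' (mul' f g) h = mul' f (mul' g h) := by
  refine DFunLike.ext _ _ fun x => ?_
  simp only [mul'_apply]
  have hf := f.continuous
  have hg := g.continuous
  have hh := h.continuous
  calc ∫ y, (∫ z, f z * g (z⁻¹ * y) ∂(haarOf K)) * h (y⁻¹ * x) ∂(haarOf K)
      = ∫ y, ∫ z, f z * g (z⁻¹ * y) * h (y⁻¹ * x) ∂(haarOf K) ∂(haarOf K) := by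
        simp only [integral_mul_const]
    _ = ∫ z, ∫ y, f z * g (z⁻¹ * y) * h (y⁻¹ * x) ∂(haarOf K) ∂(haarOf K) := by
        refine integral_integral_swap_of_hasCompactSupport
          (f := fun y z => f z * g (z⁻¹ * y) * h (y⁻¹ * x)) ?_ ?_
        · simp only [Function.uncurry_def]
          fun_prop
        · have hc : IsCompact ((tsupport f * tsupport g) ×ˢ tsupport f) :=
            (f.hasCompactSupport.isCompact.mul g.hasCompactSupport.isCompact).prod
              f.hasCompactSupport.isCompact
          refine HasCompactSupport.intro hc ?_
          rintro ⟨y, z⟩ hyz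
          by_contra hne
          have hne' : f z * g (z⁻¹ * y) ≠ 0 := left_ne_zero_of_mul hne
          have h1 : z ∈ tsupport f := subset_tsupport _ (left_ne_zero_of_mul hne')
          have h2 : z⁻¹ * y ∈ tsupport g := subset_tsupport _ (right_ne_zero_of_mul hne')
          exact hyz ⟨⟨z, h1, z⁻¹ * y, h2, by simp⟩, h1⟩
    _ = ∫ z, f z * ∫ y, g y * h (y⁻¹ * (z⁻¹ * x)) ∂(haarOf K) ∂(haarOf K) := by
        congr 1
        ext z
        rw [← integral_const_mul, ← integral_mul_left_eq_self _ z]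
        congr 1
        ext y
        have h1 : z⁻¹ * (z * y) = y := by group
        have h2 : (z * y)⁻¹ * x = y⁻¹ * (z⁻¹ * x) := by group
        rw [h1, h2, mul_assoc]

instance : Ring (HeckeAlgebra K) :=
  { (inferInstance : AddCommGroup (HeckeAlgebra K)) with
    mul := mul'
    one := one' K
    mul_assoc := mul'_assoc
    one_mul := one'_mul'
    mul_one := mul'_one'
    left_distrib := fun f g h => by
      refine DFunLike.ext _ _ fun x => ?_
      change mul' f (g + h) x = mul' f g x + mul' f h x
      simp only [mul'_apply, add_apply, mul_add]
      exact integral_add (integrable_integrand f g x) (integrable_integrand f h x)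
    right_distrib := fun f g h => by
      refine DFunLike.ext _ _ fun x => ?_
      change mul' (f + g) h x = mul' f h x + mul' g h x
      simp only [mul'_apply, add_apply, add_mul]
      exact integral_add (integrable_integrand f h x) (integrable_integrand g h x)
    zero_mul := fun f => by
      refine DFunLike.ext _ _ fun x => ?_
      change mul' 0 f x = 0
      simp [mul'_apply, zero_apply]
    mul_zero := fun f => by
      refine DFunLike.ext _ _ fun x => ?_
      change mul' f 0 x = 0
      simp [mul'_apply, zero_apply] }

theorem mul_apply (f g : HeckeAlgebra K) (x : G) :
    (f * g) x = ∫ y, f y * g (y⁻¹ * x) ∂(haarOf K) := rfl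

instance : Algebra ℂ (HeckeAlgebra K) :=
  Algebra.ofModule
    (fun a f g => by
      refine DFunLike.ext _ _ fun x => ?_
      simp only [mul_apply, smul_apply, mul_assoc, integral_const_mul])
    (fun a f g => by
      refine DFunLike.ext _ _ fun x => ?_
      simp only [mul_apply, smul_apply, mul_left_comm _ a, integral_const_mul])

/-- A topological automorphism preserving `K` preserves the Haar measure normalised by `K`. -/
theorem map_haarOf (e : G ≃ₜ* G) (he : ∀ x, e x ∈ K ↔ x ∈ K) :
    (haarOf K).map e = haarOf K := by
  have : LocallyCompactSpace G :=
    isCompact_K.locallyCompactSpace_of_mem_nhds_of_group (K.isOpen.mem_nhds K.one_mem)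
  have : (haarOf K).Regular := Measure.regular_haarMeasure
  have : ((haarOf K).map e).IsHaarMeasure := e.isHaarMeasure_map _
  have : ((haarOf K).map e).Regular := Measure.Regular.map e.toHomeomorph
  have h := Measure.isMulLeftInvariant_eq_smul_of_regular ((haarOf K).map e) (haarOf K)
  have hK : (haarOf K).map e (K : Set G) = 1 := by
    have hm : Measurable (fun x => e x) := e.toHomeomorph.continuous.measurable
    rw [Measure.map_apply hm K.isOpen.measurableSet]
    have : e ⁻¹' (K : Set G) = K := Set.ext he
    rw [this, haarOf_self]
  have h1 : (1 : ENNReal) = (Measure.haarScalarFactor ((haarOf K).map e) (haarOf K) : ENNReal) := by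
    rw [← hK]
    conv_lhs => rw [h]
    rw [Measure.smul_apply, haarOf_self]
    simp
  have h2 : Measure.haarScalarFactor ((haarOf K).map e) (haarOf K) = 1 := by exact_mod_cast h1.symm
  rw [h, h2, one_smul]

theorem mul_apply_equiv (e : G ≃ₜ* G) (he : ∀ x, e x ∈ K ↔ x ∈ K) (f g : HeckeAlgebra K) (x : G) :
    (f * g) (e x) = ∫ y, f (e y) * g (e (y⁻¹ * x)) ∂(haarOf K) := by
  rw [mul_apply]
  conv_lhs => rw [← map_haarOf e he]
  refine (e.toHomeomorph.measurableEmbedding.integral_map (fun y => f y * g (y⁻¹ * e x))).trans ?_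
  refine integral_congr_ae (Filter.Eventually.of_forall fun y => ?_)
  change f (e y) * g ((e y)⁻¹ * e x) = f (e y) * g (e (y⁻¹ * x))
  rw [map_mul e, map_inv e]

end HeckeAlgebra
end Hecke

section Unitary

open Matrix

variable {F E : Type*} [NontriviallyNormedField F] [NontriviallyNormedField E] [NormedAlgebra F E]

/-- The hermitian form `(x, y) = ∑ x_i c(y_{2r+1-i})` on `E^{2r}`: it is linear in `x`, `c`-linear in
`y`, and the standard basis satisfies `(e_i, e_{2r+1-i}) = 1`, all other products being `0`. -/
def hermForm (c : E ≃ₐ[F] E) (r : ℕ) (x y : Fin (2 * r) → E) : E := ∑ i, x i * c (y i.rev)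

/-- The unitary group `G_r` of the hermitian form, with its topology as a subgroup of
`GL_{2r}(E)`. -/
def unitaryGp (c : E ≃ₐ[F] E) (r : ℕ) : Subgroup (GL (Fin (2 * r)) E) where
  carrier := {g | ∀ x y, hermForm c r (g.1 *ᵥ x) (g.1 *ᵥ y) = hermForm c r x y}
  mul_mem' := by
    intro g h hg hh x y
    rw [Units.val_mul, ← mulVec_mulVec, ← mulVec_mulVec, hg, hh]
  one_mem' := by intro x y; simp
  inv_mem' := by
    intro g hg x y
    rw [← hg (g⁻¹.1 *ᵥ x) (g⁻¹.1 *ᵥ y), mulVec_mulVec, mulVec_mulVec, ← Units.val_mul]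
    simp

variable (c : E ≃ₐ[F] E) (r : ℕ)

instance : MeasurableSpace (unitaryGp c r) := borel _
instance : BorelSpace (unitaryGp c r) := ⟨rfl⟩

/-- The matrix of an element of the unitary group. -/
def mat {c : E ≃ₐ[F] E} {r : ℕ} (g : unitaryGp c r) : Matrix (Fin (2 * r)) (Fin (2 * r)) E := g.1.1

section mat
variable {c r}
theorem mat_mul (g h : unitaryGp c r) : mat (g * h) = mat g * mat h := rfl
theorem mat_one : mat (1 : unitaryGp c r) = 1 := rfl
theorem mat_mul_inv (g : unitaryGp c r) : mat g * mat g⁻¹ = 1 := by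
  rw [← mat_mul, mul_inv_cancel, mat_one]
theorem mat_inv_mul (g : unitaryGp c r) : mat g⁻¹ * mat g = 1 := by
  rw [← mat_mul, inv_mul_cancel, mat_one]
theorem continuous_mat : Continuous (mat : unitaryGp c r → _) :=
  Units.continuous_val.comp continuous_subtype_val
theorem continuous_mat_apply (i j : Fin (2 * r)) :
    Continuous fun g : unitaryGp c r => mat g i j :=
  continuous_mat.matrix_elem i j
theorem mat_injective : Function.Injective (mat : unitaryGp c r → _) :=
  fun _ _ h => Subtype.ext (Units.ext h)
end mat

/-- The lattice spanned over the ring of integers of `E` (the closed unit ball) by the standard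
basis of `E^{2r}`. -/
def stdLattice (E : Type*) [NontriviallyNormedField E] (r : ℕ) : Set (Fin (2 * r) → E) :=
  {v | ∀ i, ‖v i‖ ≤ 1}

/-- The stabilizer of the standard lattice in the unitary group. -/
def latticeStabilizer : Subgroup (unitaryGp c r) where
  carrier := {g | (fun v => mat g *ᵥ v) '' stdLattice E r = stdLattice E r}
  mul_mem' := by
    intro g h hg hh
    have : (fun v => mat (g * h) *ᵥ v) = (fun v => mat g *ᵥ v) ∘ fun v => mat h *ᵥ v := by
      ext v; simp [mat_mul]
    simp only [Set.mem_ofPred_eq] at hg hh ⊢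
    rw [this, Set.image_comp, hh, hg]
  one_mem' := by simp [mat_one]
  inv_mem' := by
    intro g hg
    simp only [Set.mem_ofPred_eq] at hg ⊢
    conv_lhs => rw [← hg]
    rw [← Set.image_comp]
    have : ((fun v => mat g⁻¹ *ᵥ v) ∘ fun v => mat g *ᵥ v) = id := by
      ext v; simp [mat_inv_mul]
    rw [this, Set.image_id]

/-- The diagonal torus `T_r`. -/
def torus : Subgroup (unitaryGp c r) where
  carrier := {g | (mat g).IsDiag}
  mul_mem' := by
    intro g h hg hh
    simp only [Set.mem_ofPred_eq, mat_mul] at *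
    rw [← hg.diagonal_diag, ← hh.diagonal_diag, diagonal_mul_diagonal]
    exact isDiag_diagonal _
  one_mem' := isDiag_one
  inv_mem' := by
    intro g hg i j hij
    have h1 := hg.diagonal_diag
    have h2 := congrFun (congrFun (mat_mul_inv g) i) j
    have h3 := congrFun (congrFun (mat_mul_inv g) i) i
    rw [← h1, diagonal_mul] at h2 h3
    rw [one_apply_ne hij] at h2
    rw [one_apply_eq] at h3
    exact (mul_eq_zero.mp h2).resolve_left (left_ne_zero_of_mul_eq_one h3)

theorem inv_blockTriangular {g : unitaryGp c r} (h : (mat g).BlockTriangular id) :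
    (mat g⁻¹).BlockTriangular id := by
  let _ : Invertible (mat g) := ⟨mat g⁻¹, mat_inv_mul g, mat_mul_inv g⟩
  rw [← show (mat g)⁻¹ = mat g⁻¹ from inv_eq_left_inv (mat_inv_mul g)]
  exact blockTriangular_inv_of_blockTriangular h

theorem mul_diag_of_blockTriangular {M N : Matrix (Fin (2 * r)) (Fin (2 * r)) E}
    (hM : M.BlockTriangular id) (hN : N.BlockTriangular id) (i : Fin (2 * r)) :
    (M * N) i i = M i i * N i i := by
  rw [mul_apply]
  refine Finset.sum_eq_single i (fun j _ hj => ?_) (by simp)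
  rcases lt_or_gt_of_ne hj with h | h
  · rw [hM h, zero_mul]
  · rw [hN h, mul_zero]

/-- The Borel subgroup `B_r` of upper triangular matrices. -/
def borelSubgroup : Subgroup (unitaryGp c r) where
  carrier := {g | (mat g).BlockTriangular id}
  mul_mem' := fun hg hh => BlockTriangular.mul hg hh
  one_mem' := blockTriangular_one
  inv_mem' := inv_blockTriangular c r

/-- The unipotent radical `N_r` of `B_r`: upper triangular matrices with `1` on the diagonal. -/
def unipotentRadical : Subgroup (unitaryGp c r) where
  carrier := {g | (mat g).BlockTriangular id ∧ ∀ i, mat g i i = 1}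
  mul_mem' := by
    rintro g h ⟨hg, hg'⟩ ⟨hh, hh'⟩
    refine ⟨BlockTriangular.mul hg hh, fun i => ?_⟩
    rw [mat_mul, mul_diag_of_blockTriangular r hg hh, hg', hh', one_mul]
  one_mem' := ⟨blockTriangular_one, fun i => by simp [mat_one]⟩
  inv_mem' := by
    rintro g ⟨hg, hg'⟩
    refine ⟨inv_blockTriangular c r hg, fun i => ?_⟩
    have := mul_diag_of_blockTriangular r (inv_blockTriangular c r hg) hg i
    rw [mat_inv_mul, hg', one_apply_eq, mul_one] at this
    exact this.symm

theorem torus_le_borelSubgroup : torus c r ≤ borelSubgroup c r :=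
  fun _ hg _ _ hij => hg (ne_of_gt hij)

theorem torus_comm (s t : torus c r) : s * t = t * s := by
  apply Subtype.ext
  apply mat_injective
  change mat s.1 * mat t.1 = mat t.1 * mat s.1
  rw [← IsDiag.diagonal_diag s.2, ← IsDiag.diagonal_diag t.2, diagonal_mul_diagonal,
    diagonal_mul_diagonal]
  congr 1
  ext i
  exact mul_comm _ _

theorem isClosed_torus : IsClosed (torus c r : Set (unitaryGp c r)) := by
  have : (torus c r : Set (unitaryGp c r)) =
      ⋂ (i : Fin (2 * r)) (j : Fin (2 * r)) (_ : i ≠ j), {g | mat g i j = 0} := by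
    ext g
    simp only [Set.mem_iInter]
    rfl
  rw [this]
  exact isClosed_iInter fun i => isClosed_iInter fun j => isClosed_iInter fun _ =>
    isClosed_eq (continuous_mat_apply i j) continuous_const

theorem isClosed_borelSubgroup : IsClosed (borelSubgroup c r : Set (unitaryGp c r)) := by
  have : (borelSubgroup c r : Set (unitaryGp c r)) =
      ⋂ (i : Fin (2 * r)) (j : Fin (2 * r)) (_ : j < i), {g | mat g i j = 0} := by
    ext g
    simp only [Set.mem_iInter]
    rfl
  rw [this]
  exact isClosed_iInter fun i => isClosed_iInter fun j => isClosed_iInter fun _ =>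
    isClosed_eq (continuous_mat_apply i j) continuous_const

theorem isClosed_unipotentRadical : IsClosed (unipotentRadical c r : Set (unitaryGp c r)) := by
  have : (unipotentRadical c r : Set (unitaryGp c r)) =
      (borelSubgroup c r : Set (unitaryGp c r)) ∩ ⋂ i : Fin (2 * r), {g | mat g i i = 1} := by
    ext g
    simp only [Set.mem_inter_iff, Set.mem_iInter]
    rfl
  rw [this]
  exact (isClosed_borelSubgroup c r).inter
    (isClosed_iInter fun i => isClosed_eq (continuous_mat_apply i i) continuous_const)

/-- The finite Weyl group `W_r = N(T_r) / T_r`. -/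
abbrev weylGroup : Type _ :=
  Subgroup.normalizer (torus c r : Set (unitaryGp c r)) ⧸
    (torus c r).subgroupOf (Subgroup.normalizer (torus c r : Set (unitaryGp c r)))

/-- The action of the Weyl group on the torus, induced by conjugation. -/
def weylAction : weylGroup c r →* MulAut (torus c r) :=
  QuotientGroup.lift _ (torus c r).normalizerMonoidHom (by
    intro n hn
    rw [MonoidHom.mem_ker]
    ext t
    have h := torus_comm c r ⟨n.1, hn⟩ t
    have h' : n.1 * t.1 = t.1 * n.1 := congrArg Subtype.val h
    change mat (n.1 * t.1 * n.1⁻¹) _ _ = mat t.1 _ _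
    rw [h', mul_inv_cancel_right])

theorem weylAction_mk (n : Subgroup.normalizer (torus c r : Set (unitaryGp c r)))
    (t : torus c r) : (weylAction c r (QuotientGroup.mk n) t).1 = n.1 * t.1 * n.1⁻¹ := rfl

theorem continuous_weylAction (w : weylGroup c r) : Continuous (weylAction c r w) := by
  obtain ⟨n, rfl⟩ := QuotientGroup.mk_surjective w
  refine Continuous.subtype_mk (f := fun t : torus c r => n.1 * t.1 * n.1⁻¹) ?_ _
  fun_prop

/-- The Weyl group acts by topological automorphisms. -/
def weylHomeo (w : weylGroup c r) : torus c r ≃ₜ* torus c r :=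
  { weylAction c r w with
    continuous_toFun := continuous_weylAction c r w
    continuous_invFun := by
      have := continuous_weylAction c r w⁻¹
      rwa [map_inv] at this }

theorem weylHomeo_apply (w : weylGroup c r) (t : torus c r) :
    weylHomeo c r w t = weylAction c r w t := rfl

section Topology

variable [IsUltrametricDist F]

/-- The matrices with entries in the ring of integers of `E`. -/
def integralMatrices (F E : Type*) [NontriviallyNormedField F] [NontriviallyNormedField E]
    [NormedAlgebra F E] [IsUltrametricDist F] (r : ℕ) :
    Submonoid (Matrix (Fin (2 * r)) (Fin (2 * r)) E) where
  carrier := {M | ∀ i j, ‖M i j‖ ≤ 1}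
  mul_mem' := by
    intro M N hM hN i j
    have : IsUltrametricDist E := IsUltrametricDist.of_normedAlgebra F
    rw [mul_apply]
    refine IsUltrametricDist.norm_sum_le_of_forall_le_of_nonneg zero_le_one fun k _ => ?_
    rw [norm_mul]
    exact mul_le_one₀ (hM i k) (norm_nonneg _) (hN k j)
  one_mem' := by
    intro i j
    by_cases h : i = j
    · subst h; simp
    · rw [one_apply_ne h]; simp

theorem mulVec_mem_stdLattice {M : Matrix (Fin (2 * r)) (Fin (2 * r)) E}
    (hM : M ∈ integralMatrices F E r) {v : Fin (2 * r) → E} (hv : v ∈ stdLattice E r) :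
    M *ᵥ v ∈ stdLattice E r := by
  have : IsUltrametricDist E := IsUltrametricDist.of_normedAlgebra F
  intro i
  change ‖∑ k, M i k * v k‖ ≤ 1
  refine IsUltrametricDist.norm_sum_le_of_forall_le_of_nonneg zero_le_one fun k _ => ?_
  rw [norm_mul]
  exact mul_le_one₀ (hM i k) (norm_nonneg _) (hv k)

theorem mat_mem_integralMatrices {g : unitaryGp c r} (hg : g ∈ latticeStabilizer c r) :
    mat g ∈ integralMatrices F E r := by
  intro i j
  have h1 : Pi.single j (1 : E) ∈ stdLattice E r := by
    intro k
    by_cases h : k = j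
    · subst h; simp
    · simp [h]
  have h2 : mat g *ᵥ Pi.single j 1 ∈ stdLattice E r := by
    rw [← show _ = stdLattice E r from hg]
    exact ⟨_, h1, rfl⟩
  have := h2 i
  simpa using this

theorem mem_latticeStabilizer_iff (g : unitaryGp c r) :
    g ∈ latticeStabilizer c r ↔ g.1 ∈ (integralMatrices F E r).units := by
  rw [Submonoid.mem_units_iff]
  constructor
  · intro hg
    exact ⟨mat_mem_integralMatrices c r hg, mat_mem_integralMatrices c r (inv_mem hg)⟩
  · rintro ⟨h1, h2⟩
    apply Set.Subset.antisymm
    · rintro _ ⟨v, hv, rfl⟩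
      exact mulVec_mem_stdLattice r h1 hv
    · intro v hv
      refine ⟨mat g⁻¹ *ᵥ v, mulVec_mem_stdLattice r h2 hv, ?_⟩
      simp [mat_mul_inv]

theorem isOpen_integralMatrices :
    IsOpen (integralMatrices F E r : Set (Matrix (Fin (2 * r)) (Fin (2 * r)) E)) := by
  have : IsUltrametricDist E := IsUltrametricDist.of_normedAlgebra F
  have : (integralMatrices F E r : Set (Matrix (Fin (2 * r)) (Fin (2 * r)) E)) =
      ⋂ i, ⋂ j, (fun M => M i j) ⁻¹' Metric.closedBall (0 : E) 1 := by
    ext M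
    simp only [Set.mem_iInter, Set.mem_preimage, mem_closedBall_zero_iff]
    rfl
  rw [this]
  exact isOpen_iInter_of_finite fun i => isOpen_iInter_of_finite fun j =>
    (IsUltrametricDist.isOpen_closedBall (0 : E) one_ne_zero).preimage
      (continuous_id.matrix_elem i j)

/-- The compact open subgroup `L_r`, the stabilizer of the standard lattice. -/
def latticeSubgroup : OpenSubgroup (unitaryGp c r) where
  toSubgroup := latticeStabilizer c r
  isOpen' := by
    have : (latticeStabilizer c r : Set (unitaryGp c r)) =
        (fun g => mat g) ⁻¹' (integralMatrices F E r) ∩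
          (fun g => mat g⁻¹) ⁻¹' (integralMatrices F E r) := by
      ext g
      exact (mem_latticeStabilizer_iff c r g).trans (Submonoid.mem_units_iff _ _)
    change IsOpen (latticeStabilizer c r : Set (unitaryGp c r))
    rw [this]
    exact ((isOpen_integralMatrices (F := F) r).preimage continuous_mat).inter
      ((isOpen_integralMatrices (F := F) r).preimage (continuous_mat.comp continuous_inv))

variable [LocallyCompactSpace F] [FiniteDimensional F E]

theorem continuous_conj : Continuous c := by
  have : ProperSpace F := ProperSpace.of_locallyCompactSpace F
  exact c.toLinearMap.continuous_of_finiteDimensional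

theorem isClosed_unitaryGp : IsClosed (unitaryGp c r : Set (GL (Fin (2 * r)) E)) := by
  have hc := continuous_conj c
  have : (unitaryGp c r : Set (GL (Fin (2 * r)) E)) = ⋂ (x) (y),
      {g | hermForm c r (g.1 *ᵥ x) (g.1 *ᵥ y) = hermForm c r x y} := by
    ext g
    simp only [Set.mem_iInter]
    rfl
  rw [this]
  refine isClosed_iInter fun x => isClosed_iInter fun y => isClosed_eq ?_ continuous_const
  have hm : ∀ z : Fin (2 * r) → E, Continuous fun g : GL (Fin (2 * r)) E => g.1 *ᵥ z :=
    fun z => Units.continuous_val.matrix_mulVec continuous_const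
  unfold hermForm
  exact continuous_finsetSum _ fun i _ => ((continuous_apply i).comp (hm x)).mul
    (hc.comp ((continuous_apply i.rev).comp (hm y)))

theorem isCompact_integralMatrices :
    IsCompact (integralMatrices F E r : Set (Matrix (Fin (2 * r)) (Fin (2 * r)) E)) := by
  have : ProperSpace F := ProperSpace.of_locallyCompactSpace F
  have : ProperSpace E := FiniteDimensional.proper F E
  have h := isCompact_univ_pi fun _ : Fin (2 * r) =>
    isCompact_univ_pi fun _ : Fin (2 * r) => isCompact_closedBall (0 : E) 1
  have h2 : (integralMatrices F E r : Set (Matrix (Fin (2 * r)) (Fin (2 * r)) E)) =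
      Set.univ.pi fun _ => Set.univ.pi fun _ => Metric.closedBall (0 : E) 1 := by
    ext M
    exact ⟨fun h i _ j _ => mem_closedBall_zero_iff.2 (h i j),
      fun h i j => mem_closedBall_zero_iff.1 (h i trivial j trivial)⟩
  rw [h2]
  exact h

theorem isCompact_latticeSubgroup :
    IsCompact (latticeSubgroup c r : Set (unitaryGp c r)) := by
  have h := Submonoid.units_isCompact (isCompact_integralMatrices (F := F) (E := E) r)
  have h2 := (isClosed_unitaryGp c r).isClosedEmbedding_subtypeVal.isCompact_preimage h
  have h3 : (latticeSubgroup c r : Set (unitaryGp c r)) =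
      Subtype.val ⁻¹' ((integralMatrices F E r).units : Set (GL (Fin (2 * r)) E)) := by
    ext g
    exact mem_latticeStabilizer_iff c r g
  rw [h3]
  exact h2

instance : CompactSpace (latticeSubgroup c r) :=
  isCompact_iff_compactSpace.mp (isCompact_latticeSubgroup c r)

/-- The compact open subgroup `H ∩ L_r` of a subgroup `H` of `G_r`. -/
def interLattice (H : Subgroup (unitaryGp c r)) : OpenSubgroup H :=
  (latticeSubgroup c r).comap H.subtype continuous_subtype_val

theorem isCompact_interLattice {H : Subgroup (unitaryGp c r)}
    (hH : IsClosed (H : Set (unitaryGp c r))) : IsCompact (interLattice c r H : Set H) :=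
  hH.isClosedEmbedding_subtypeVal.isCompact_preimage (isCompact_latticeSubgroup c r)

instance : LocallyCompactSpace (borelSubgroup c r) :=
  (isCompact_interLattice c r (isClosed_borelSubgroup c r)).locallyCompactSpace_of_mem_nhds_of_group
    ((interLattice c r (borelSubgroup c r)).isOpen.mem_nhds (one_mem _))

/-- The maximal compact subgroup `T_r° = T_r ∩ L_r` of the torus. -/
def torusCompact : OpenSubgroup (torus c r) := interLattice c r (torus c r)

instance : CompactSpace (torusCompact c r) :=
  isCompact_iff_compactSpace.mp (isCompact_interLattice c r (isClosed_torus c r))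

/-- The compact open subgroup `N_r ∩ L_r` of `N_r`. -/
def unipotentCompact : OpenSubgroup (unipotentRadical c r) := interLattice c r (unipotentRadical c r)

instance : CompactSpace (unipotentCompact c r) :=
  isCompact_iff_compactSpace.mp (isCompact_interLattice c r (isClosed_unipotentRadical c r))

/-- The Satake transform `(S f)(t) = δ(t)^{1/2} ∫_{N_r} f(tn) dn`, where `δ` is the modular
character of `B_r` and `N_r ∩ L_r` has volume `1`. -/
def satakeTransform (f : HeckeAlgebra (latticeSubgroup c r)) (t : torus c r) : ℂ :=
  (Real.sqrt (Measure.modularCharacter (Subgroup.inclusion (torus_le_borelSubgroup c r) t)) : ℂ) *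
    ∫ n : unipotentRadical c r, f (t.1 * n.1) ∂(haarOf (unipotentCompact c r))

/-- Every compact subgroup of the torus is contained in `T_r°`. -/
theorem le_torusCompact {C : Subgroup (torus c r)} (hC : IsCompact (C : Set (torus c r))) :
    C ≤ (torusCompact c r).toSubgroup := by
  have key : ∀ t ∈ C, ∀ i, ‖mat t.1 i i‖ ≤ 1 := by
    intro t ht i
    have hcont : Continuous fun t : torus c r => mat t.1 i i :=
      (continuous_mat_apply i i).comp continuous_subtype_val
    obtain ⟨M, hM⟩ := (hC.image hcont).isBounded.exists_norm_le
    by_contra! h1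
    have hpow : ∀ n : ℕ, mat (t ^ n).1 i i = mat t.1 i i ^ n := by
      intro n
      induction n with
      | zero => simp [mat_one]
      | succ n ih =>
        rw [pow_succ, pow_succ, ← ih]
        exact mul_diag_of_blockTriangular r (torus_le_borelSubgroup c r (t ^ n).2)
          (torus_le_borelSubgroup c r t.2) i
    obtain ⟨n, hn⟩ := pow_unbounded_of_one_lt M h1
    have := hM _ ⟨t ^ n, pow_mem ht n, rfl⟩
    simp only [hpow, norm_pow] at this
    exact absurd this (not_le.mpr hn)
  have key2 : ∀ t ∈ C, mat t.1 ∈ integralMatrices F E r := by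
    intro t ht i j
    by_cases h : i = j
    · subst h; exact key t ht i
    · rw [t.2 h]; simp
  intro t ht
  exact (mem_latticeStabilizer_iff c r t.1).mpr
    ((Submonoid.mem_units_iff _ _).mpr ⟨key2 t ht, key2 t⁻¹ (inv_mem ht)⟩)

theorem weylAction_mem_aux (w : weylGroup c r) {t : torus c r} (ht : t ∈ torusCompact c r) :
    weylAction c r w t ∈ torusCompact c r := by
  have h := (isCompact_interLattice c r (isClosed_torus c r)).image (continuous_weylAction c r w)
  have := le_torusCompact c r
    (C := (interLattice c r (torus c r)).toSubgroup.map (weylAction c r w).toMonoidHom) h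
  exact this ⟨t, ht, rfl⟩

theorem weylAction_mem (w : weylGroup c r) (t : torus c r) :
    weylAction c r w t ∈ torusCompact c r ↔ t ∈ torusCompact c r := by
  refine ⟨fun h => ?_, weylAction_mem_aux c r w⟩
  have := weylAction_mem_aux c r w⁻¹ h
  rwa [map_inv, MulAut.inv_apply_self] at this

/-- The algebra `H(T_r, T_r°)^{W_r}` of Weyl-invariant elements of `H(T_r, T_r°)`. -/
def heckeInvariants : Subalgebra ℂ (HeckeAlgebra (torusCompact c r)) where
  carrier := {f | ∀ w t, f (weylAction c r w t) = f t}
  mul_mem' := by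
    intro f g hf hg w t
    have h := HeckeAlgebra.mul_apply_equiv (weylHomeo c r w) (weylAction_mem c r w) f g t
    simp only [weylHomeo_apply] at h
    rw [h, HeckeAlgebra.mul_apply]
    congr 1
    ext y
    rw [hf w y, hg w]
  add_mem' := by
    intro f g hf hg w t
    rw [HeckeAlgebra.add_apply, HeckeAlgebra.add_apply, hf w t, hg w t]
  algebraMap_mem' := by
    intro a w t
    rw [Algebra.algebraMap_eq_smul_one, HeckeAlgebra.smul_apply, HeckeAlgebra.smul_apply]
    congr 1
    by_cases ht : t ∈ torusCompact c r
    · exact (HeckeAlgebra.one'_of_mem ((weylAction_mem c r w t).mpr ht)).trans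
        (HeckeAlgebra.one'_of_mem ht).symm
    · exact (HeckeAlgebra.one'_of_notMem fun h => ht ((weylAction_mem c r w t).mp h)).trans
        (HeckeAlgebra.one'_of_notMem ht).symm

instance : (torusCompact c r).toSubgroup.Normal :=
  ⟨fun n hn g => by rwa [torus_comm, inv_mul_cancel_left]⟩

/-- The cocharacter lattice `Λ = T_r / T_r°`, written multiplicatively. -/
abbrev cocharLattice : Type _ := torus c r ⧸ (torusCompact c r).toSubgroup

/-- The action of the Weyl group on `Λ`. -/
def weylLattice (w : weylGroup c r) : cocharLattice c r ≃* cocharLattice c r :=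
  QuotientGroup.congr _ _ (weylAction c r w) (by
    ext t
    constructor
    · rintro ⟨s, hs, rfl⟩
      exact (weylAction_mem c r w s).mpr hs
    · intro ht
      refine ⟨weylAction c r w⁻¹ t, (weylAction_mem c r w⁻¹ t).mpr ht, ?_⟩
      rw [map_inv]
      exact MulAut.apply_inv_self _ _ _)

/-- The algebra `ℂ[Λ]^{W_r}`. -/
def latticeInvariants : Subalgebra ℂ (MonoidAlgebra ℂ (cocharLattice c r)) :=
  ⨅ w : weylGroup c r,
    AlgHom.equalizer (MonoidAlgebra.domCongr ℂ ℂ (weylLattice c r w)).toAlgHom (AlgHom.id ℂ _)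

end Topology

section Cocharacters

/-- The element `(σ, ε)` of `{±1}^r ⋊ S_r` acting on `ℤ^r` by permuting the coordinates and changing
their signs. -/
def signedPerm {r : ℕ} (σ : Equiv.Perm (Fin r)) (ε : Fin r → ℤˣ) : (Fin r → ℤ) ≃+ (Fin r → ℤ) where
  toFun l i := ε i * l (σ.symm i)
  invFun l i := ε (σ i) * l (σ i)
  left_inv l := by
    ext i
    simp [← mul_assoc, ← Units.val_mul]
  right_inv l := by
    ext i
    simp [← mul_assoc, ← Units.val_mul]
  map_add' l m := by
    ext i
    simp [mul_add]

/-- The algebra `ℂ[T_1^{±1}, …, T_r^{±1}]^{W_r}`: Laurent polynomials in `r` variables, that is, the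
group algebra of `ℤ^r`, with `T_1^{l_1} ⋯ T_r^{l_r}` the basis vector of `l`, that are invariant under
all permutations of the variables and all substitutions `T_i ↦ T_i^{-1}`. -/
def laurentInvariants (r : ℕ) : Subalgebra ℂ (AddMonoidAlgebra ℂ (Fin r → ℤ)) :=
  ⨅ (σ : Equiv.Perm (Fin r)) (ε : Fin r → ℤˣ),
    AlgHom.equalizer (AddMonoidAlgebra.domCongr ℂ ℂ (signedPerm σ ε)).toAlgHom (AlgHom.id ℂ _)

/-- The dominant cocharacters: `l_1 ≥ l_2 ≥ ⋯ ≥ l_r ≥ 0`. -/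
def dominant (r : ℕ) : Set (Fin r → ℤ) := {l | Antitone l ∧ ∀ i, 0 ≤ l i}

variable [Algebra.IsQuadraticExtension F E]

theorem conj_conj_apply (x : E) : c (c x) = x := by
  have h1 : Nat.card (E ≃ₐ[F] E) ≤ 2 := by
    rw [← Algebra.IsQuadraticExtension.finrank_eq_two F E, Nat.card_eq_fintype_card]
    exact AlgEquiv.card_le
  have h2 : c ^ 2 = 1 := by
    have h3 : 0 < Nat.card (E ≃ₐ[F] E) := Nat.card_pos
    have h4 : c ^ Nat.card (E ≃ₐ[F] E) = 1 := pow_card_eq_one'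
    interval_cases h : Nat.card (E ≃ₐ[F] E)
    · rw [pow_one] at h4
      rw [h4, one_pow]
    · exact h4
  have := congrArg (fun d : E ≃ₐ[F] E => d x) h2
  simpa [pow_two] using this

/-- The diagonal entries of `diag(a_1, …, a_r, c(a_r)⁻¹, …, c(a_1)⁻¹)`. -/
def torusEntry (a : Fin r → Eˣ) (i : Fin (2 * r)) : Eˣ :=
  if h : i.1 < r then a ⟨i.1, h⟩ else (Units.map c (a ⟨i.rev.1, by simp [Fin.val_rev]; omega⟩))⁻¹

theorem torusEntry_mul (a : Fin r → Eˣ) (i : Fin (2 * r)) :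
    (torusEntry c r a i : E) * c (torusEntry c r a i.rev) = 1 := by
  unfold torusEntry
  by_cases h : i.1 < r
  · have h' : ¬ (i.rev.1 < r) := by simp [Fin.val_rev]; omega
    rw [dif_pos h, dif_neg h']
    simp [conj_conj_apply]
  · have h' : i.rev.1 < r := by simp [Fin.val_rev]; omega
    rw [dif_neg h, dif_pos h']
    simp

/-- The element `diag(a_1, …, a_r, c(a_r)⁻¹, …, c(a_1)⁻¹)` of the torus `T_r`. -/
def torusElt (a : Fin r → Eˣ) : torus c r :=
  ⟨⟨⟨diagonal fun i => (torusEntry c r a i : E), diagonal fun i => ((torusEntry c r a i)⁻¹ : Eˣ),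
      by simp, by simp⟩, by
    intro x y
    unfold hermForm
    refine Finset.sum_congr rfl fun i _ => ?_
    simp only [mulVec_diagonal, map_mul]
    calc _ = ((torusEntry c r a i : E) * c (torusEntry c r a i.rev)) * (x i * c (y i.rev)) := by ring
      _ = _ := by rw [torusEntry_mul, one_mul]⟩, isDiag_diagonal _⟩

/-- The element `ϖ^l = diag(ϖ^{l_1}, …, ϖ^{l_r}, c(ϖ)^{-l_r}, …, c(ϖ)^{-l_1})` of `T_r`. -/
def cochar (ϖ : Eˣ) (l : Fin r → ℤ) : torus c r := torusElt c r fun i => ϖ ^ l i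

end Cocharacters

end Unitary

/-- `ϖ` is a uniformizer: a generator of the maximal ideal of the ring of integers `{‖x‖ ≤ 1}`. -/
def IsUniformizer {E : Type*} [NontriviallyNormedField E] (ϖ : Eˣ) : Prop :=
  ‖(ϖ : E)‖ < 1 ∧ ∀ x : E, ‖x‖ < 1 → ‖x‖ ≤ ‖(ϖ : E)‖

/-- A quadratic extension `E/F` of nonarchimedean local fields is ramified if its ramification index
is not `1`, that is, if the value group of `E` is strictly larger than that of `F`. -/
def IsRamified (F E : Type*) [NontriviallyNormedField F] [NontriviallyNormedField E]
    [NormedAlgebra F E] : Prop :=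
  ∃ x : E, ∀ y : F, ‖y‖ ≠ ‖x‖

end LocalHecke

end

open LocalHecke

noncomputable section

namespace LocalHecke

set_option linter.unusedSectionVars false

open MeasureTheory
open scoped Pointwise NNReal ENNReal

section

/-! ### Integration over a group as a sum over the cosets of a compact open subgroup. -/

section IntegralCosets

variable {G : Type*} [Group G] [TopologicalSpace G] [IsTopologicalGroup G] [MeasurableSpace G]
  [BorelSpace G] (K : OpenSubgroup G) [CompactSpace K]

/-! The group `L_r` contains a permutation matrix for every element of the Weyl group, so the
classical argument for special maximal compact subgroups applies to it. The decompositions `G = B L`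
and `G = L T L` (`iwasawa`, `exists_mul_torus_mul`) come from elimination over the ring of integers:
a pivot of largest norm is moved into place by a permutation matrix, and the other entries of its
column are removed by an Eichler transformation (`exists_clear`). The columns of a unitary matrix
are isotropic, and this alone makes the required Eichler transformation unitary; nothing is divided
by 2.

Minors control the double cosets. For dominant `l`, all minors of size `j` of an element of `L ϖ^l
L` have norm at most `|ϖ|^{-(l_1+…+l_j)}`, while the lower right corner of `ϖ^m n` with `n ∈ N` has
norm exactly `|ϖ|^{-(m_1+…+m_j)}`. So `ϖ^m n ∈ L ϖ^l L` forces `m` to lie below `l` in the dominance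
order (`partialSum_le`). This gives the disjointness in the Cartan decomposition. It also makes the
Satake transform triangular on characteristic functions of double cosets, with nonzero diagonal
coefficients, whence bijectivity onto the invariants (`satakeHom_injective`,
`satakeHom_surjective`).

Multiplicativity follows from `G = B L` and `B = T N`, which turn a convolution over `G` into
iterated integrals over `T` and `N` (`orbitIntegral_mul`). Weyl invariance is checked on simple
reflections. There `N` is a semidirect product of a simple root subgroup `U` and a complement `N'`
stable under the reflection. A rank one computation puts `t u` and `u t'` in the same double coset,
where `u ∈ U` and `t'` is the reflection of `t` (`exists_reflTorus_eq`). The Jacobian that remains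
is absorbed by the square root of the modular character (`sqrt_conjChar_mul_orbitIntegral`).

Finally the Hecke algebra of the commutative group `T` is the group algebra of `Λ ≅ ℤ^r`, on which
the Weyl group acts through exactly the signed permutations. -/

theorem apply_out_of_right_invariant {K : OpenSubgroup G} {h : G → ℂ}
    (hr : ∀ k ∈ K, ∀ x, h (x * k) = h x) (g : G) :
    h (QuotientGroup.mk g : G ⧸ K.toSubgroup).out = h g := by
  obtain ⟨k, hk⟩ := QuotientGroup.mk_out_eq_mul K.toSubgroup g
  rw [hk, hr _ k.2]

/-- The quotient by an open subgroup is discrete, so a compact support has finite image in it. -/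
theorem finite_support_quotient {h : G → ℂ} (hc : HasCompactSupport h) :
    (Function.support fun x : G ⧸ K.toSubgroup => h x.out).Finite := by
  have : DiscreteTopology (G ⧸ K.toSubgroup) := QuotientGroup.discreteTopology K.isOpen
  have h1 : ((QuotientGroup.mk : G → G ⧸ K.toSubgroup) '' tsupport h).Finite :=
    isCompact_iff_finite.1 (hc.isCompact.image QuotientGroup.continuous_mk)
  refine h1.subset fun x hx => ⟨x.out, subset_tsupport _ hx, ?_⟩
  exact QuotientGroup.out_eq' x

/-- The integral of a right `K`-invariant function is the sum of its values on the cosets of `K`. -/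
theorem integral_eq_finsum {h : G → ℂ} (hr : ∀ k ∈ K, ∀ x, h (x * k) = h x)
    (hc : HasCompactSupport h) :
    ∫ x, h x ∂(haarOf K) = ∑ᶠ x : G ⧸ K.toSubgroup, h x.out := by
  classical
  have hfin := finite_support_quotient K hc
  rw [finsum_eq_sum_of_support_subset (s := hfin.toFinset) _ (by simp)]
  have hopen : ∀ x : G ⧸ K.toSubgroup,
      (QuotientGroup.mk ⁻¹' {x} : Set G) = x.out • (K : Set G) := by
    intro x
    ext g
    rw [Set.mem_preimage, Set.mem_singleton_iff, Set.mem_smul_set_iff_inv_smul_mem, smul_eq_mul]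
    conv_lhs => rw [eq_comm, ← QuotientGroup.out_eq' x]
    exact QuotientGroup.eq
  -- `h` is a finite combination of indicators of cosets of `K`, each of volume 1.
  have hh : h = fun g => ∑ x ∈ hfin.toFinset,
      (QuotientGroup.mk ⁻¹' {x} : Set G).indicator (fun _ => h x.out) g := by
    ext g
    by_cases hg : h g = 0
    · rw [hg, Finset.sum_eq_zero]
      intro x _
      by_cases hx : g ∈ (QuotientGroup.mk ⁻¹' {x} : Set G)
      · rw [Set.indicator_of_mem hx]
        have hx' : (QuotientGroup.mk g : G ⧸ K.toSubgroup) = x := hx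
        rw [← hx', apply_out_of_right_invariant hr, hg]
      · rw [Set.indicator_of_notMem hx]
    · rw [Finset.sum_eq_single (QuotientGroup.mk g : G ⧸ K.toSubgroup)]
      · rw [Set.indicator_of_mem (by simp), apply_out_of_right_invariant hr]
      · intro x _ hx
        rw [Set.indicator_of_notMem]
        exact fun h' => hx (Eq.symm h')
      · intro hx
        exfalso
        apply hx
        simp [apply_out_of_right_invariant hr, hg]
  conv_lhs => rw [hh]
  have hm : ∀ x : G ⧸ K.toSubgroup, MeasurableSet (QuotientGroup.mk ⁻¹' {x} : Set G) := by
    intro x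
    rw [hopen]
    exact (K.isOpen.smul _).measurableSet
  have hv : ∀ x : G ⧸ K.toSubgroup, haarOf K (QuotientGroup.mk ⁻¹' {x} : Set G) = 1 := by
    intro x
    rw [hopen, measure_smul, HeckeAlgebra.haarOf_self]
  rw [integral_finsetSum]
  · refine Finset.sum_congr rfl fun x _ => ?_
    rw [integral_indicator_const _ (hm x), Measure.real, hv]
    simp
  · intro x _
    exact (integrable_indicator_iff (hm x)).2 (integrableOn_const (by rw [hv]; simp))

variable {B : Type*} [Group B] [TopologicalSpace B] [IsTopologicalGroup B] [MeasurableSpace B]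
  [BorelSpace B] {K} {KB : OpenSubgroup B} [CompactSpace KB]

/-- If `G = B K`, then right `K`-invariant functions may be integrated over `B`. -/
theorem integral_eq_integral_of_factorization (i : B →* G) (hKB : ∀ b, b ∈ KB ↔ i b ∈ K)
    (hG : ∀ g, ∃ b, ∃ k ∈ K, g = i b * k) {h : G → ℂ} (hr : ∀ k ∈ K, ∀ x, h (x * k) = h x)
    (hc : HasCompactSupport h) (hcB : HasCompactSupport fun b => h (i b)) :
    ∫ x, h x ∂(haarOf K) = ∫ b, h (i b) ∂(haarOf KB) := by
  have hrB : ∀ k ∈ KB, ∀ x, h (i (x * k)) = h (i x) := fun k hk x => by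
    rw [map_mul, hr _ ((hKB k).1 hk)]
  rw [integral_eq_finsum K hr hc, integral_eq_finsum KB hrB hcB]
  symm
  -- This map of cosets is injective because `KB` is the preimage of `K`, and surjective by the
  -- factorization `G = B K`; the two coset sums then agree term by term.
  let e : B ⧸ KB.toSubgroup → G ⧸ K.toSubgroup := Quotient.map' i (by
    intro a b hab
    rw [QuotientGroup.leftRel_apply] at hab ⊢
    rw [← map_inv, ← map_mul]
    exact (hKB _).1 hab)
  have he : ∀ b : B, e (QuotientGroup.mk b) = QuotientGroup.mk (i b) := fun b => rfl
  refine finsum_eq_of_bijective e ⟨?_, ?_⟩ ?_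
  · intro x y
    induction x using QuotientGroup.induction_on
    induction y using QuotientGroup.induction_on
    rw [he, he, QuotientGroup.eq, QuotientGroup.eq, ← map_inv, ← map_mul]
    exact (hKB _).2
  · intro x
    induction x using QuotientGroup.induction_on with
    | H g =>
    obtain ⟨b, k, hk, rfl⟩ := hG g
    refine ⟨QuotientGroup.mk b, ?_⟩
    rw [he, QuotientGroup.eq, inv_mul_cancel_left]
    exact hk
  · intro x
    induction x using QuotientGroup.induction_on with
    | H b =>
    rw [he, apply_out_of_right_invariant hr]
    exact apply_out_of_right_invariant (h := fun b => h (i b)) hrB b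

end IntegralCosets

/-! ### Haar measures and modular characters of semidirect products. -/

section Semidirect

variable {H A N : Type*}
  [Group H] [TopologicalSpace H] [IsTopologicalGroup H] [MeasurableSpace H] [BorelSpace H]
  [Group A] [TopologicalSpace A] [IsTopologicalGroup A] [MeasurableSpace A] [BorelSpace A]
  [Group N] [TopologicalSpace N] [IsTopologicalGroup N] [MeasurableSpace N] [BorelSpace N]
  [SecondCountableTopology H] [SecondCountableTopology A] [SecondCountableTopology N]
  [LocallyCompactSpace H] [LocallyCompactSpace A] [LocallyCompactSpace N]
  {KH : OpenSubgroup H} {KA : OpenSubgroup A} {KN : OpenSubgroup N}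
  [CompactSpace KH] [CompactSpace KA] [CompactSpace KN]
  {i : A →* H} {j : N →* H} (e : A × N ≃ₜ H)

/-- The Haar measure of a semidirect product `H = A N` is the product of the left Haar measures. -/
theorem map_prod_haarOf (he : ∀ a n, e (a, n) = i a * j n)
    (hp : ∀ n a, (e.symm (j n * i a)).1 = a)
    (hK : ∀ a n, e (a, n) ∈ KH ↔ a ∈ KA ∧ n ∈ KN) :
    ((haarOf KA).prod (haarOf KN)).map e = haarOf KH := by
  have hinv : (((haarOf KA).prod (haarOf KN)).map e).IsMulLeftInvariant := by
    refine ⟨fun h => ?_⟩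
    obtain ⟨⟨a₀, n₀⟩, rfl⟩ := e.surjective h
    rw [Measure.map_map (by fun_prop) (by fun_prop)]
    -- Since `n₀ a = a n₁` with `n₁ ∈ N` depending on `a` (this is `hp`), one has `a₀ n₀ a n = (a₀
    -- a)(n₁ n)`: left translation is a skew product of left translations of the two factors.
    have h1 : ((fun x => e (a₀, n₀) * x) ∘ e) =
        e ∘ fun p : A × N => (a₀ * p.1, (e.symm (j n₀ * i p.1)).2 * p.2) := by
      ext ⟨a, n⟩
      have h2 : j n₀ * i a = i a * j (e.symm (j n₀ * i a)).2 := by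
        conv_lhs => rw [← e.apply_symm_apply (j n₀ * i a)]
        rw [← Prod.mk.eta (p := e.symm (j n₀ * i a)), he, hp]
      simp only [Function.comp_apply, he, map_mul]
      calc i a₀ * j n₀ * (i a * j n) = i a₀ * (j n₀ * i a) * j n := by group
        _ = i a₀ * (i a * j (e.symm (j n₀ * i a)).2) * j n := congrArg (fun x => i a₀ * x * j n) h2
        _ = _ := by group
    have hi : Continuous i := by
      have : (i : A → H) = fun a => e (a, 1) := by ext a; simp [he]
      rw [this]; fun_prop
    have hj : Continuous j := by
      have : (j : N → H) = fun a => e (1, a) := by ext a; simp [he]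
      rw [this]; fun_prop
    have h3 : MeasurePreserving
        (fun p : A × N => (a₀ * p.1, (e.symm (j n₀ * i p.1)).2 * p.2))
        ((haarOf KA).prod (haarOf KN)) ((haarOf KA).prod (haarOf KN)) := by
      refine (measurePreserving_mul_left (haarOf KA) a₀).skew_product
        (g := fun a n => (e.symm (j n₀ * i a)).2 * n) ?_ ?_
      · refine Continuous.measurable ?_
        simp only [Function.uncurry_def]
        fun_prop
      · exact Filter.Eventually.of_forall fun a => map_mul_left_eq_self _ _
    rw [h1, ← Measure.map_map (by fun_prop) h3.measurable, h3.map_eq]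
  have hsf : SigmaFinite (((haarOf KA).prod (haarOf KN)).map e) :=
    e.toMeasurableEquiv.sigmaFinite_map
  have h := Measure.haarMeasure_unique (((haarOf KA).prod (haarOf KN)).map e) (positiveCompacts KH)
  have hvol : ((haarOf KA).prod (haarOf KN)).map e (positiveCompacts KH) = 1 := by
    have hpre : e ⁻¹' (positiveCompacts KH : Set H) = (KA : Set A) ×ˢ (KN : Set N) := by
      ext ⟨a, n⟩
      exact hK a n
    have hm : MeasurableSet (positiveCompacts KH : Set H) := KH.isOpen.measurableSet
    rw [Measure.map_apply (by fun_prop) hm, hpre, Measure.prod_prod, HeckeAlgebra.haarOf_self,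
      HeckeAlgebra.haarOf_self, one_mul]
  rw [h, hvol, one_smul]
  rfl

theorem integral_semidirect (he : ∀ a n, e (a, n) = i a * j n)
    (hp : ∀ n a, (e.symm (j n * i a)).1 = a)
    (hK : ∀ a n, e (a, n) ∈ KH ↔ a ∈ KA ∧ n ∈ KN) {f : H → ℂ} (hf : Continuous f)
    (hc : HasCompactSupport f) :
    ∫ h, f h ∂(haarOf KH) = ∫ a, ∫ n, f (i a * j n) ∂(haarOf KN) ∂(haarOf KA) := by
  rw [← map_prod_haarOf e he hp hK, e.measurableEmbedding.integral_map, integral_prod]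
  · simp only [he]
  · refine (hf.comp e.continuous).integrable_of_hasCompactSupport ?_
    exact hc.comp_homeomorph e

instance haarOf_regular {G : Type*} [Group G] [TopologicalSpace G] [IsTopologicalGroup G]
    [MeasurableSpace G] [BorelSpace G] [LocallyCompactSpace G] (K : OpenSubgroup G)
    [CompactSpace K] : (haarOf K).Regular := Measure.regular_haarMeasure

/-- `mulEquivHaarChar φ` is the factor by which `φ` multiplies volumes, so the pushforward carries
its inverse. -/
theorem map_haarOf_eq_smul {G : Type*} [Group G] [TopologicalSpace G] [IsTopologicalGroup G]
    [MeasurableSpace G] [BorelSpace G] [LocallyCompactSpace G] (K : OpenSubgroup G)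
    [CompactSpace K] (φ : G ≃ₜ* G) :
    (haarOf K).map φ = (mulEquivHaarChar φ)⁻¹ • haarOf K := by
  conv_rhs => rw [← mulEquivHaarChar_smul_map (haarOf K) φ]
  rw [smul_smul, inv_mul_cancel₀ (mulEquivHaarChar_pos φ).ne', one_smul]

theorem smul_haarOf_injective {G : Type*} [Group G] [TopologicalSpace G] [IsTopologicalGroup G]
    [MeasurableSpace G] [BorelSpace G] (K : OpenSubgroup G)
    [CompactSpace K] {a b : ℝ≥0} (h : a • haarOf K = b • haarOf K) : a = b := by
  have := congrArg (fun μ => μ (K : Set G)) h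
  simp only [Measure.smul_apply, HeckeAlgebra.haarOf_self, ENNReal.smul_def, smul_eq_mul, mul_one]
    at this
  exact_mod_cast this

theorem mulEquivHaarChar_eq_one {G : Type*} [Group G] [TopologicalSpace G] [IsTopologicalGroup G]
    [MeasurableSpace G] [BorelSpace G] [LocallyCompactSpace G] (K : OpenSubgroup G)
    [CompactSpace K] (φ : G ≃ₜ* G) (h : ∀ x, φ x ∈ K ↔ x ∈ K) : mulEquivHaarChar φ = 1 := by
  have h1 := map_haarOf_eq_smul K φ
  rw [HeckeAlgebra.map_haarOf φ h] at h1
  have h2 := smul_haarOf_injective K (a := 1) ((one_smul _ _).trans h1)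
  rw [← inv_inv (mulEquivHaarChar φ), ← h2, inv_one]

theorem integral_comp_equiv {G : Type*} [Group G] [TopologicalSpace G] [IsTopologicalGroup G]
    [MeasurableSpace G] [BorelSpace G] [LocallyCompactSpace G] (K : OpenSubgroup G)
    [CompactSpace K] (φ : G ≃ₜ* G) (f : G → ℂ) :
    ∫ x, f (φ x) ∂(haarOf K) = ((mulEquivHaarChar φ : ℝ) : ℂ)⁻¹ * ∫ x, f x ∂(haarOf K) := by
  refine (φ.toHomeomorph.measurableEmbedding.integral_map f).symm.trans ?_
  change ∫ x, f x ∂((haarOf K).map φ) = _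
  rw [map_haarOf_eq_smul, integral_smul_nnreal_measure, NNReal.smul_def]
  simp

/-- The Haar measure of `H` is a product measure, so an automorphism acting factor by factor scales
it by the product of the two factors. -/
theorem mulEquivHaarChar_semidirect (he : ∀ a n, e (a, n) = i a * j n)
    (hp : ∀ n a, (e.symm (j n * i a)).1 = a)
    (hK : ∀ a n, e (a, n) ∈ KH ↔ a ∈ KA ∧ n ∈ KN)
    (φ : H ≃ₜ* H) (α : A ≃ₜ* A) (ν : N ≃ₜ* N) (h : ∀ a n, φ (e (a, n)) = e (α a, ν n)) :
    mulEquivHaarChar φ = mulEquivHaarChar α * mulEquivHaarChar ν := by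
  have h1 := map_haarOf_eq_smul KH φ
  have hφ : Measurable φ := φ.continuous.measurable
  have hα : Measurable α := α.continuous.measurable
  have hν : Measurable ν := ν.continuous.measurable
  have h2 : (φ : H → H) ∘ e = e ∘ Prod.map α ν := by
    ext ⟨a, n⟩
    exact h a n
  rw [← map_prod_haarOf e he hp hK, Measure.map_map hφ (by fun_prop), h2,
    ← Measure.map_map (by fun_prop) (hα.prodMap hν), ← Measure.map_prod_map _ _ hα hν,
    map_haarOf_eq_smul, map_haarOf_eq_smul, Measure.prod_smul_left, Measure.prod_smul_right,
    smul_smul, Measure.map_smul, map_prod_haarOf e he hp hK] at h1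
  have h3 := smul_haarOf_injective KH h1
  rw [← mul_inv] at h3
  exact (inv_injective h3).symm

/-- The modular character of a semidirect product `H = A N`, with `A` commutative, at an element of
`A`: it measures how conjugation scales the Haar measure of `N`. -/
theorem modularCharacter_semidirect (he : ∀ a n, e (a, n) = i a * j n)
    (hp : ∀ n a, (e.symm (j n * i a)).1 = a)
    (hK : ∀ a n, e (a, n) ∈ KH ↔ a ∈ KA ∧ n ∈ KN) (hcomm : ∀ a b : A, a * b = b * a)
    (t : A) (φ : N ≃ₜ* N) (hφ : ∀ n, i t * j n * (i t)⁻¹ = j (φ n)) :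
    Measure.modularCharacter (i t) = mulEquivHaarChar φ := by
  change Measure.modularCharacterFun (i t) = _
  have hm := Measure.map_right_mul_eq_modularCharacterFun_smul (haarOf KH) (i t)
  -- `a n t = (t a)(t⁻¹ n t)` as `A` is commutative. The first component is a left translation and
  -- preserves the measure, so only the conjugation on `N` counts.
  have h2 : (fun x => x * i t) ∘ e = e ∘ Prod.map (fun a => t * a) φ.symm := by
    ext ⟨a, n⟩
    have h3 := hφ (φ.symm n)
    rw [φ.apply_symm_apply] at h3
    simp only [Function.comp_apply, he, Prod.map_apply, ← h3, hcomm t a, map_mul]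
    group
  have hs : Measurable φ.symm := φ.symm.continuous.measurable
  have ht : Measurable fun a : A => t * a := by fun_prop
  rw [← map_prod_haarOf e he hp hK, Measure.map_map (by fun_prop) (by fun_prop), h2,
    ← Measure.map_map (by fun_prop) (ht.prodMap hs), ← Measure.map_prod_map _ _ ht hs,
    map_mul_left_eq_self, map_haarOf_eq_smul, Measure.prod_smul_right, Measure.map_smul,
    map_prod_haarOf e he hp hK, mulEquivHaarChar_symm, inv_inv] at hm
  exact (smul_haarOf_injective KH hm).symm

end Semidirect

end

section

/-! ### Conjugation on closed subgroups and the factor by which it scales volume. -/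

section Conj

variable {G : Type*} [Group G] [TopologicalSpace G] [IsTopologicalGroup G]

instance secondCountableTopology_subgroup [SecondCountableTopology G] (H : Subgroup G) :
    SecondCountableTopology H :=
  TopologicalSpace.Subtype.secondCountableTopology (H : Set G)

theorem conj_mem_of_mem_normalizer {N : Subgroup G} {g : G}
    (hg : g ∈ Subgroup.normalizer (N : Set G)) {n : G} (hn : n ∈ N) : g * n * g⁻¹ ∈ N :=
  (Subgroup.mem_normalizer_iff.1 hg n).1 hn

theorem inv_conj_mem_of_mem_normalizer {N : Subgroup G} {g : G}
    (hg : g ∈ Subgroup.normalizer (N : Set G)) {n : G} (hn : n ∈ N) : g⁻¹ * n * g ∈ N := by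
  have h := conj_mem_of_mem_normalizer (inv_mem hg) hn
  rwa [inv_inv] at h

/-- Conjugation by an element of the normalizer of `N`, as a topological automorphism of `N`. -/
def conjEquiv (N : Subgroup G) (g : G) (hg : g ∈ Subgroup.normalizer (N : Set G)) : N ≃ₜ* N where
  toFun n := ⟨g * n * g⁻¹, conj_mem_of_mem_normalizer hg n.2⟩
  invFun n := ⟨g⁻¹ * n * g, inv_conj_mem_of_mem_normalizer hg n.2⟩
  left_inv n := Subtype.ext (by
    change g⁻¹ * (g * n * g⁻¹) * g = n
    group)
  right_inv n := Subtype.ext (by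
    change g * (g⁻¹ * n * g) * g⁻¹ = n
    group)
  map_mul' a b := Subtype.ext (by
    change g * (a * b) * g⁻¹ = g * a * g⁻¹ * (g * b * g⁻¹)
    group)
  continuous_toFun := ((continuous_subtype_val.const_mul g).mul_const g⁻¹).subtype_mk _
  continuous_invFun := ((continuous_subtype_val.const_mul g⁻¹).mul_const g).subtype_mk _

theorem coe_conjEquiv (N : Subgroup G) {g : G} (hg : g ∈ Subgroup.normalizer (N : Set G)) (n : N) :
    (conjEquiv N g hg n : G) = g * n * g⁻¹ := rfl

/-- The open subgroup `K ∩ H` of `H`. -/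
def interOpen (K : OpenSubgroup G) (H : Subgroup G) : OpenSubgroup H :=
  K.comap H.subtype continuous_subtype_val

theorem mem_interOpen {K : OpenSubgroup G} {H : Subgroup G} (h : H) :
    h ∈ interOpen K H ↔ (h : G) ∈ K := Iff.rfl

variable [MeasurableSpace G] [BorelSpace G]

/-- The factor by which conjugation by `g` scales the Haar measure of `N`. -/
def conjChar (N : Subgroup G) [LocallyCompactSpace N] (g : G)
    (hg : g ∈ Subgroup.normalizer (N : Set G)) : ℝ≥0 :=
  mulEquivHaarChar (conjEquiv N g hg)

theorem conjChar_pos (N : Subgroup G) [LocallyCompactSpace N] {g : G}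
    (hg : g ∈ Subgroup.normalizer (N : Set G)) : 0 < conjChar N g hg := mulEquivHaarChar_pos _

theorem conjChar_mul (N : Subgroup G) [LocallyCompactSpace N] {g h : G}
    (hg : g ∈ Subgroup.normalizer (N : Set G)) (hh : h ∈ Subgroup.normalizer (N : Set G)) :
    conjChar N (g * h) (mul_mem hg hh) = conjChar N g hg * conjChar N h hh := by
  have h1 : conjEquiv N (g * h) (mul_mem hg hh) =
      (conjEquiv N h hh).trans (conjEquiv N g hg) := by
    ext n
    change g * h * n * (g * h)⁻¹ = g * (h * n * h⁻¹) * g⁻¹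
    group
  rw [conjChar, h1, mulEquivHaarChar_trans, mul_comm]
  rfl

theorem conjChar_inv (N : Subgroup G) [LocallyCompactSpace N] {g : G}
    (hg : g ∈ Subgroup.normalizer (N : Set G)) :
    conjChar N g⁻¹ (inv_mem hg) = (conjChar N g hg)⁻¹ := by
  rw [conjChar, conjChar, ← mulEquivHaarChar_symm]
  congr 1
  ext n
  change g⁻¹ * n * g⁻¹⁻¹ = g⁻¹ * n * g
  group

theorem conjChar_congr (N : Subgroup G) [LocallyCompactSpace N] {g h : G}
    (hg : g ∈ Subgroup.normalizer (N : Set G)) (hh : h ∈ Subgroup.normalizer (N : Set G))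
    (H : ∀ n ∈ N, g * n * g⁻¹ = h * n * h⁻¹) : conjChar N g hg = conjChar N h hh := by
  rw [conjChar, conjChar]
  congr 1
  ext n
  exact H n n.2

/-- Conjugation by an element of `K` preserves `K ∩ N`, a set of positive finite volume. -/
theorem conjChar_eq_one {K : OpenSubgroup G} (N : Subgroup G) [LocallyCompactSpace N]
    [CompactSpace (interOpen K N)] {g : G}
    (hg : g ∈ Subgroup.normalizer (N : Set G)) (hgK : g ∈ K) : conjChar N g hg = 1 := by
  refine mulEquivHaarChar_eq_one (interOpen K N) _ fun x => ?_
  rw [mem_interOpen, mem_interOpen, coe_conjEquiv]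
  have hgK' : g⁻¹ ∈ K := inv_mem hgK
  rw [mul_mem_cancel_right hgK', mul_mem_cancel_left hgK]

theorem integral_conj {K : OpenSubgroup G} (N : Subgroup G) [LocallyCompactSpace N]
    [CompactSpace (interOpen K N)] {g : G}
    (hg : g ∈ Subgroup.normalizer (N : Set G)) (f : G → ℂ) :
    ∫ n : N, f (g * n * g⁻¹) ∂(haarOf (interOpen K N)) =
      ((conjChar N g hg : ℝ) : ℂ)⁻¹ * ∫ n : N, f n ∂(haarOf (interOpen K N)) :=
  integral_comp_equiv (interOpen K N) (conjEquiv N g hg) fun n => f n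

/-- A decomposition `H = A ⋉ N` of closed subgroups of `G`, compatible with the compact open
subgroup `K`. -/
structure Semidirect (K : OpenSubgroup G) (A N H : Subgroup G) where
  leA : A ≤ H
  leN : N ≤ H
  proj : H →* A
  continuous_proj : Continuous proj
  proj_left : ∀ a : A, proj (Subgroup.inclusion leA a) = a
  proj_right : ∀ n : N, proj (Subgroup.inclusion leN n) = 1
  mem_of_proj : ∀ h, proj h = 1 → (h : G) ∈ N
  proj_mem : ∀ h : H, (h : G) ∈ K → (proj h : G) ∈ K

namespace Semidirect

variable {K : OpenSubgroup G} {A N H : Subgroup G} (D : Semidirect K A N H)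

-- `N` is normal in `H`, being the kernel of `proj`.
include D in
theorem le_normalizer : H ≤ Subgroup.normalizer (N : Set G) := by
  have key : ∀ h : H, ∀ n ∈ N, (h : G) * n * (h : G)⁻¹ ∈ N := by
    intro h n hn
    have := D.mem_of_proj (h * ⟨n, D.leN hn⟩ * h⁻¹) (by
      rw [map_mul, map_mul, map_inv]
      have := D.proj_right ⟨n, hn⟩
      change D.proj ⟨n, D.leN hn⟩ = 1 at this
      rw [this, mul_one, mul_inv_cancel])
    exact this
  intro h hh
  rw [Subgroup.mem_normalizer_iff]
  refine fun n => ⟨key ⟨h, hh⟩ n, fun hn => ?_⟩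
  have := key (⟨h, hh⟩⁻¹) _ hn
  have h2 : h⁻¹ * (h * n * h⁻¹) * h⁻¹⁻¹ = n := by group
  exact h2 ▸ this

/-- The homeomorphism `A × N ≃ H`. -/
def homeo : A × N ≃ₜ H where
  toFun p := Subgroup.inclusion D.leA p.1 * Subgroup.inclusion D.leN p.2
  invFun h := (D.proj h, ⟨(D.proj h : G)⁻¹ * h, by
    have := D.mem_of_proj (Subgroup.inclusion D.leA (D.proj h)⁻¹ * h) (by
      rw [map_mul, D.proj_left, inv_mul_cancel])
    exact this⟩)
  left_inv p := by
    have h1 : D.proj (Subgroup.inclusion D.leA p.1 * Subgroup.inclusion D.leN p.2) = p.1 := by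
      rw [map_mul, D.proj_left, D.proj_right, mul_one]
    ext
    · simp [h1]
    · simp [h1]
  right_inv h := by
    ext
    simp
  continuous_toFun := by
    refine Continuous.subtype_mk (f := fun p : A × N => (p.1 : G) * p.2) ?_ _
    fun_prop
  continuous_invFun := by
    have := D.continuous_proj
    refine this.prodMk (Continuous.subtype_mk ?_ _)
    fun_prop

theorem homeo_apply (a : A) (n : N) :
    D.homeo (a, n) = Subgroup.inclusion D.leA a * Subgroup.inclusion D.leN n := rfl

theorem homeo_symm_fst (n : N) (a : A) :
    (D.homeo.symm (Subgroup.inclusion D.leN n * Subgroup.inclusion D.leA a)).1 = a := by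
  change D.proj _ = a
  rw [map_mul, D.proj_left, D.proj_right, one_mul]

/-- By `proj_mem` the `A`-part of an element of `K ∩ H` lies in `K`, hence so does its `N`-part.
This makes the product of the normalised Haar measures normalised again. -/
theorem homeo_mem (a : A) (n : N) :
    D.homeo (a, n) ∈ interOpen K H ↔ a ∈ interOpen K A ∧ n ∈ interOpen K N := by
  constructor
  · intro h
    have h1 : (a : G) ∈ K := by
      have := D.proj_mem _ h
      rwa [homeo_apply, map_mul, D.proj_left, D.proj_right, mul_one] at this
    refine ⟨h1, ?_⟩
    have h2 : (a : G) * n ∈ K := h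
    exact (mul_mem_cancel_left h1).1 h2
  · rintro ⟨h1, h2⟩
    have : (a : G) * n ∈ K := mul_mem h1 h2
    exact this

variable [SecondCountableTopology G] [LocallyCompactSpace H] [LocallyCompactSpace A]
  [LocallyCompactSpace N] [CompactSpace (interOpen K H)] [CompactSpace (interOpen K A)]
  [CompactSpace (interOpen K N)]

include D in
theorem integral {f : G → ℂ} (hf : Continuous f) (hc : HasCompactSupport fun h : H => f h) :
    ∫ h : H, f h ∂(haarOf (interOpen K H)) =
      ∫ a : A, ∫ n : N, f (a * n) ∂(haarOf (interOpen K N)) ∂(haarOf (interOpen K A)) :=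
  integral_semidirect D.homeo D.homeo_apply D.homeo_symm_fst D.homeo_mem
    (f := fun h : H => f h) (by fun_prop) hc

include D in
theorem conjChar_eq {g : G} (hH : g ∈ Subgroup.normalizer (H : Set G))
    (hA : g ∈ Subgroup.normalizer (A : Set G)) (hN : g ∈ Subgroup.normalizer (N : Set G)) :
    conjChar H g hH = conjChar A g hA * conjChar N g hN := by
  refine mulEquivHaarChar_semidirect D.homeo D.homeo_apply D.homeo_symm_fst D.homeo_mem _ _ _ ?_
  intro a n
  ext
  change g * (a * n) * g⁻¹ = (g * a * g⁻¹) * (g * n * g⁻¹)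
  group

theorem modularCharacter_eq (hcomm : ∀ a b : A, a * b = b * a) (t : A)
    (ht : (t : G) ∈ Subgroup.normalizer (N : Set G)) :
    Measure.modularCharacter (Subgroup.inclusion D.leA t) = conjChar N t ht :=
  modularCharacter_semidirect D.homeo D.homeo_apply D.homeo_symm_fst D.homeo_mem hcomm t
    (conjEquiv N t ht) fun _ => rfl

end Semidirect

end Conj

/-! ### Integrals over cosets of `N`: reflection invariance and compatibility with convolution. -/

section Satake

variable {G : Type*} [Group G] [TopologicalSpace G] [IsTopologicalGroup G] [MeasurableSpace G]
  [BorelSpace G] [SecondCountableTopology G] {K : OpenSubgroup G} [CompactSpace K]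

theorem hasCompactSupport_restrict {H : Subgroup G} (hH : IsClosed (H : Set G)) {f : G → ℂ}
    (hf : HasCompactSupport f) (x : G) : HasCompactSupport fun h : H => f (x * h) :=
  (hf.comp_homeomorph (Homeomorph.mulLeft x)).comp_isClosedEmbedding hH.isClosedEmbedding_subtypeVal

/-- The integral of a function over the coset `x N`. -/
def orbitIntegral (K : OpenSubgroup G) (N : Subgroup G) [CompactSpace (interOpen K N)] (f : G → ℂ)
    (x : G) : ℂ := ∫ n : N, f (x * n) ∂(haarOf (interOpen K N))

section orbitIntegral

variable {N : Subgroup G} [CompactSpace (interOpen K N)]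

theorem orbitIntegral_mul_left (f : HeckeAlgebra K) {k : G} (hk : k ∈ K) (x : G) :
    orbitIntegral K N f (k * x) = orbitIntegral K N f x := by
  unfold orbitIntegral
  simp only [mul_assoc, f.left_invariant hk]

theorem orbitIntegral_mul_mem (f : G → ℂ) {m : G} (hm : m ∈ N) (x : G) :
    orbitIntegral K N f (x * m) = orbitIntegral K N f x := by
  have := integral_mul_left_eq_self (μ := haarOf (interOpen K N)) (fun n : N => f (x * n)) ⟨m, hm⟩
  unfold orbitIntegral
  rw [← this]
  simp only [Subgroup.coe_mul, mul_assoc]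

/-- Write `x k n = x (k n k⁻¹) k`: the last factor is absorbed by `f`, and conjugation by `k`
preserves the measure of `N`. -/
theorem orbitIntegral_mul_right [LocallyCompactSpace N] (f : HeckeAlgebra K) {k : G} (hk : k ∈ K)
    (hkN : k ∈ Subgroup.normalizer (N : Set G)) (x : G) :
    orbitIntegral K N f (x * k) = orbitIntegral K N f x := by
  have h := integral_conj (K := K) N hkN fun n => f (x * n)
  rw [conjChar_eq_one N hkN hk] at h
  simp only [NNReal.coe_one, Complex.ofReal_one, inv_one, one_mul] at h
  unfold orbitIntegral
  rw [← h]
  congr 1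
  ext n
  have h1 : x * k * n = x * (k * n * k⁻¹) * k := by group
  rw [h1, f.right_invariant hk]

/-- Moving `t` to the left of `n` replaces `n` by `t⁻¹ n t`, at the cost of the Jacobian. -/
theorem orbitIntegral_conj [LocallyCompactSpace N] (f : G → ℂ) {t : G}
    (ht : t ∈ Subgroup.normalizer (N : Set G)) :
    ∫ n : N, f (n * t) ∂(haarOf (interOpen K N)) =
      ((conjChar N t ht : ℝ) : ℂ) * orbitIntegral K N f t := by
  have h := integral_conj (K := K) N ht fun n => f (n * t)
  have h2 : ∫ n : N, f (t * n * t⁻¹ * t) ∂(haarOf (interOpen K N)) = orbitIntegral K N f t := by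
    simp only [inv_mul_cancel_right]
    rfl
  have h3 : ((conjChar N t ht : ℝ) : ℂ) ≠ 0 := by
    exact_mod_cast (conjChar_pos N ht).ne'
  rw [h2] at h
  rw [h, mul_inv_cancel_left₀ h3]

theorem continuous_orbitIntegral_integrand (f : HeckeAlgebra K) (x : G) :
    Continuous fun n : N => f (x * n) := by
  have := f.continuous
  fun_prop

end orbitIntegral

/-- Invariance of the normalised integrals of `f` over cosets of `N = U ⋉ N'` under an element
`w` of `K` that normalises `N'`. -/
theorem sqrt_conjChar_mul_orbitIntegral {U N' N : Subgroup G} (D : Semidirect K U N' N)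
    (hN : IsClosed (N : Set G))
    [LocallyCompactSpace N] [LocallyCompactSpace U] [LocallyCompactSpace N']
    [CompactSpace (interOpen K N)] [CompactSpace (interOpen K U)] [CompactSpace (interOpen K N')]
    (f : HeckeAlgebra K) {t t' w : G} (ht' : w * t * w⁻¹ = t') (hw : w ∈ K)
    (hwN' : w ∈ Subgroup.normalizer (N' : Set G))
    (htN : t ∈ Subgroup.normalizer (N : Set G)) (htU : t ∈ Subgroup.normalizer (U : Set G))
    (htN' : t ∈ Subgroup.normalizer (N' : Set G)) (htN₂ : t' ∈ Subgroup.normalizer (N : Set G))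
    (htU₂ : t' ∈ Subgroup.normalizer (U : Set G)) (hconj : ∀ u ∈ U, t' * u * t'⁻¹ = t⁻¹ * u * t)
    (hdc : ∀ u ∈ U, ∃ k₁ ∈ K, ∃ k₂ ∈ K, k₂ ∈ Subgroup.normalizer (N' : Set G) ∧
      u * t' = k₁ * (t * u) * k₂) :
    (Real.sqrt (conjChar N t htN) : ℂ) * orbitIntegral K N f t =
      (Real.sqrt (conjChar N t' htN₂) : ℂ) * orbitIntegral K N f t' := by
  have hI : ∀ x, orbitIntegral K N f x =
      ∫ u : U, orbitIntegral K N' f (x * u) ∂(haarOf (interOpen K U)) := by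
    intro x
    have hf := f.continuous
    have := D.integral (f := fun n => f (x * n)) (by fun_prop)
      (hasCompactSupport_restrict hN f.hasCompactSupport x)
    refine this.trans ?_
    simp only [← mul_assoc]
    rfl
  have htN'₂ : t' ∈ Subgroup.normalizer (N' : Set G) := by
    rw [← ht']
    exact mul_mem (mul_mem hwN' htN') (inv_mem hwN')
  have hcN' : conjChar N' t' htN'₂ = conjChar N' t htN' := by
    subst ht'
    rw [conjChar_mul N' (mul_mem hwN' htN') (inv_mem hwN'), conjChar_mul N' hwN' htN',
      conjChar_inv N' hwN',
      conjChar_eq_one N' hwN' hw]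
    simp
  -- The reflection inverts the root: `t'` acts on `U` as `t⁻¹` does, whereas the action on `N'`
  -- keeps its Jacobian.
  have hcU : conjChar U t' htU₂ = (conjChar U t htU)⁻¹ := by
    rw [← conjChar_inv]
    refine conjChar_congr _ _ _ fun u hu => ?_
    rw [hconj u hu, inv_inv]
  -- Integrate over `N'` inside and over `U` outside. By `hdc` the inner integrals at `t u` and at
  -- `u t'` agree, and moving `t'` back to the left of `u` produces the Jacobian of `U`.
  have h1 : orbitIntegral K N f t = ((conjChar U t' htU₂ : ℝ) : ℂ) * orbitIntegral K N f t' := by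
    rw [hI t, hI t']
    have h2 : ∀ u : U, orbitIntegral K N' f (t * u) = orbitIntegral K N' f (u * t') := by
      intro u
      obtain ⟨k₁, hk₁, k₂, hk₂, hk₂N, h3⟩ := hdc u u.2
      rw [h3, orbitIntegral_mul_right f hk₂ hk₂N, orbitIntegral_mul_left f hk₁]
    simp only [h2]
    exact orbitIntegral_conj (orbitIntegral K N' f) htU₂
  rw [h1, D.conjChar_eq htN htU htN', D.conjChar_eq htN₂ htU₂ htN'₂, hcN', hcU, ← mul_assoc]
  congr 1
  -- With `a` and `b` the Jacobians of `t` on `U` and `N'`, what is left is `√(a b) · a⁻¹ = √(a⁻¹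
  -- b)`.
  have ha := conjChar_pos U htU
  generalize conjChar U t htU = a at ha
  generalize conjChar N' t htN' = b
  have ha' : (0 : ℝ) < a := ha
  rw [← Complex.ofReal_mul]
  congr 1
  push_cast
  rw [Real.sqrt_mul ha'.le, Real.sqrt_mul (inv_nonneg.2 ha'.le), Real.sqrt_inv]
  have h4 : (a : ℝ)⁻¹ = (Real.sqrt a)⁻¹ * (Real.sqrt a)⁻¹ := by
    rw [← mul_inv, Real.mul_self_sqrt ha'.le]
  have h5 : Real.sqrt a ≠ 0 := (Real.sqrt_pos.2 ha').ne'
  rw [h4]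
  field_simp

/-- The integral over cosets of `N` takes convolution on `G = B K` to convolution on `T`. -/
theorem orbitIntegral_mul {T N B : Subgroup G} (D : Semidirect K T N B)
    (hB : IsClosed (B : Set G)) (hN : IsClosed (N : Set G)) (hBK : ∀ g, ∃ b ∈ B, ∃ k ∈ K, g = b * k)
    [LocallyCompactSpace B] [LocallyCompactSpace T] [LocallyCompactSpace N]
    [CompactSpace (interOpen K B)] [CompactSpace (interOpen K T)] [CompactSpace (interOpen K N)]
    (f g : HeckeAlgebra K) (t : T) :
    orbitIntegral K N (f * g : HeckeAlgebra K) t = ∫ s : T, orbitIntegral K N f s *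
      orbitIntegral K N g ((s⁻¹ * t : T) : G) ∂(haarOf (interOpen K T)) := by
  have hf := f.continuous
  have hg := g.continuous
  have hfB : HasCompactSupport fun b : B => f b := by
    simpa using hasCompactSupport_restrict hB f.hasCompactSupport 1
  -- The integrand of a convolution is right `K`-invariant, so `G = B K` reduces the integral to
  -- `B`.
  have h1 : ∀ x : G, (f * g) x = ∫ b : B, f b * g ((b : G)⁻¹ * x) ∂(haarOf (interOpen K B)) := by
    intro x
    rw [HeckeAlgebra.mul_apply]
    refine integral_eq_integral_of_factorization (KB := interOpen K B) (K := K) B.subtype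
      (h := fun y => f y * g (y⁻¹ * x)) (fun _ => Iff.rfl) ?_ ?_ ?_ ?_
    · intro y
      obtain ⟨b, hb, k, hk, rfl⟩ := hBK y
      exact ⟨⟨b, hb⟩, k, hk, rfl⟩
    · intro k hk y
      rw [f.right_invariant hk, mul_inv_rev, mul_assoc, g.left_invariant (inv_mem hk)]
    · exact HeckeAlgebra.hasCompactSupport_integrand f g x
    · exact hfB.mul_right
  have h2 : orbitIntegral K N (f * g : HeckeAlgebra K) t =
      ∫ b : B, f b * orbitIntegral K N g ((b : G)⁻¹ * t) ∂(haarOf (interOpen K B)) := by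
    unfold orbitIntegral
    simp only [h1]
    have hcont : Continuous fun p : N × B => f p.2 * g ((p.2 : G)⁻¹ * (t * p.1)) := by fun_prop
    rw [integral_integral_swap_of_hasCompactSupport
      (f := fun (n : N) (b : B) => f b * g ((b : G)⁻¹ * (t * n)))]
    · simp only [integral_const_mul, mul_assoc]
    · exact hcont
    · have hc1 : IsCompact (((t : G)⁻¹) • (tsupport f * tsupport g) : Set G) :=
        (f.hasCompactSupport.isCompact.mul g.hasCompactSupport.isCompact).smul _
      have hc2 : IsCompact (((↑) : N → G) ⁻¹' (((t : G)⁻¹) • (tsupport f * tsupport g) : Set G)) :=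
        hN.isClosedEmbedding_subtypeVal.isCompact_preimage hc1
      have hc3 : IsCompact (((↑) : B → G) ⁻¹' (tsupport f)) :=
        hB.isClosedEmbedding_subtypeVal.isCompact_preimage f.hasCompactSupport.isCompact
      refine HasCompactSupport.intro (hc2.prod hc3) ?_
      rintro ⟨n, b⟩ hnb
      by_contra hne
      have hb : (b : G) ∈ tsupport f := subset_tsupport _ (left_ne_zero_of_mul hne)
      have hn : (b : G)⁻¹ * (t * n) ∈ tsupport g := subset_tsupport _ (right_ne_zero_of_mul hne)
      refine hnb ⟨?_, hb⟩
      rw [Set.mem_preimage, Set.mem_smul_set_iff_inv_smul_mem]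
      exact ⟨_, hb, _, hn, by simp⟩
  rw [h2]
  have hcontI : Continuous fun x : G => f x * orbitIntegral K N g (x⁻¹ * t) := by
    refine HeckeAlgebra.continuous_of_right_invariant (K := K) fun k hk x => ?_
    rw [f.right_invariant hk, mul_inv_rev, mul_assoc, orbitIntegral_mul_left g (inv_mem hk)]
  rw [D.integral hcontI hfB.mul_right]
  refine integral_congr_ae (Filter.Eventually.of_forall fun s => ?_)
  -- `(s n)⁻¹ t = n⁻¹ s⁻¹ t`, and `n⁻¹` passes to the right of `s⁻¹ t` as another element of `N`,
  -- where the integral does not see it.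
  have h3 : ∀ n : N, orbitIntegral K N g (((s : G) * n)⁻¹ * t) =
      orbitIntegral K N g ((s⁻¹ * t : T) : G) := by
    intro n
    have htn : (t : G) ∈ Subgroup.normalizer (N : Set G) := D.le_normalizer (D.leA t.2)
    have hsn : (s : G) ∈ Subgroup.normalizer (N : Set G) := D.le_normalizer (D.leA s.2)
    have hm := mul_mem (inv_mem hsn) htn
    have h4 : ((s : G) * n)⁻¹ * t =
        ((s : G)⁻¹ * t) * (((s : G)⁻¹ * t)⁻¹ * (n : G)⁻¹ * ((s : G)⁻¹ * t)⁻¹⁻¹) := by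
      group
    rw [h4]
    exact orbitIntegral_mul_mem _ ((Subgroup.mem_normalizer_iff.1 (inv_mem hm) _).1 (inv_mem n.2)) _
  simp only [h3, integral_mul_const]
  rfl

end Satake

end

section

open Matrix

/-! ### Adjoints, permutation matrices and Eichler transformations in the unitary group. -/

section UnitaryAlgebra

variable {F E : Type*} [NontriviallyNormedField F] [NontriviallyNormedField E] [NormedAlgebra F E]
variable {c : E ≃ₐ[F] E} {r : ℕ}

theorem hermForm_add_left (x x' y : Fin (2 * r) → E) :
    hermForm c r (x + x') y = hermForm c r x y + hermForm c r x' y := by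
  simp [hermForm, add_mul, Finset.sum_add_distrib]

theorem hermForm_add_right (x y y' : Fin (2 * r) → E) :
    hermForm c r x (y + y') = hermForm c r x y + hermForm c r x y' := by
  simp [hermForm, mul_add, Finset.sum_add_distrib]

theorem hermForm_smul_left (a : E) (x y : Fin (2 * r) → E) :
    hermForm c r (a • x) y = a * hermForm c r x y := by
  simp [hermForm, Finset.mul_sum, mul_assoc]

theorem hermForm_smul_right (a : E) (x y : Fin (2 * r) → E) :
    hermForm c r x (a • y) = c a * hermForm c r x y := by
  simp [hermForm, Finset.mul_sum, mul_left_comm]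

theorem hermForm_single_left (i : Fin (2 * r)) (a : E) (y : Fin (2 * r) → E) :
    hermForm c r (Pi.single i a) y = a * c (y i.rev) := by
  rw [hermForm, Finset.sum_eq_single i]
  · simp
  · intro j _ hj
    simp [hj]
  · simp

theorem hermForm_single_right (i : Fin (2 * r)) (a : E) (x : Fin (2 * r) → E) :
    hermForm c r x (Pi.single i a) = x i.rev * c a := by
  rw [hermForm, Finset.sum_eq_single i.rev]
  · simp
  · intro j _ hj
    have : j.rev ≠ i := fun h => hj (by rw [← h, Fin.rev_rev])
    simp [this]
  · simp

theorem conj_hermForm [Algebra.IsQuadraticExtension F E] (x y : Fin (2 * r) → E) :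
    c (hermForm c r x y) = hermForm c r y x := by
  rw [hermForm, hermForm, map_sum, ← Equiv.sum_comp Fin.revPerm]
  refine Finset.sum_congr rfl fun i _ => ?_
  simp [conj_conj_apply, mul_comm]

theorem rev_ne_self (k : Fin (2 * r)) : k.rev ≠ k := by
  intro h
  have := congrArg Fin.val h
  rw [Fin.val_rev] at this
  omega

theorem rev_eq_comm {i k : Fin (2 * r)} : i.rev = k ↔ k.rev = i :=
  ⟨fun h => by rw [← h, Fin.rev_rev], fun h => by rw [← h, Fin.rev_rev]⟩

/-- The adjoint of a matrix with respect to the hermitian form. -/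
def hermAdj (c : E ≃ₐ[F] E) (r : ℕ) (M : Matrix (Fin (2 * r)) (Fin (2 * r)) E) :
    Matrix (Fin (2 * r)) (Fin (2 * r)) E := of fun i j => c (M j.rev i.rev)

theorem hermAdj_apply (M : Matrix (Fin (2 * r)) (Fin (2 * r)) E) (i j : Fin (2 * r)) :
    hermAdj c r M i j = c (M j.rev i.rev) := rfl

theorem hermAdj_transpose (M : Matrix (Fin (2 * r)) (Fin (2 * r)) E) :
    hermAdj c r Mᵀ = (hermAdj c r M)ᵀ := rfl

theorem hermAdj_mul_apply (M : Matrix (Fin (2 * r)) (Fin (2 * r)) E) (i j : Fin (2 * r)) :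
    (hermAdj c r M * M) i j = hermForm c r (M.col j) (M.col i.rev) := by
  rw [mul_apply, hermForm]
  refine Finset.sum_congr rfl fun k _ => ?_
  simp [hermAdj, mul_comm]

/-- The entries of `hermAdj c r M * M` are the hermitian products of the columns of `M`, that is, of
the images of the basis vectors. By sesquilinearity these products decide whether `M` is an
isometry, which gives the converse `hermForm_mulVec_of_hermAdj`. -/
theorem hermAdj_mul_eq_one {M : Matrix (Fin (2 * r)) (Fin (2 * r)) E}
    (h : ∀ x y, hermForm c r (M *ᵥ x) (M *ᵥ y) = hermForm c r x y) : hermAdj c r M * M = 1 := by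
  ext i j
  have h1 := h (Pi.single j 1) (Pi.single i.rev 1)
  rw [mulVec_single_one, mulVec_single_one, hermForm_single_left] at h1
  rw [hermAdj_mul_apply, h1, one_mul, Pi.single_apply, one_apply]
  have : j.rev = i.rev ↔ i = j := by rw [Fin.rev_inj, eq_comm]
  simp only [this]
  split_ifs <;> simp

theorem hermForm_mulVec_of_hermAdj {M : Matrix (Fin (2 * r)) (Fin (2 * r)) E}
    (h : hermAdj c r M * M = 1) (x y : Fin (2 * r) → E) :
    hermForm c r (M *ᵥ x) (M *ᵥ y) = hermForm c r x y := by
  have h1 : ∀ x, M *ᵥ x = ∑ j, x j • M.col j := fun x => by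
    ext i
    simp [mulVec, dotProduct, mul_comm]
  have hl : ∀ (s : Finset (Fin (2 * r))) (f : Fin (2 * r) → Fin (2 * r) → E) y,
      hermForm c r (∑ j ∈ s, f j) y = ∑ j ∈ s, hermForm c r (f j) y := by
    intro s f y
    classical
    induction s using Finset.induction_on with
    | empty => simp [hermForm]
    | insert a s ha ih => rw [Finset.sum_insert ha, Finset.sum_insert ha, hermForm_add_left, ih]
  have hr : ∀ (s : Finset (Fin (2 * r))) (f : Fin (2 * r) → Fin (2 * r) → E) y,
      hermForm c r y (∑ j ∈ s, f j) = ∑ j ∈ s, hermForm c r y (f j) := by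
    intro s f y
    classical
    induction s using Finset.induction_on with
    | empty => simp [hermForm]
    | insert a s ha ih => rw [Finset.sum_insert ha, Finset.sum_insert ha, hermForm_add_right, ih]
  rw [h1, h1, hl]
  refine Finset.sum_congr rfl fun j _ => ?_
  rw [hr, Finset.sum_eq_single j.rev]
  · have := hermAdj_mul_apply (c := c) M j j
    rw [h, one_apply_eq] at this
    rw [hermForm_smul_left, hermForm_smul_right, ← this, mul_one]
  · intro i _ hi
    have := hermAdj_mul_apply (c := c) M i.rev j
    rw [h, one_apply_ne (fun h' => hi (by rw [← h', Fin.rev_rev])), Fin.rev_rev] at this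
    rw [hermForm_smul_left, hermForm_smul_right, ← this, mul_zero, mul_zero]
  · simp

/-- The element of the unitary group with a given matrix. -/
def unitaryOf (M : Matrix (Fin (2 * r)) (Fin (2 * r)) E) (h : hermAdj c r M * M = 1) :
    unitaryGp c r :=
  ⟨⟨M, hermAdj c r M, mul_eq_one_comm.1 h, h⟩, hermForm_mulVec_of_hermAdj h⟩

theorem hermAdj_mat_mul (g : unitaryGp c r) : hermAdj c r (mat g) * mat g = 1 :=
  hermAdj_mul_eq_one g.2

theorem mat_inv (g : unitaryGp c r) : mat g⁻¹ = hermAdj c r (mat g) := by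
  have := congrArg (· * mat g⁻¹) (hermAdj_mat_mul g)
  simpa [Matrix.mul_assoc, mat_mul_inv] using this.symm

theorem mat_inv_apply (g : unitaryGp c r) (i j : Fin (2 * r)) :
    mat g⁻¹ i j = c (mat g j.rev i.rev) := by rw [mat_inv, hermAdj_apply]

theorem hermForm_col (g : unitaryGp c r) (i j : Fin (2 * r)) :
    hermForm c r ((mat g).col i) ((mat g).col j) = if i.rev = j then 1 else 0 := by
  have := hermAdj_mul_apply (c := c) (mat g) j.rev i
  rw [hermAdj_mat_mul, Fin.rev_rev] at this
  rw [← this, one_apply]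
  congr 1
  exact propext ⟨fun h => by rw [← h, Fin.rev_rev], fun h => by rw [← h, Fin.rev_rev]⟩

/-- Transposition, an anti-automorphism of the unitary group. -/
def transposeElt (g : unitaryGp c r) : unitaryGp c r :=
  unitaryOf (mat g)ᵀ (by
    rw [hermAdj_transpose, ← transpose_mul, ← mat_inv, mat_mul_inv, transpose_one])

@[simp] theorem mat_transposeElt (g : unitaryGp c r) : mat (transposeElt g) = (mat g)ᵀ := rfl

theorem transposeElt_mul (g h : unitaryGp c r) :
    transposeElt (g * h) = transposeElt h * transposeElt g := by
  apply mat_injective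
  simp [mat_mul, transpose_mul]

theorem transposeElt_transposeElt (g : unitaryGp c r) : transposeElt (transposeElt g) = g := by
  apply mat_injective
  simp

/-- The permutation matrix of a permutation commuting with `i ↦ 2r + 1 - i`. -/
def permElt (c : E ≃ₐ[F] E) (π : Equiv.Perm (Fin (2 * r))) (hπ : ∀ i, π i.rev = (π i).rev) :
    unitaryGp c r :=
  unitaryOf (of fun i j => if i = π j then 1 else 0) (by
    ext i j
    rw [mul_apply, Finset.sum_eq_single (π j)]
    · have h1 : (π j).rev = π i.rev ↔ i = j := by
        rw [← hπ, π.injective.eq_iff, Fin.rev_inj, eq_comm]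
      simp only [hermAdj_apply, of_apply, if_true, mul_one, h1, one_apply]
      split_ifs <;> simp
    · intro k _ hk
      simp [hk]
    · simp)

theorem mat_permElt (π : Equiv.Perm (Fin (2 * r))) (hπ : ∀ i, π i.rev = (π i).rev)
    (i j : Fin (2 * r)) : mat (permElt c π hπ) i j = if i = π j then 1 else 0 := rfl

theorem permElt_mulVec (π : Equiv.Perm (Fin (2 * r))) (hπ : ∀ i, π i.rev = (π i).rev)
    (v : Fin (2 * r) → E) (i : Fin (2 * r)) :
    (mat (permElt c π hπ) *ᵥ v) i = v (π.symm i) := by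
  rw [mulVec, dotProduct, Finset.sum_eq_single (π.symm i)]
  · simp [mat_permElt]
  · intro j _ hj
    rw [mat_permElt, if_neg, zero_mul]
    rintro rfl
    simp at hj
  · simp

theorem mat_permElt_mul_apply (π : Equiv.Perm (Fin (2 * r))) (hπ : ∀ i, π i.rev = (π i).rev)
    (g : unitaryGp c r) (i j : Fin (2 * r)) :
    mat (permElt c π hπ * g) i j = mat g (π.symm i) j :=
  permElt_mulVec π hπ (fun k => mat g k j) i

theorem perm_symm_rev {π : Equiv.Perm (Fin (2 * r))} (hπ : ∀ i, π i.rev = (π i).rev)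
    (i : Fin (2 * r)) : π.symm i.rev = (π.symm i).rev := by
  rw [Equiv.symm_apply_eq, hπ, Equiv.apply_symm_apply]

theorem permElt_inv (π : Equiv.Perm (Fin (2 * r))) (hπ : ∀ i, π i.rev = (π i).rev) :
    (permElt c π hπ)⁻¹ = permElt c π.symm (perm_symm_rev hπ) := by
  apply mat_injective
  ext i j
  have h : j.rev = π i.rev ↔ i = π.symm j := by
    rw [hπ, Fin.rev_inj, Equiv.eq_symm_apply, eq_comm]
  rw [mat_inv_apply, mat_permElt, mat_permElt]
  simp only [h]
  split_ifs <;> simp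

theorem mat_mul_permElt_apply (π : Equiv.Perm (Fin (2 * r))) (hπ : ∀ i, π i.rev = (π i).rev)
    (g : unitaryGp c r) (i j : Fin (2 * r)) :
    mat (g * permElt c π hπ) i j = mat g i (π j) := by
  rw [mat_mul, mul_apply, Finset.sum_eq_single (π j)]
  · simp [mat_permElt]
  · intro k _ hk
    simp [mat_permElt, hk]
  · simp

theorem mat_permElt_conj_apply (π : Equiv.Perm (Fin (2 * r))) (hπ : ∀ i, π i.rev = (π i).rev)
    (g : unitaryGp c r) (i j : Fin (2 * r)) :
    mat (permElt c π hπ * g * (permElt c π hπ)⁻¹) i j = mat g (π.symm i) (π.symm j) := by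
  rw [permElt_inv, mat_mul_permElt_apply, mat_permElt_mul_apply]

/-- The diagonal element of the torus with given entries. -/
def diagElt (c : E ≃ₐ[F] E) (d : Fin (2 * r) → E) (hd : ∀ i, d i * c (d i.rev) = 1) : torus c r :=
  ⟨unitaryOf (diagonal d) (by
    have : hermAdj c r (diagonal d) = diagonal fun i => c (d i.rev) := by
      ext i j
      rw [hermAdj_apply, diagonal_apply, diagonal_apply]
      by_cases h : i = j
      · simp [h]
      · have h' : j.rev ≠ i.rev := fun h' => h (Fin.rev_injective h').symm
        simp [h, h']
    rw [this, diagonal_mul_diagonal, ← diagonal_one]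
    congr 1
    ext i
    rw [mul_comm, hd]), isDiag_diagonal _⟩

theorem mat_diagElt (d : Fin (2 * r) → E) (hd : ∀ i, d i * c (d i.rev) = 1) :
    mat (diagElt c d hd).1 = diagonal d := rfl

theorem mat_torus (t : torus c r) : mat t.1 = diagonal fun i => mat t.1 i i :=
  t.2.diagonal_diag.symm

theorem torus_apply_mul (t : torus c r) (i : Fin (2 * r)) :
    mat t.1 i i * c (mat t.1 i.rev i.rev) = 1 := by
  have h := congrFun (congrFun (hermAdj_mat_mul t.1) i) i
  rw [mat_torus t, mul_diagonal, hermAdj_apply, diagonal_apply_eq, one_apply_eq] at h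
  rw [mul_comm]
  exact h

theorem torus_apply_ne_zero (t : torus c r) (i : Fin (2 * r)) : mat t.1 i i ≠ 0 :=
  left_ne_zero_of_mul_eq_one (torus_apply_mul t i)

theorem torus_ext {s t : torus c r} (h : ∀ i, mat s.1 i i = mat t.1 i i) : s = t := by
  apply Subtype.ext
  apply mat_injective
  rw [mat_torus s, mat_torus t]
  simp [h]

theorem torus_mul_apply (s t : torus c r) (i : Fin (2 * r)) :
    mat (s * t).1 i i = mat s.1 i i * mat t.1 i i := by
  change (mat s.1 * mat t.1) i i = _
  rw [mat_torus s, diagonal_mul, diagonal_apply_eq]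

theorem torus_inv_apply (t : torus c r) (i : Fin (2 * r)) :
    mat (t⁻¹).1 i i = (mat t.1 i i)⁻¹ := by
  have := torus_mul_apply t⁻¹ t i
  rw [inv_mul_cancel] at this
  change mat 1 i i = _ at this
  rw [mat_one, one_apply_eq] at this
  exact eq_inv_of_mul_eq_one_left this.symm

theorem mat_torus_mul (t : torus c r) (g : unitaryGp c r) (i j : Fin (2 * r)) :
    mat (t.1 * g) i j = mat t.1 i i * mat g i j := by
  rw [mat_mul, mat_torus t, diagonal_mul, diagonal_apply_eq]

theorem mat_mul_torus (t : torus c r) (g : unitaryGp c r) (i j : Fin (2 * r)) :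
    mat (g * t.1) i j = mat g i j * mat t.1 j j := by
  rw [mat_mul, mat_torus t, mul_diagonal, diagonal_apply_eq]

theorem mat_torus_conj (t : torus c r) (g : unitaryGp c r) (i j : Fin (2 * r)) :
    mat (t.1 * g * t.1⁻¹) i j = mat t.1 i i * mat g i j * (mat t.1 j j)⁻¹ := by
  have h := mat_mul_torus t⁻¹ (t.1 * g) i j
  rw [mat_torus_mul, torus_inv_apply] at h
  exact h

section Eichler

variable [Algebra.IsQuadraticExtension F E]

/-- The matrix of the transformation `x ↦ x + x_k z - (∑_{j ≠ k} x_j c(z_{2r+1-j})) e_{2r+1-k}`. -/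
def eichlerMatrix (c : E ≃ₐ[F] E) (k : Fin (2 * r)) (z : Fin (2 * r) → E) :
    Matrix (Fin (2 * r)) (Fin (2 * r)) E :=
  of fun i j => (if i = j then 1 else 0) + (if j = k then z i else 0) -
    (if i = k.rev then (if j = k then 0 else c (z j.rev)) else 0)

/-- The matrix leaves out the term `j = k` of the form `(x, z)`, which is the source of the
correction `x_k c(z_{2r+1-k})`. -/
theorem eichlerMatrix_mulVec (k : Fin (2 * r)) (z x : Fin (2 * r) → E) :
    eichlerMatrix c k z *ᵥ x =
      x + x k • z + (x k * c (z k.rev) - hermForm c r x z) • Pi.single k.rev 1 := by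
  ext i
  have h1 : hermForm c r x z - x k * c (z k.rev) = ∑ j, (if j = k then 0 else c (z j.rev)) * x j := by
    rw [hermForm, sub_eq_iff_eq_add, ← Finset.sum_erase_add _ _ (Finset.mem_univ k)]
    congr 1
    rw [← Finset.sum_erase_add (a := k) _ _ (Finset.mem_univ k), if_pos rfl, zero_mul, add_zero]
    refine Finset.sum_congr rfl fun j hj => ?_
    rw [if_neg (Finset.ne_of_mem_erase hj), mul_comm]
  simp only [mulVec, dotProduct, eichlerMatrix, of_apply, sub_mul, add_mul, Finset.sum_sub_distrib,
    Finset.sum_add_distrib, ite_mul, one_mul, zero_mul, Finset.sum_ite_eq, Finset.sum_ite_eq',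
    Finset.mem_univ, if_true, Pi.add_apply, Pi.smul_apply, smul_eq_mul, Pi.single_apply, mul_ite,
    mul_one, mul_zero]
  by_cases hi : i = k.rev
  · simp only [hi, if_true]
    have h2 : ∑ j, (if j = k then 0 else c (z j.rev) * x j) =
        ∑ j, (if j = k then 0 else c (z j.rev)) * x j := by
      refine Finset.sum_congr rfl fun j _ => ?_
      split_ifs <;> simp
    rw [h2, ← h1]
    ring
  · simp only [hi, if_false]
    simp [mul_comm]

/-- The transformation sends `e_k` to `e_k + z`, and `hz` says precisely that this vector is
isotropic. -/
theorem hermAdj_eichlerMatrix {k : Fin (2 * r)} {z : Fin (2 * r) → E} (hk : z k = 0)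
    (hz : z k.rev + c (z k.rev) + hermForm c r z z = 0) :
    hermAdj c r (eichlerMatrix c k z) * eichlerMatrix c k z = 1 := by
  refine hermAdj_mul_eq_one fun x y => ?_
  have h1 := conj_hermForm (c := c) y z
  rw [eichlerMatrix_mulVec, eichlerMatrix_mulVec]
  simp only [hermForm_add_left, hermForm_add_right, hermForm_smul_left, hermForm_smul_right,
    hermForm_single_left, hermForm_single_right, map_sub, map_mul, h1, map_one, hk, map_zero,
    Fin.rev_rev, conj_conj_apply, Pi.add_apply, Pi.smul_apply, smul_eq_mul, Pi.single_apply, (rev_ne_self k).symm, if_false]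
  linear_combination (x k * c (y k)) * hz

/-- The Eichler transformation with matrix `eichlerMatrix c k z`. -/
def eichler (c : E ≃ₐ[F] E) (k : Fin (2 * r)) (z : Fin (2 * r) → E) (hk : z k = 0)
    (hz : z k.rev + c (z k.rev) + hermForm c r z z = 0) : unitaryGp c r :=
  unitaryOf (eichlerMatrix c k z) (hermAdj_eichlerMatrix hk hz)

theorem mat_eichler (k : Fin (2 * r)) (z : Fin (2 * r) → E) (hk : z k = 0)
    (hz : z k.rev + c (z k.rev) + hermForm c r z z = 0) :
    mat (eichler c k z hk hz) = eichlerMatrix c k z := rfl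

end Eichler

end UnitaryAlgebra

/-! ### Conjugation is an isometry; integrality in the unitary group. -/

section Norms

variable {F E : Type*} [NontriviallyNormedField F] [IsUltrametricDist F] [LocallyCompactSpace F]
  [NontriviallyNormedField E] [NormedAlgebra F E] [Algebra.IsQuadraticExtension F E]
variable (c : E ≃ₐ[F] E) {r : ℕ}

/-- `‖x‖ < 1` means that the powers of `x` tend to 0, a condition preserved by any continuous
automorphism. -/
theorem norm_conj_lt_one {x : E} (hx : ‖x‖ < 1) : ‖c x‖ < 1 := by
  have h1 := tendsto_pow_atTop_nhds_zero_of_norm_lt_one hx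
  have h2 := (continuous_conj c).tendsto 0 |>.comp h1
  rw [map_zero] at h2
  have h3 : Filter.Tendsto (fun n => c x ^ n) Filter.atTop (nhds 0) := by
    refine h2.congr fun n => ?_
    simp
  have h4 := tendsto_norm_zero.comp h3
  simp only [Function.comp_def, norm_pow] at h4
  rw [tendsto_pow_atTop_nhds_zero_iff, abs_of_nonneg (norm_nonneg _)] at h4
  exact h4

/-- If `‖c x‖ < ‖x‖`, then `c x / x` has norm below 1 while its conjugate `x / c x` has norm above
1, contradicting `norm_conj_lt_one`. -/
theorem norm_conj (x : E) : ‖c x‖ = ‖x‖ := by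
  have key : ∀ x : E, ¬ ‖c x‖ < ‖x‖ := by
    intro x h
    have hx : 0 < ‖x‖ := (norm_nonneg _).trans_lt h
    have h1 : ‖c x / x‖ < 1 := by rwa [norm_div, div_lt_one hx]
    have h2 := norm_conj_lt_one c h1
    have hx0 : x ≠ 0 := norm_pos_iff.1 hx
    have hcx : 0 < ‖c x‖ := norm_pos_iff.2 (by simpa using hx0)
    rw [map_div₀, conj_conj_apply, norm_div, div_lt_one hcx] at h2
    exact lt_asymm h h2
  refine le_antisymm ?_ (not_lt.1 (key x))
  have := key (c x)
  rw [conj_conj_apply] at this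
  exact not_lt.1 this

variable {c}

/-- The entries of `g⁻¹` are conjugates of entries of `g`, so integrality of `g` already gives that
of `g⁻¹`. -/
theorem mem_latticeSubgroup_iff (g : unitaryGp c r) :
    g ∈ latticeSubgroup c r ↔ ∀ i j, ‖mat g i j‖ ≤ 1 := by
  refine (mem_latticeStabilizer_iff c r g).trans ((Submonoid.mem_units_iff _ _).trans ?_)
  constructor
  · rintro ⟨h, _⟩
    exact h
  · intro h
    refine ⟨h, fun i j => ?_⟩
    change ‖mat g⁻¹ i j‖ ≤ 1
    rw [mat_inv_apply, norm_conj]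
    exact h _ _

/-- Transposition thus transfers facts on columns and left multiplication by `L` to rows and right
multiplication. -/
theorem transposeElt_mem {g : unitaryGp c r} (hg : g ∈ latticeSubgroup c r) :
    transposeElt g ∈ latticeSubgroup c r := by
  rw [mem_latticeSubgroup_iff] at hg ⊢
  exact fun i j => hg j i

theorem permElt_mem (π : Equiv.Perm (Fin (2 * r))) (hπ : ∀ i, π i.rev = (π i).rev) :
    permElt c π hπ ∈ latticeSubgroup c r := by
  rw [mem_latticeSubgroup_iff]
  intro i j
  rw [mat_permElt]
  split_ifs <;> simp

theorem eichler_mem {k : Fin (2 * r)} {z : Fin (2 * r) → E} (hk : z k = 0)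
    (hz : z k.rev + c (z k.rev) + hermForm c r z z = 0) (h : ∀ i, ‖z i‖ ≤ 1) :
    eichler c k z hk hz ∈ latticeSubgroup c r := by
  have : IsUltrametricDist E := IsUltrametricDist.of_normedAlgebra F
  rw [mem_latticeSubgroup_iff]
  intro i j
  rw [mat_eichler, eichlerMatrix, of_apply, sub_eq_add_neg]
  refine (IsUltrametricDist.norm_add_le_max _ _).trans (max_le
    ((IsUltrametricDist.norm_add_le_max _ _).trans (max_le ?_ ?_)) ?_)
  · split_ifs <;> simp
  · split_ifs <;> simp [h]
  · split_ifs <;> simp [h, norm_conj]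

theorem torus_mem_iff (t : torus c r) :
    t ∈ torusCompact c r ↔ ∀ i, ‖mat t.1 i i‖ ≤ 1 := by
  refine (mem_latticeSubgroup_iff t.1).trans ⟨fun h i => h i i, fun h i j => ?_⟩
  rw [mat_torus t, diagonal_apply]
  split_ifs
  · exact h i
  · simp

theorem norm_torus_rev (t : torus c r) (i : Fin (2 * r)) :
    ‖mat t.1 i.rev i.rev‖ = ‖mat t.1 i i‖⁻¹ := by
  have h := congrArg norm (torus_apply_mul t i)
  rw [norm_mul, norm_conj, norm_one] at h
  exact eq_inv_of_mul_eq_one_right h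

theorem torus_mem_iff_eq (t : torus c r) :
    t ∈ torusCompact c r ↔ ∀ i, ‖mat t.1 i i‖ = 1 := by
  rw [torus_mem_iff]
  refine ⟨fun h i => le_antisymm (h i) ?_, fun h i => (h i).le⟩
  have h1 := h i.rev
  rw [norm_torus_rev] at h1
  have h2 : 0 < ‖mat t.1 i i‖ := norm_pos_iff.2 (torus_apply_ne_zero t i)
  exact (inv_le_one₀ h2).1 h1

end Norms

end

section

open Matrix

/-! ### Reflections as permutations of the indices, and the elimination step. -/

section SwapPerm

variable {r : ℕ}

/-- If `k = p` or `k = p.rev` the four points coincide in pairs; the order of the tests then yields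
the identity, respectively the single exchange of `p` and `k`. -/
theorem swapFun_involutive (p k : Fin (2 * r)) : Function.Involutive fun a : Fin (2 * r) =>
    if a = p then k else if a = k then p else if a = p.rev then k.rev else
      if a = k.rev then p.rev else a := by
  intro a
  have hp := rev_ne_self p
  have hk := rev_ne_self k
  have h1 := @rev_eq_comm r p k
  have h2 := @Fin.rev_inj _ p k
  grind

/-- The permutation that exchanges `p` with `k` and `2r+1-p` with `2r+1-k`. -/
def swapPerm (p k : Fin (2 * r)) : Equiv.Perm (Fin (2 * r)) := (swapFun_involutive p k).toPerm

theorem swapPerm_apply (p k a : Fin (2 * r)) : swapPerm p k a =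
    if a = p then k else if a = k then p else if a = p.rev then k.rev else
      if a = k.rev then p.rev else a := rfl

theorem swapPerm_symm (p k : Fin (2 * r)) : (swapPerm p k).symm = swapPerm p k :=
  Function.Involutive.toPerm_symm _

theorem swapPerm_rev (p k a : Fin (2 * r)) : swapPerm p k a.rev = (swapPerm p k a).rev := by
  simp only [swapPerm_apply]
  have hp := rev_ne_self p
  have hk := rev_ne_self k
  have h1 := @rev_eq_comm r p k
  have h2 := @Fin.rev_inj _ p k
  have h3 := @rev_eq_comm r a p
  have h4 := @rev_eq_comm r a k
  have h5 := @Fin.rev_inj _ a p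
  have h6 := @Fin.rev_inj _ a k
  have h7 := Fin.rev_rev p
  have h8 := Fin.rev_rev k
  grind

theorem swapPerm_left (p k : Fin (2 * r)) : swapPerm p k p = k := by simp [swapPerm_apply]

theorem swapPerm_right (p k : Fin (2 * r)) : swapPerm p k k = p := by
  simp only [swapPerm_apply]
  split_ifs with h
  · exact h
  · simp

theorem swapPerm_of_ne {p k a : Fin (2 * r)} (h1 : a ≠ p) (h2 : a ≠ k) (h3 : a ≠ p.rev)
    (h4 : a ≠ k.rev) : swapPerm p k a = a := by
  simp [swapPerm_apply, h1, h2, h3, h4]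

/-- `swapPerm` preserves every set of indices that contains `p` and `k` and is stable under
`i ↦ 2r+1-i`. -/
theorem swapPerm_mem {M : Fin (2 * r) → Prop} (hM : ∀ i, M i → M i.rev) {p k : Fin (2 * r)}
    (hp : M p) (hk : M k) {a : Fin (2 * r)} (ha : M a) : M (swapPerm p k a) := by
  rw [swapPerm_apply]
  split_ifs
  exacts [hk, hp, hM _ hk, hM _ hp, ha]

theorem swapPerm_of_not_mem {M : Fin (2 * r) → Prop} (hM : ∀ i, M i → M i.rev) {p k : Fin (2 * r)}
    (hp : M p) (hk : M k) {a : Fin (2 * r)} (ha : ¬ M a) : swapPerm p k a = a := by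
  refine swapPerm_of_ne ?_ ?_ ?_ ?_ <;> rintro rfl
  exacts [ha hp, ha hk, ha (hM _ hp), ha (hM _ hk)]

end SwapPerm

variable {F E : Type*} [NontriviallyNormedField F] [IsUltrametricDist F] [LocallyCompactSpace F]
  [NontriviallyNormedField E] [NormedAlgebra F E] [Algebra.IsQuadraticExtension F E]
variable {c : E ≃ₐ[F] E} {r : ℕ}

theorem inv_mulVec_eq (h : unitaryGp c r) {x y : Fin (2 * r) → E} (hxy : mat h *ᵥ x = y) :
    mat h⁻¹ *ᵥ y = x := by
  rw [← hxy, mulVec_mulVec, mat_inv_mul, one_mulVec]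

/-- Clearing the coordinates of an isotropic vector `v` at the positions in `M` other than a position
`k` where `v` is largest. -/
theorem exists_clear (M : Fin (2 * r) → Prop) (hM : ∀ i, M i → M i.rev) {k : Fin (2 * r)} (hk : M k)
    {v : Fin (2 * r) → E} (hv : hermForm c r v v = 0) (hmax : ∀ i, M i → ‖v i‖ ≤ ‖v k‖)
    (h0 : v k ≠ 0) (hout : ∀ i, ¬ M i → v i = 0 ∨ v i.rev = 0) :
    ∃ h ∈ latticeSubgroup c r,
      (∀ x : Fin (2 * r) → E, (∀ i, M i → i ≠ k.rev → x i = 0) → mat h *ᵥ x = x) ∧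
      (∀ i, M i → i ≠ k → (mat h *ᵥ v) i = 0) ∧ (∀ i, ¬ M i → (mat h *ᵥ v) i = v i) ∧
      (mat h *ᵥ v) k = v k := by
  classical
  -- Chosen so that `e_k + z` is the part of `v` supported on `M`, divided by the pivot `v k`.
  -- Maximality of the pivot makes `z` integral.
  let z : Fin (2 * r) → E := fun i => if M i ∧ i ≠ k then v i / v k else 0
  let v' : Fin (2 * r) → E := fun i => if M i ∧ i ≠ k then 0 else v i
  have hzk : z k = 0 := by simp [z]
  have hz0 : ∀ i, ¬ M i → z i = 0 := fun i hi => by simp [z, hi]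
  have hMr : ∀ i, M i.rev ↔ M i := fun i => ⟨fun h => by simpa using hM _ h, hM i⟩
  -- By `hout` the indices outside `M` contribute nothing to `(v, v)`, so truncating `v` to `M`
  -- keeps it isotropic. Expanded, this is the condition `hz` on the Eichler transformation.
  have hy : hermForm c r (Pi.single k 1 + z) (Pi.single k 1 + z) = 0 := by
    have hyi : ∀ i, M i → (Pi.single k 1 + z : Fin (2 * r) → E) i = v i / v k := by
      intro i hi
      by_cases hik : i = k
      · subst hik; simp [z, h0]
      · simp [z, hik, hi]
    have hyi' : ∀ i, ¬ M i → (Pi.single k 1 + z : Fin (2 * r) → E) i = 0 := by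
      intro i hi
      have hik : i ≠ k := fun h => hi (h ▸ hk)
      simp [z, hik, hi]
    have hck : c (v k) ≠ 0 := by simpa using h0
    have : hermForm c r (Pi.single k 1 + z) (Pi.single k 1 + z) =
        (v k * c (v k))⁻¹ * hermForm c r v v := by
      rw [hermForm, hermForm, Finset.mul_sum]
      refine Finset.sum_congr rfl fun i _ => ?_
      by_cases hi : M i
      · rw [hyi i hi, hyi i.rev (hM i hi), map_div₀]
        field_simp
      · rw [hyi' i hi, zero_mul]
        rcases hout i hi with h | h <;> simp [h]
    rw [this, hv, mul_zero]
  have hz : z k.rev + c (z k.rev) + hermForm c r z z = 0 := by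
    rw [hermForm_add_left, hermForm_add_right, hermForm_add_right, hermForm_single_left,
      hermForm_single_left, hermForm_single_right, Pi.single_eq_of_ne (rev_ne_self k)] at hy
    simp only [map_zero, map_one, mul_zero, one_mul, mul_one, zero_add] at hy
    rw [← hy]
    ring
  have hnorm : ∀ i, ‖z i‖ ≤ 1 := by
    intro i
    simp only [z]
    split_ifs with h
    · rw [norm_div]
      exact div_le_one_of_le₀ (hmax i h.1) (norm_nonneg _)
    · simp
  -- The Eichler transformation takes the cleared vector `v'` to `v`, so its inverse does the
  -- clearing.
  refine ⟨(eichler c k z hzk hz)⁻¹, inv_mem (eichler_mem hzk hz hnorm), fun x hx => ?_, ?_⟩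
  · refine inv_mulVec_eq _ ?_
    have hxz : hermForm c r x z = 0 := by
      refine Finset.sum_eq_zero fun i _ => ?_
      by_cases hi : M i
      · by_cases hik : i = k.rev
        · rw [hik, Fin.rev_rev, hzk, map_zero, mul_zero]
        · rw [hx i hi hik, zero_mul]
      · rw [hz0 i.rev (fun h => hi ((hMr i).1 h)), map_zero, mul_zero]
    rw [mat_eichler, eichlerMatrix_mulVec, hxz, hx k hk (rev_ne_self k).symm]
    simp
  · have hv' : mat (eichler c k z hzk hz)⁻¹ *ᵥ v = v' := by
      refine inv_mulVec_eq _ ?_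
      have hvk : v' k = v k := by simp [v']
      have hxz : hermForm c r v' z = v k * c (z k.rev) := by
        rw [hermForm, Finset.sum_eq_single k, hvk]
        · intro i _ hik
          by_cases hi : M i
          · simp [v', hi, hik]
          · rw [hz0 i.rev (fun h => hi ((hMr i).1 h)), map_zero, mul_zero]
        · simp
      rw [mat_eichler, eichlerMatrix_mulVec, hxz, hvk, sub_self, zero_smul, add_zero]
      ext i
      by_cases hi : M i ∧ i ≠ k
      · simp [v', z, hi]
        field_simp
      · simp only [Pi.add_apply, Pi.smul_apply, v', z, if_neg hi]
        simp
    rw [hv']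
    refine ⟨fun i hi hik => ?_, fun i hi => ?_, ?_⟩
    · simp [v', hi, hik]
    · simp [v', hi]
    · simp [v']

theorem hermForm_col_self (g : unitaryGp c r) (k : Fin (2 * r)) :
    hermForm c r ((mat g).col k) ((mat g).col k) = 0 := by
  rw [hermForm_col, if_neg (rev_ne_self k)]

theorem exists_max_norm {ι : Type*} [Finite ι] {M : ι → Prop} (hM : ∃ i, M i) (f : ι → E) :
    ∃ p, M p ∧ ∀ i, M i → ‖f i‖ ≤ ‖f p‖ := by
  obtain ⟨p, hp, h⟩ := Set.exists_max_image {i | M i} (fun i => ‖f i‖) (Set.toFinite _) hM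
  exact ⟨p, hp, h⟩

/-! ### The Iwasawa decomposition by column elimination. -/

section Iwasawa

/-- The first `m` columns of `g` are upper triangular. -/
def TriangularTo (m : ℕ) (g : unitaryGp c r) : Prop :=
  ∀ j : Fin (2 * r), j.1 < m → mat g j j ≠ 0 ∧ ∀ i, j < i → mat g i j = 0

/-- Columns `l` and `a` are orthogonal when `l ≠ a.rev`. In the sum for their product, the terms
with index below `a.rev` vanish by triangularity of column `a` and those above it by induction,
leaving `mat g a.rev l` times the conjugate of the nonzero diagonal entry of column `a`. -/
theorem TriangularTo.row_eq_zero {m : ℕ} {g : unitaryGp c r} (hg : TriangularTo m g)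
    (j : ℕ) : ∀ a : Fin (2 * r), a.1 = j → j < m → ∀ l, l < a.rev →
      mat g a.rev l = 0 := by
  induction j using Nat.strong_induction_on with
  | _ j ih =>
  intro a ha hj l hl
  have h1 := hermForm_col g l a
  rw [if_neg (fun h => hl.ne (by rw [← h, Fin.rev_rev])), hermForm,
    Finset.sum_eq_single a.rev] at h1
  · simp only [Fin.rev_rev] at h1
    refine (mul_eq_zero.1 h1).resolve_right ?_
    simpa using (hg a (ha ▸ hj)).1
  · intro b _ hb
    rcases lt_or_gt_of_ne hb with h | h
    · have h2 : a < b.rev := by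
        rw [← Fin.rev_lt_rev, Fin.rev_rev]; exact h
      have := (hg a (ha ▸ hj)).2 b.rev h2
      simp only [col_apply]
      rw [this, map_zero, mul_zero]
    · have h2 : b.rev < a := by
        rw [← Fin.rev_lt_rev, Fin.rev_rev]; exact h
      have := ih b.rev.1 (ha ▸ h2) b.rev rfl (lt_trans (ha ▸ h2) hj) l (by
        rw [Fin.rev_rev]; exact hl.trans h)
      rw [Fin.rev_rev] at this
      simp only [col_apply]
      rw [this, zero_mul]
  · simp

theorem TriangularTo.exists_succ {m : ℕ} {g : unitaryGp c r} (hg : TriangularTo m g) (hm : m < r) :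
    ∃ h ∈ latticeSubgroup c r, TriangularTo (m + 1) (h * g) := by
  let k : Fin (2 * r) := ⟨m, by omega⟩
  let M : Fin (2 * r) → Prop := fun i => m ≤ i.1 ∧ m ≤ i.rev.1
  have hM : ∀ i, M i → M i.rev := fun i hi => ⟨hi.2, by rw [Fin.rev_rev]; exact hi.1⟩
  have hk : M k := ⟨le_rfl, by rw [Fin.val_rev]; change m ≤ 2 * r - (m + 1); omega⟩
  -- The last `m` rows need no clearing: `row_eq_zero` gives their vanishing to the left of the
  -- diagonal.
  have hbot : ∀ i : Fin (2 * r), i.rev.1 < m → mat g i k = 0 := by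
    intro i hi
    have := hg.row_eq_zero i.rev.1 i.rev rfl hi k
    rw [Fin.rev_rev] at this
    apply this
    change m < i.1
    rw [Fin.val_rev] at hi
    omega
  obtain ⟨p, hp, hmax⟩ := exists_max_norm ⟨k, hk⟩ fun i => mat g i k
  -- Columns `k` and `k.rev` have product 1. If column `k` vanished on the middle rows, every term
  -- of that product would be 0.
  have hpk : mat g p k ≠ 0 := by
    intro h0
    have hmid : ∀ i, M i → mat g i k = 0 := fun i hi => by
      have := hmax i hi
      simpa [h0] using this
    have h1 := hermForm_col g k k.rev
    rw [if_pos rfl, hermForm, Finset.sum_eq_zero] at h1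
    · exact zero_ne_one h1
    · intro i _
      simp only [col_apply]
      by_cases hi : i.rev.1 < m
      · rw [hbot i hi, zero_mul]
      · by_cases hi' : m ≤ i.1
        · rw [hmid i ⟨hi', not_lt.1 hi⟩, zero_mul]
        · rw [hg.row_eq_zero i.1 i rfl (not_le.1 hi') k.rev, map_zero, mul_zero]
          rw [Fin.rev_lt_rev]
          exact not_le.1 hi'
  let g₁ := permElt c (swapPerm p k) (swapPerm_rev p k) * g
  have hg₁ : ∀ i j, mat g₁ i j = mat g (swapPerm p k i) j := by
    intro i j
    rw [mat_permElt_mul_apply, swapPerm_symm]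
  have hg₁k : mat g₁ k k = mat g p k := by rw [hg₁, swapPerm_right]
  have hlow : ∀ j : Fin (2 * r), j.1 < m → ∀ i, j < i → mat g₁ i j = 0 := by
    intro j hj i hij
    rw [hg₁]
    by_cases hi : M i
    · exact (hg j hj).2 _ (Fin.lt_def.2 (lt_of_lt_of_le hj (swapPerm_mem hM hp hk hi).1))
    · rw [swapPerm_of_not_mem hM hp hk hi]
      exact (hg j hj).2 _ hij
  obtain ⟨h, hhK, hfix, hclear, hkeep, hpivot⟩ := exists_clear M hM hk (hermForm_col_self g₁ k)
    (by
      intro i hi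
      simp only [col_apply]
      rw [hg₁k, hg₁]
      exact hmax _ (swapPerm_mem hM hp hk hi))
    (by simp only [col_apply]; rw [hg₁k]; exact hpk)
    (by
      intro i hi
      have hcases : i.1 < m ∨ i.rev.1 < m := by
        by_contra! h
        exact hi h
      simp only [col_apply]
      rcases hcases with h | h
      · right
        rw [hg₁, swapPerm_of_not_mem hM hp hk (fun h' => hi (by simpa using hM _ h'))]
        exact hbot _ (by rwa [Fin.rev_rev])
      · left
        rw [hg₁, swapPerm_of_not_mem hM hp hk hi]
        exact hbot _ h)
  refine ⟨h * permElt c (swapPerm p k) (swapPerm_rev p k), mul_mem hhK (permElt_mem _ _), ?_⟩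
  rw [mul_assoc]
  change TriangularTo (m + 1) (h * g₁)
  -- The earlier columns vanish on `M`, so the clearing transformation fixes them.
  have hcol : ∀ j : Fin (2 * r), j.1 < m → ∀ i, mat (h * g₁) i j = mat g₁ i j := by
    intro j hj i
    have := hfix ((mat g₁).col j) (fun a ha _ => hlow j hj a (Fin.lt_def.2 (lt_of_lt_of_le hj ha.1)))
    exact congrFun this i
  intro j hj
  rcases Nat.lt_succ_iff_lt_or_eq.1 hj with hj | hj
  · refine ⟨?_, fun i hij => ?_⟩
    · rw [hcol j hj, hg₁, swapPerm_of_not_mem hM hp hk (fun h => absurd hj (not_lt.2 h.1))]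
      exact (hg j hj).1
    · rw [hcol j hj]
      exact hlow j hj i hij
  · have hjk : j = k := Fin.ext hj
    subst hjk
    refine ⟨?_, fun i hij => ?_⟩
    · have : mat (h * g₁) k k = mat g₁ k k := hpivot
      rw [this, hg₁k]
      exact hpk
    · by_cases hi : M i
      · exact hclear i hi hij.ne'
      · have : mat (h * g₁) i k = mat g₁ i k := hkeep i hi
        have h2 : m < i.1 := hij
        have h3 : i.rev.1 < m := by
          by_contra! h
          exact hi ⟨h2.le, h⟩
        rw [this, hg₁, swapPerm_of_not_mem hM hp hk hi]
        exact hbot i h3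

theorem exists_triangularTo (g : unitaryGp c r) (m : ℕ) (hm : m ≤ r) :
    ∃ h ∈ latticeSubgroup c r, TriangularTo m (h * g) := by
  induction m with
  | zero => exact ⟨1, one_mem _, fun j hj => absurd hj (Nat.not_lt_zero _)⟩
  | succ m ih =>
    obtain ⟨h, hh, hg⟩ := ih (by omega)
    obtain ⟨h', hh', hg'⟩ := hg.exists_succ (by omega)
    exact ⟨h' * h, mul_mem hh' hh, by rwa [mul_assoc]⟩

/-- The Iwasawa decomposition `G = B L`. -/
theorem iwasawa (g : unitaryGp c r) :
    ∃ b ∈ borelSubgroup c r, ∃ k ∈ latticeSubgroup c r, g = b * k := by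
  obtain ⟨h, hh, hg⟩ := exists_triangularTo g⁻¹ r le_rfl
  have hb : h * g⁻¹ ∈ borelSubgroup c r := by
    intro i j hij
    change j < i at hij
    by_cases hj : j.1 < r
    · exact (hg j hj).2 i hij
    · have := hg.row_eq_zero i.rev.1 i.rev rfl (by
        rw [Fin.val_rev]
        have : j.1 < i.1 := hij
        omega) j
      rw [Fin.rev_rev] at this
      exact this hij
  exact ⟨(h * g⁻¹)⁻¹, inv_mem hb, h, hh, by group⟩

end Iwasawa

/-! ### The decomposition `G = L T L` by elimination on rows and columns. -/

section Cartan

/-- The columns `j` of `g` with `j` or `2r+1-j` among the first `m` indices are diagonal. -/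
def DiagonalOutside (M : Fin (2 * r) → Prop) (g : unitaryGp c r) : Prop :=
  ∀ i j, ¬ M j → i ≠ j → mat g i j = 0

theorem inv_apply_eq_zero_of_col {g : unitaryGp c r} {j : Fin (2 * r)}
    (h : ∀ i, i ≠ j → mat g i j = 0) {i : Fin (2 * r)} (hi : i ≠ j) : mat g⁻¹ i j = 0 := by
  have h1 : ∀ i, mat g⁻¹ i j * mat g j j = (1 : Matrix _ _ E) i j := by
    intro i
    rw [← mat_inv_mul g, mul_apply, Finset.sum_eq_single j]
    · intro b _ hb
      rw [h b hb, mul_zero]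
    · simp
  have h2 := h1 j
  rw [one_apply_eq] at h2
  have h3 := h1 i
  rw [one_apply_ne hi] at h3
  exact (mul_eq_zero.1 h3).resolve_right (right_ne_zero_of_mul_eq_one h2)

/-- A column that is diagonal in `g` is diagonal in `g⁻¹`, and column `j.rev` of `g⁻¹` is, up to
conjugation and reversal, row `j` of `g`. -/
theorem row_eq_zero_of_col {g : unitaryGp c r} {j : Fin (2 * r)}
    (h : ∀ i, i ≠ j.rev → mat g i j.rev = 0) {i : Fin (2 * r)} (hi : i ≠ j) : mat g j i = 0 := by
  have := inv_apply_eq_zero_of_col h (i := i.rev) (fun h' => hi (Fin.rev_injective h'))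
  rw [mat_inv_apply, Fin.rev_rev, Fin.rev_rev] at this
  simpa using this

theorem DiagonalOutside.row {M : Fin (2 * r) → Prop} (hM : ∀ i, M i → M i.rev) {g : unitaryGp c r}
    (hg : DiagonalOutside M g) {i j : Fin (2 * r)} (hi : ¬ M i) (hij : i ≠ j) : mat g i j = 0 :=
  row_eq_zero_of_col
    (fun a ha => hg a i.rev (fun h => hi (by simpa using hM _ h)) ha) hij.symm

theorem DiagonalOutside.transpose {M : Fin (2 * r) → Prop} (hM : ∀ i, M i → M i.rev)
    {g : unitaryGp c r} (hg : DiagonalOutside M g) : DiagonalOutside M (transposeElt g) :=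
  fun _ _ hj hij => hg.row hM hj hij.symm

theorem norm_mul_apply_le {g h : unitaryGp c r} (hg : g ∈ latticeSubgroup c r) {C : ℝ} (hC : 0 ≤ C)
    {j : Fin (2 * r)} (hh : ∀ i, ‖mat h i j‖ ≤ C) (i : Fin (2 * r)) : ‖mat (g * h) i j‖ ≤ C := by
  have : IsUltrametricDist E := IsUltrametricDist.of_normedAlgebra F
  rw [mat_mul, mul_apply]
  refine IsUltrametricDist.norm_sum_le_of_forall_le_of_nonneg hC fun k _ => ?_
  rw [norm_mul]
  exact (mul_le_of_le_one_left (norm_nonneg _) ((mem_latticeSubgroup_iff g).1 hg i k)).trans (hh k)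

/-- The pivot is an entry of largest norm in the whole block `M × M`, so that both its column and
its row can be cleared by integral transformations. -/
theorem DiagonalOutside.exists_step {M : Fin (2 * r) → Prop} (hM : ∀ i, M i → M i.rev)
    {g : unitaryGp c r} (hg : DiagonalOutside M g) {k : Fin (2 * r)} (hk : M k) :
    ∃ h ∈ latticeSubgroup c r, ∃ h' ∈ latticeSubgroup c r,
      DiagonalOutside (fun i => M i ∧ i ≠ k ∧ i ≠ k.rev) (h * g * h') := by
  obtain ⟨⟨p, q⟩, ⟨hp, hq⟩, hmax⟩ := exists_max_norm (M := fun x : Fin (2 * r) × Fin (2 * r) =>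
    M x.1 ∧ M x.2) ⟨(k, k), hk, hk⟩ fun x => mat g x.1 x.2
  simp only at hp hq hmax
  have hpq : mat g p q ≠ 0 := by
    intro h0
    have h1 := hermForm_col g k k.rev
    rw [if_pos rfl, hermForm, Finset.sum_eq_zero] at h1
    · exact zero_ne_one h1
    · intro i _
      simp only [col_apply]
      by_cases hi : M i
      · have := hmax (i, k) ⟨hi, hk⟩
        simp only [h0, norm_zero, norm_le_zero_iff] at this
        rw [this, zero_mul]
      · rw [hg.row hM hi (fun h => hi (h ▸ hk)), zero_mul]
  let w := permElt c (swapPerm p k) (swapPerm_rev p k)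
  let w' := permElt c (swapPerm q k) (swapPerm_rev q k)
  let g₁ := w * g * w'
  have hg₁ : ∀ i j, mat g₁ i j = mat g (swapPerm p k i) (swapPerm q k j) := by
    intro i j
    rw [mat_mul_permElt_apply, mat_permElt_mul_apply, swapPerm_symm]
  have hg₁k : mat g₁ k k = mat g p q := by rw [hg₁, swapPerm_right, swapPerm_right]
  have hD₁ : DiagonalOutside M g₁ := by
    intro i j hj hij
    rw [hg₁, swapPerm_of_not_mem hM hq hk hj]
    refine hg _ _ hj fun h => hij ?_
    rw [← swapPerm_of_not_mem hM hp hk hj] at h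
    exact (swapPerm p k).injective h
  have hmax₁ : ∀ i j, M i → M j → ‖mat g₁ i j‖ ≤ ‖mat g p q‖ := by
    intro i j hi hj
    rw [hg₁]
    exact hmax (_, _) ⟨swapPerm_mem hM hp hk hi, swapPerm_mem hM hq hk hj⟩
  have hcol0 : ∀ g' : unitaryGp c r, DiagonalOutside M g' → ∀ i, ¬ M i → mat g' i k = 0 :=
    fun g' hg' i hi => hg'.row hM hi fun h => hi (h ▸ hk)
  obtain ⟨h, hhK, hfix, hclear, hkeep, hpivot⟩ := exists_clear M hM hk (hermForm_col_self g₁ k)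
    (by intro i hi; simp only [col_apply]; rw [hg₁k]; exact hmax₁ i k hi hk)
    (by simp only [col_apply]; rw [hg₁k]; exact hpq)
    (fun i hi => Or.inl (hcol0 g₁ hD₁ i hi))
  have hk₂ : ∀ i, i ≠ k → mat (h * g₁) i k = 0 := by
    intro i hik
    by_cases hi : M i
    · exact hclear i hi hik
    · exact (hkeep i hi).trans (hcol0 g₁ hD₁ i hi)
  have hD₂ : DiagonalOutside M (h * g₁) := by
    intro i j hj hij
    have := hfix ((mat g₁).col j) (fun a ha _ => hD₁ a j hj fun h => hj (h ▸ ha))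
    exact (congrFun this i).trans (hD₁ i j hj hij)
  have hg₂k : mat (h * g₁) k k = mat g p q := Eq.trans hpivot hg₁k
  -- Left multiplication by `L` does not enlarge the norm of a column, so the pivot still dominates
  -- its row.
  have hmax₂ : ∀ j, M j → ‖mat (h * g₁) k j‖ ≤ ‖mat g p q‖ := by
    intro j hj
    refine norm_mul_apply_le hhK (norm_nonneg _) (fun i => ?_) k
    by_cases hi : M i
    · exact hmax₁ i j hi hj
    · rw [hD₁.row hM hi (fun h => hi (h ▸ hj)), norm_zero]
      exact norm_nonneg _
  -- After transposition the row of the pivot becomes a column and is cleared in the same way.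
  let g₃ := transposeElt (h * g₁)
  have hD₃ : DiagonalOutside M g₃ := hD₂.transpose hM
  obtain ⟨h', hhK', hfix', hclear', hkeep', -⟩ := exists_clear M hM hk (hermForm_col_self g₃ k)
    (by intro i hi; exact (hmax₂ i hi).trans (congrArg norm hg₂k).ge)
    (by simp only [col_apply]; exact fun h => hpq (hg₂k.symm.trans h))
    (fun i hi => Or.inl (hcol0 g₃ hD₃ i hi))
  have hD₄ : DiagonalOutside (fun i => M i ∧ i ≠ k ∧ i ≠ k.rev) (h' * g₃) := by
    intro i j hj hij
    by_cases hjk : j = k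
    · subst hjk
      by_cases hi : M i
      · exact hclear' i hi hij
      · exact (hkeep' i hi).trans (hcol0 g₃ hD₃ i hi)
    -- For `j = k.rev` nothing has to be cleared: column `k` of `h * g₁` is diagonal, which by
    -- unitarity makes its row `k.rev` diagonal.
    · have hcolj : ∀ i, i ≠ j → mat g₃ i j = 0 := by
        intro i hij
        by_cases hjr : j = k.rev
        · have : ∀ i, i ≠ j → mat (h * g₁) j i = 0 := fun i hij => row_eq_zero_of_col
            (g := h * g₁) (j := j) (fun a ha => by
              rw [hjr, Fin.rev_rev] at ha ⊢
              exact hk₂ a ha) hij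
          exact this i hij
        · exact hD₃ i j (fun h => hj ⟨h, hjk, hjr⟩) hij
      have := hfix' ((mat g₃).col j) (fun a ha hak => hcolj a (by
        rintro rfl
        exact hj ⟨ha, hjk, hak⟩))
      exact (congrFun this i).trans (hcolj i hij)
  have hM' : ∀ i, (M i ∧ i ≠ k ∧ i ≠ k.rev) → (M i.rev ∧ i.rev ≠ k ∧ i.rev ≠ k.rev) := by
    rintro i ⟨h1, h2, h3⟩
    exact ⟨hM i h1, fun h => h3 (by rw [← h, Fin.rev_rev]), fun h => h2 (Fin.rev_injective h)⟩
  have hD₅ := hD₄.transpose hM'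
  rw [transposeElt_mul, transposeElt_transposeElt] at hD₅
  refine ⟨h * w, mul_mem hhK (permElt_mem _ _), w' * transposeElt h',
    mul_mem (permElt_mem _ _) (transposeElt_mem hhK'), ?_⟩
  have : h * w * g * (w' * transposeElt h') = h * (w * g * w') * transposeElt h' := by group
  rw [this]
  exact hD₅

theorem exists_diagonalOutside (g : unitaryGp c r) (m : ℕ) (hm : m ≤ r) :
    ∃ h ∈ latticeSubgroup c r, ∃ h' ∈ latticeSubgroup c r,
      DiagonalOutside (fun i => m ≤ i.1 ∧ m ≤ i.rev.1) (h * g * h') := by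
  induction m with
  | zero =>
    exact ⟨1, one_mem _, 1, one_mem _, fun i j hj => absurd ⟨Nat.zero_le _, Nat.zero_le _⟩ hj⟩
  | succ m ih =>
    obtain ⟨h, hh, h', hh', hg⟩ := ih (by omega)
    have hM : ∀ i : Fin (2 * r), m ≤ i.1 ∧ m ≤ i.rev.1 → m ≤ i.rev.1 ∧ m ≤ i.rev.rev.1 :=
      fun i hi => ⟨hi.2, by rw [Fin.rev_rev]; exact hi.1⟩
    let k : Fin (2 * r) := ⟨m, by omega⟩
    obtain ⟨a, ha, b, hb, hab⟩ := hg.exists_step hM (k := k)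
      ⟨le_rfl, by rw [Fin.val_rev]; change m ≤ 2 * r - (m + 1); omega⟩
    refine ⟨a * h, mul_mem ha hh, h' * b, mul_mem hh' hb, fun i j hj hij => ?_⟩
    have : a * h * g * (h' * b) = a * (h * g * h') * b := by group
    rw [this]
    refine hab i j (fun hj' => hj ?_) hij
    obtain ⟨⟨h1, h2⟩, h3, h4⟩ := hj'
    have h5 : j.1 ≠ m := fun h => h3 (Fin.ext h)
    have h6 : j.rev.1 ≠ m := fun h => h4 (by rw [← Fin.rev_inj, Fin.rev_rev]; exact Fin.ext h)
    exact ⟨by omega, by omega⟩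

/-- The decomposition `G = L T L`. -/
theorem exists_mul_torus_mul (g : unitaryGp c r) :
    ∃ k ∈ latticeSubgroup c r, ∃ t : torus c r, ∃ k' ∈ latticeSubgroup c r, g = k * t.1 * k' := by
  obtain ⟨h, hh, h', hh', hg⟩ := exists_diagonalOutside g r le_rfl
  have ht : h * g * h' ∈ torus c r := by
    intro i j hij
    refine hg i j (fun hj => ?_) hij
    have := hj.2
    rw [Fin.val_rev] at this
    have := hj.1
    have := j.2
    omega
  exact ⟨h⁻¹, inv_mem hh, ⟨_, ht⟩, h'⁻¹, inv_mem hh', by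
    change g = h⁻¹ * (h * g * h') * h'⁻¹
    group⟩

end Cartan

end

section

open Matrix

variable {F E : Type*} [NontriviallyNormedField F] [IsUltrametricDist F] [LocallyCompactSpace F]
  [NontriviallyNormedField E] [NormedAlgebra F E] [Algebra.IsQuadraticExtension F E]
variable {c : E ≃ₐ[F] E} {r : ℕ}

instance secondCountableTopology_unitaryGp : SecondCountableTopology (unitaryGp c r) := by
  have : ProperSpace F := ProperSpace.of_locallyCompactSpace F
  have : ProperSpace E := FiniteDimensional.proper F E
  have : SecondCountableTopology (Matrix (Fin (2 * r)) (Fin (2 * r)) E) :=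
    inferInstanceAs (SecondCountableTopology (Fin (2 * r) → Fin (2 * r) → E))
  have : SecondCountableTopology (Matrix (Fin (2 * r)) (Fin (2 * r)) E)ᵐᵒᵖ :=
    MulOpposite.opHomeomorph.symm.isInducing.secondCountableTopology
  have : SecondCountableTopology (GL (Fin (2 * r)) E) :=
    Units.isInducing_embedProduct.secondCountableTopology
  exact TopologicalSpace.Subtype.secondCountableTopology _

/-- The topology of units also involves the inverse, whose entries are conjugates of entries of the
matrix. -/
theorem continuous_unitary {X : Type*} [TopologicalSpace X] {f : X → unitaryGp c r}
    (h : ∀ i j, Continuous fun x => mat (f x) i j) : Continuous f := by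
  refine Continuous.subtype_mk (f := fun x => (f x).1) (Units.continuous_iff.2 ⟨?_, ?_⟩) _
  · exact continuous_matrix h
  · refine continuous_matrix fun i j => ?_
    have : (fun x => mat (f x)⁻¹ i j) = fun x => c (mat (f x) j.rev i.rev) := by
      ext x
      rw [mat_inv_apply]
    change Continuous fun x => mat (f x)⁻¹ i j
    rw [this]
    exact (continuous_conj c).comp (h _ _)

theorem locallyCompactSpace_of_isClosed {H : Subgroup (unitaryGp c r)}
    (hH : IsClosed (H : Set (unitaryGp c r))) : LocallyCompactSpace H :=
  (isCompact_interLattice c r hH).locallyCompactSpace_of_mem_nhds_of_group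
    ((interLattice c r H).isOpen.mem_nhds (one_mem _))

theorem compactSpace_interOpen {H : Subgroup (unitaryGp c r)}
    (hH : IsClosed (H : Set (unitaryGp c r))) :
    CompactSpace (interOpen (latticeSubgroup c r) H) :=
  isCompact_iff_compactSpace.mp (isCompact_interLattice c r hH)

instance : LocallyCompactSpace (torus c r) := locallyCompactSpace_of_isClosed (isClosed_torus c r)
instance : LocallyCompactSpace (unipotentRadical c r) :=
  locallyCompactSpace_of_isClosed (isClosed_unipotentRadical c r)
instance : CompactSpace (interOpen (latticeSubgroup c r) (torus c r)) :=
  compactSpace_interOpen (isClosed_torus c r)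
instance : CompactSpace (interOpen (latticeSubgroup c r) (unipotentRadical c r)) :=
  compactSpace_interOpen (isClosed_unipotentRadical c r)
instance : CompactSpace (interOpen (latticeSubgroup c r) (borelSubgroup c r)) :=
  compactSpace_interOpen (isClosed_borelSubgroup c r)

/-! ### The decomposition `B = T N` and the square root of the modular character. -/

section Borel

theorem unipotentRadical_le : unipotentRadical c r ≤ borelSubgroup c r := fun _ h => h.1

theorem borel_apply_mul (b : borelSubgroup c r) (i : Fin (2 * r)) :
    mat b.1 i i * c (mat b.1 i.rev i.rev) = 1 := by
  have h := mul_diag_of_blockTriangular r b.2 (inv_mem b.2) i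
  rw [mat_mul_inv, one_apply_eq, mat_inv_apply] at h
  exact h.symm

/-- The projection `B → T` to the diagonal part. -/
def borelProj : borelSubgroup c r →* torus c r where
  toFun b := diagElt c (fun i => mat b.1 i i) (borel_apply_mul b)
  map_one' := torus_ext fun i => by
    rw [mat_diagElt, diagonal_apply_eq]
    rfl
  map_mul' a b := torus_ext fun i => by
    rw [torus_mul_apply, mat_diagElt, mat_diagElt, mat_diagElt, diagonal_apply_eq,
      diagonal_apply_eq, diagonal_apply_eq]
    exact mul_diag_of_blockTriangular r a.2 b.2 i

theorem borelProj_apply (b : borelSubgroup c r) (i : Fin (2 * r)) :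
    mat (borelProj b).1 i i = mat b.1 i i := by
  change diagonal _ i i = _
  rw [diagonal_apply_eq]

theorem continuous_borelProj : Continuous (borelProj : borelSubgroup c r → torus c r) := by
  refine Continuous.subtype_mk (f := fun b : borelSubgroup c r => (borelProj b).1)
    (continuous_unitary fun i j => ?_) _
  change Continuous fun b : borelSubgroup c r => diagonal (fun i => mat b.1 i i) i j
  by_cases h : i = j
  · subst h
    simp only [diagonal_apply_eq]
    exact (continuous_mat_apply i i).comp continuous_subtype_val
  · simp only [diagonal_apply_ne _ h]
    exact continuous_const

/-- The decomposition `B = T N`. -/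
def borelSemidirect (c : E ≃ₐ[F] E) (r : ℕ) :
    Semidirect (latticeSubgroup c r) (torus c r) (unipotentRadical c r) (borelSubgroup c r) where
  leA := torus_le_borelSubgroup c r
  leN := unipotentRadical_le
  proj := borelProj
  continuous_proj := continuous_borelProj
  proj_left a := torus_ext fun i => borelProj_apply _ i
  proj_right n := torus_ext fun i => by
    rw [borelProj_apply]
    change mat n.1 i i = mat 1 i i
    rw [n.2.2, mat_one, one_apply_eq]
  mem_of_proj b hb := ⟨b.2, fun i => by
    rw [← borelProj_apply, hb]
    change mat 1 i i = 1
    rw [mat_one, one_apply_eq]⟩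
  proj_mem b hb := by
    have hb' := (mem_latticeSubgroup_iff b.1).1 hb
    exact (torus_mem_iff (borelProj b)).2 fun i => by
      rw [borelProj_apply]
      exact hb' i i

theorem borel_le_normalizer :
    borelSubgroup c r ≤ Subgroup.normalizer (unipotentRadical c r : Set (unitaryGp c r)) :=
  (borelSemidirect c r).le_normalizer

theorem torus_mem_normalizer (t : torus c r) :
    t.1 ∈ Subgroup.normalizer (unipotentRadical c r : Set (unitaryGp c r)) :=
  borel_le_normalizer (torus_le_borelSubgroup c r t.2)

/-- The square root of the modular character of `B` on `T`. -/
def sqrtModular (t : torus c r) : ℂ :=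
  (Real.sqrt (conjChar (unipotentRadical c r) t.1 (torus_mem_normalizer t)) : ℂ)

theorem satakeTransform_eq (f : HeckeAlgebra (latticeSubgroup c r)) (t : torus c r) :
    satakeTransform c r f t = sqrtModular t *
      orbitIntegral (latticeSubgroup c r) (unipotentRadical c r) f t.1 := by
  have h := (borelSemidirect c r).modularCharacter_eq (torus_comm c r) t (torus_mem_normalizer t)
  unfold sqrtModular
  rw [← h]
  rfl

theorem sqrtModular_ne_zero (t : torus c r) : sqrtModular t ≠ 0 := by
  unfold sqrtModular
  have h := conjChar_pos (unipotentRadical c r) (torus_mem_normalizer t)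
  have h' : (0 : ℝ) < conjChar (unipotentRadical c r) t.1 (torus_mem_normalizer t) := h
  exact_mod_cast (Real.sqrt_pos.2 h').ne'

theorem sqrtModular_mul (s t : torus c r) : sqrtModular (s * t) = sqrtModular s * sqrtModular t := by
  unfold sqrtModular
  have h := conjChar_mul (unipotentRadical c r) (torus_mem_normalizer s) (torus_mem_normalizer t)
  rw [← Complex.ofReal_mul, ← Real.sqrt_mul (NNReal.coe_nonneg _), ← NNReal.coe_mul, ← h]
  rfl

theorem sqrtModular_of_mem {t : torus c r} (ht : t ∈ torusCompact c r) : sqrtModular t = 1 := by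
  unfold sqrtModular
  rw [conjChar_eq_one (K := latticeSubgroup c r) (unipotentRadical c r) (torus_mem_normalizer t) ht]
  simp

end Borel

/-! ### Root subgroups and the Bruhat relation in rank one. -/

section Root

/-- The condition on `x` for `1 + x E_{ik} - c(x) E_{2r+1-k, 2r+1-i}` (`1 + x E_{ik}` if
`k = 2r+1-i`) to be unitary. -/
def RootParam (c : E ≃ₐ[F] E) (i k : Fin (2 * r)) (x : E) : Prop := k.rev = i → x + c x = 0

theorem eichler_aux_left {i k : Fin (2 * r)} (hik : i ≠ k) (x : E) :
    (Pi.single i x : Fin (2 * r) → E) k = 0 := Pi.single_eq_of_ne hik.symm _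

theorem eichler_aux_right {i k : Fin (2 * r)} {x : E} (hx : RootParam c i k x) :
    (Pi.single i x : Fin (2 * r) → E) k.rev + c ((Pi.single i x : Fin (2 * r) → E) k.rev) +
      hermForm c r (Pi.single i x) (Pi.single i x) = 0 := by
  rw [hermForm_single_left, Pi.single_eq_of_ne (rev_ne_self i)]
  by_cases h : k.rev = i
  · rw [h, Pi.single_eq_same, hx h]
    simp
  · rw [Pi.single_eq_of_ne h]
    simp

/-- The element `1 + x E_{ik} - c(x) E_{2r+1-k, 2r+1-i}` (`1 + x E_{ik}` if `k = 2r+1-i`) of a root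
subgroup. -/
def rootElt {i k : Fin (2 * r)} (hik : i ≠ k) {x : E} (hx : RootParam c i k x) : unitaryGp c r :=
  eichler c k (Pi.single i x) (eichler_aux_left hik x) (eichler_aux_right hx)

variable {i k : Fin (2 * r)} (hik : i ≠ k)

/-- For `k = i.rev` the positions `(i, k)` and `(k.rev, i.rev)` coincide; the guard `i.rev ≠ k`
prevents a second contribution there. -/
theorem mat_rootElt {x : E} (hx : RootParam c i k x) (a b : Fin (2 * r)) :
    mat (rootElt hik hx) a b = (if a = b then 1 else 0) + (if a = i ∧ b = k then x else 0) -
      (if a = k.rev ∧ b = i.rev ∧ i.rev ≠ k then c x else 0) := by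
  rw [rootElt, mat_eichler, eichlerMatrix, of_apply]
  have h1 : (if b = k then (Pi.single i x : Fin (2 * r) → E) a else 0) =
      if a = i ∧ b = k then x else 0 := by
    simp only [Pi.single_apply]
    split_ifs <;> grind
  have h2 : (if a = k.rev then (if b = k then 0 else c ((Pi.single i x : Fin (2 * r) → E) b.rev))
      else 0) = if a = k.rev ∧ b = i.rev ∧ i.rev ≠ k then c x else 0 := by
    simp only [Pi.single_apply]
    have h3 : b.rev = i ↔ b = i.rev := by rw [rev_eq_comm, eq_comm]
    simp only [h3]
    by_cases ha : a = k.rev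
    · by_cases hb : b = i.rev
      · by_cases hb' : b = k
        · subst hb'
          simp [← hb]
        · subst hb
          simp [ha, hb']
      · simp [hb]
    · simp [ha]
  rw [h1, h2]

theorem rootElt_mulVec {x : E} (hx : RootParam c i k x) (v : Fin (2 * r) → E) (a : Fin (2 * r)) :
    (mat (rootElt hik hx) *ᵥ v) a = v a + (if a = i then x * v k else 0) -
      (if a = k.rev ∧ i.rev ≠ k then c x * v i.rev else 0) := by
  rw [rootElt, mat_eichler, eichlerMatrix_mulVec, hermForm_single_right]
  simp only [Pi.add_apply, Pi.smul_apply, smul_eq_mul, Pi.single_apply]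
  have := @rev_eq_comm r i k
  by_cases h : i.rev = k
  · have h' := this.1 h
    simp only [h, h', if_true, ne_eq, not_true_eq_false, and_false, if_false]
    split_ifs <;> ring
  · have h' : k.rev ≠ i := fun h' => h (this.2 h')
    simp only [h, h', if_false, ne_eq, not_false_eq_true, and_true]
    split_ifs <;> simp <;> ring

theorem rootElt_apply_self {x : E} (hx : RootParam c i k x) : mat (rootElt hik hx) i k = x := by
  rw [mat_rootElt, if_neg hik, if_pos ⟨rfl, rfl⟩, if_neg (fun h => h.2.2 h.2.1.symm)]
  simp

theorem unitary_ext {g h : unitaryGp c r} (H : ∀ v, mat g *ᵥ v = mat h *ᵥ v) : g = h :=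
  mat_injective (ext_of_mulVec_single fun _ => H _)

theorem rootElt_congr {x y : E} (hx : RootParam c i k x) (hxy : x = y) :
    rootElt hik hx = rootElt hik (hxy ▸ hx : RootParam c i k y) := by
  subst hxy
  rfl

theorem RootParam.add {x y : E} (hx : RootParam c i k x) (hy : RootParam c i k y) :
    RootParam c i k (x + y) := fun h => by
  rw [map_add]
  linear_combination hx h + hy h

theorem RootParam.zero : RootParam c i k 0 := fun _ => by simp

theorem RootParam.neg {x : E} (hx : RootParam c i k x) : RootParam c i k (-x) := fun h => by
  rw [map_neg]
  linear_combination -hx h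

theorem rootElt_add {x y : E} (hx : RootParam c i k x) (hy : RootParam c i k y) :
    rootElt hik (hx.add hy) = rootElt hik hx * rootElt hik hy := by
  refine unitary_ext fun v => ?_
  rw [mat_mul, ← mulVec_mulVec]
  ext a
  simp only [rootElt_mulVec, map_add]
  have h1 : k ≠ k.rev := (rev_ne_self k).symm
  have h2 := rev_ne_self i
  have h3 : i.rev ≠ k.rev := fun h => hik (Fin.rev_injective h)
  simp only [hik.symm, if_false, h1, false_and, h2, h3]
  split_ifs <;> ring

theorem rootElt_zero : rootElt hik (RootParam.zero (c := c)) = 1 := by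
  apply mat_injective
  ext a b
  rw [mat_rootElt, mat_one, one_apply]
  simp

theorem rootElt_neg {x : E} (hx : RootParam c i k x) :
    rootElt hik hx.neg = (rootElt hik hx)⁻¹ := by
  rw [eq_inv_iff_mul_eq_one, ← rootElt_add, rootElt_congr hik _ (neg_add_cancel x), rootElt_zero]

theorem rootElt_mem {x : E} (hx : RootParam c i k x) (h : ‖x‖ ≤ 1) :
    rootElt hik hx ∈ latticeSubgroup c r := by
  refine eichler_mem _ _ fun a => ?_
  rw [Pi.single_apply]
  split_ifs
  · exact h
  · simp

theorem RootParam.torus {x : E} (hx : RootParam c i k x) (t : torus c r) :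
    RootParam c i k (mat t.1 i i * x * (mat t.1 k k)⁻¹) := fun h => by
  subst h
  have h1 := torus_apply_mul t k
  have h2 := congrArg c h1
  rw [map_mul, map_one, conj_conj_apply] at h2
  have h3 := torus_apply_ne_zero t k
  have h4 : c (mat t.1 k k) ≠ 0 := by simpa using h3
  have e1 : mat t.1 k.rev k.rev = (c (mat t.1 k k))⁻¹ := eq_inv_of_mul_eq_one_right h2
  have e2 : c (mat t.1 k.rev k.rev) = (mat t.1 k k)⁻¹ := eq_inv_of_mul_eq_one_right h1
  rw [map_mul, map_mul, e2, map_inv₀, e1]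
  linear_combination (c (mat t.1 k k))⁻¹ * (mat t.1 k k)⁻¹ * hx rfl

theorem torus_conj_rootElt {x : E} (hx : RootParam c i k x) (t : torus c r) :
    t.1 * rootElt hik hx * t.1⁻¹ = rootElt hik (hx.torus t) := by
  apply mat_injective
  ext a b
  rw [mat_torus_conj, mat_rootElt, mat_rootElt]
  have ht := torus_apply_ne_zero t
  by_cases hab : a = b
  · subst hab
    have h1 : ¬ (a = i ∧ a = k) := fun h => hik (h.1.symm.trans h.2)
    have h2 : ¬ (a = k.rev ∧ a = i.rev ∧ i.rev ≠ k) :=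
      fun h => hik (Fin.rev_injective (h.2.1.symm.trans h.1))
    simp [h1, h2, ht a]
  · simp only [hab, if_false, zero_add]
    by_cases h1 : a = i ∧ b = k
    · obtain ⟨rfl, rfl⟩ := h1
      have h2 : ¬ (a = b.rev ∧ b = a.rev ∧ a.rev ≠ b) := fun h => h.2.2 h.2.1.symm
      simp [h2]
    · by_cases h2 : a = k.rev ∧ b = i.rev ∧ i.rev ≠ k
      · obtain ⟨rfl, rfl, h3⟩ := h2
        have e1 : mat t.1 k.rev k.rev = (c (mat t.1 k k))⁻¹ := by
          have := congrArg c (torus_apply_mul t k)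
          rw [map_mul, map_one, conj_conj_apply] at this
          exact eq_inv_of_mul_eq_one_right this
        have e2 : (mat t.1 i.rev i.rev)⁻¹ = c (mat t.1 i i) := by
          have := congrArg c (torus_apply_mul t i)
          rw [map_mul, map_one, conj_conj_apply] at this
          exact inv_eq_of_mul_eq_one_left this
        rw [if_neg h1, if_neg h1, if_pos ⟨rfl, rfl, h3⟩, if_pos ⟨rfl, rfl, h3⟩, e1, mul_assoc,
          mul_assoc, e2, map_mul, map_mul, map_inv₀]
        ring
      · simp [h1, h2]

theorem RootParam.swap {x : E} (hx : RootParam c i k x) : RootParam c k i x :=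
  fun h => hx (rev_eq_comm.1 h)

theorem swapPerm_conj_rootElt {x : E} (hx : RootParam c i k x) :
    permElt c (swapPerm i k) (swapPerm_rev i k) * rootElt hik hx *
      (permElt c (swapPerm i k) (swapPerm_rev i k))⁻¹ = rootElt hik.symm hx.swap := by
  apply mat_injective
  ext a b
  rw [mat_permElt_conj_apply, swapPerm_symm, mat_rootElt, mat_rootElt]
  have key : ∀ a b, swapPerm i k a = b ↔ a = swapPerm i k b := fun a b => by
    conv_rhs => rw [← swapPerm_symm]
    exact Equiv.eq_symm_apply _ |>.symm
  have h1 : swapPerm i k a = swapPerm i k b ↔ a = b := (swapPerm i k).injective.eq_iff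
  have h2 : ∀ a, swapPerm i k a = i ↔ a = k := fun a => by rw [key, swapPerm_left]
  have h3 : ∀ a, swapPerm i k a = k ↔ a = i := fun a => by rw [key, swapPerm_right]
  have h4 : ∀ a, swapPerm i k a = i.rev ↔ a = k.rev := fun a => by
    rw [key, swapPerm_rev, swapPerm_left]
  have h5 : ∀ a, swapPerm i k a = k.rev ↔ a = i.rev := fun a => by
    rw [key, swapPerm_rev, swapPerm_right]
  have h6 : i.rev = k ↔ k.rev = i := rev_eq_comm
  simp only [h1, h2, h3, h4, h5, ne_eq, h6]

theorem RootParam.inv {x : E} (hx : RootParam c i k x) : RootParam c k i x⁻¹ := fun h => by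
  have h1 := hx (rev_eq_comm.1 h)
  rw [map_inv₀, eq_neg_of_add_eq_zero_right h1, inv_neg, add_neg_cancel]

/-- The entries of the diagonal factor in the Bruhat relation `exists_rootElt_eq`. -/
def bruhatEntry (c : E ≃ₐ[F] E) (i k : Fin (2 * r)) (x : E) (a : Fin (2 * r)) : E :=
  if a = i then x else if a = k then -x⁻¹ else if a = k.rev then -c x else
    if a = i.rev then (c x)⁻¹ else 1

include hik in
theorem bruhatEntry_mul {x : E} (h0 : x ≠ 0) (hx : RootParam c i k x) (a : Fin (2 * r)) :
    bruhatEntry c i k x a * c (bruhatEntry c i k x a.rev) = 1 := by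
  unfold bruhatEntry
  have hc0 : c x ≠ 0 := by simpa using h0
  have hi := rev_ne_self i
  have hk := rev_ne_self k
  have hik' : i.rev ≠ k.rev := fun h => hik (Fin.rev_injective h)
  by_cases h : k.rev = i
  · have h1 := eq_neg_of_add_eq_zero_right (hx h)
    have h2 : i.rev = k := rev_eq_comm.2 h
    by_cases ha : a = i
    · subst ha
      simp [h2, hik.symm, h1, h0]
    · by_cases ha' : a = k
      · subst ha'
        simp [h, hik.symm, h1, h0]
      · have h3 : a.rev ≠ i := fun h' => ha' (by rw [← h2, ← h', Fin.rev_rev])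
        have h4 : a.rev ≠ k := fun h' => ha (by rw [← h, ← h', Fin.rev_rev])
        simp [ha, ha', h, h2, h3, h4]
  · have h2 : i.rev ≠ k := fun h' => h (rev_eq_comm.1 h')
    by_cases ha : a = i
    · subst ha
      simp [hi, h2, hik', h0, conj_conj_apply]
    · by_cases ha' : a = k
      · subst ha'
        simp [hik.symm, h, hk, h0, conj_conj_apply]
      · by_cases ha2 : a = k.rev
        · subst ha2
          simp [h, hk, hik.symm, hc0]
        · by_cases ha3 : a = i.rev
          · subst ha3
            simp [hi, h2, hik', hc0]
          · have h3 : a.rev ≠ i := fun h' => ha3 (by rw [← h', Fin.rev_rev])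
            have h4 : a.rev ≠ k := fun h' => ha2 (by rw [← h', Fin.rev_rev])
            have h5 : a.rev ≠ i.rev := fun h' => ha (Fin.rev_injective h')
            have h6 : a.rev ≠ k.rev := fun h' => ha' (Fin.rev_injective h')
            simp [ha, ha', ha2, ha3, h3, h4, h5, h6]

/-- The Bruhat relation in the rank one subgroup of a root. -/
theorem exists_rootElt_eq {x : E} (h0 : x ≠ 0) (hx : RootParam c i k x) :
    ∃ a : torus c r, rootElt hik hx = rootElt hik.symm hx.inv * a.1 *
      permElt c (swapPerm i k) (swapPerm_rev i k) * rootElt hik.symm hx.inv := by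
  have hc0 : c x ≠ 0 := by simpa using h0
  -- On the coordinates `i, k` this is the identity `[1 x; 0 1] = [1 0; x⁻¹ 1] · diag(x, -x⁻¹) · [0
  -- 1; 1 0] · [1 0; x⁻¹ 1]`. When `k ≠ i.rev`, the coordinates `k.rev, i.rev` carry its counterpart
  -- forced by unitarity.
  refine ⟨diagElt c _ (bruhatEntry_mul hik h0 hx), unitary_ext fun v => ?_⟩
  have hi := rev_ne_self i
  have hk := rev_ne_self k
  have hik' : i.rev ≠ k.rev := fun h => hik (Fin.rev_injective h)
  simp only [mat_mul, ← mulVec_mulVec, mat_diagElt]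
  ext a
  simp only [rootElt_mulVec, mulVec_diagonal, bruhatEntry, permElt_mulVec, swapPerm_symm, swapPerm_left,
    swapPerm_rev, swapPerm_right]
  by_cases h : k.rev = i
  · have h1 := eq_neg_of_add_eq_zero_right (hx h)
    have h2 : i.rev = k := rev_eq_comm.2 h
    by_cases ha : a = i
    · subst ha
      simp [h, h2, hik, swapPerm_left]
      field_simp
      ring
    · by_cases ha' : a = k
      · subst ha'
        simp [h, h2, hik, hik.symm, swapPerm_right, h0]
      · have h3 : swapPerm i k a = a := swapPerm_of_ne ha ha' (by rwa [h2]) (by rwa [h])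
        simp [h, h2, ha, ha', h3]
  · have h2 : i.rev ≠ k := fun h' => h (rev_eq_comm.1 h')
    by_cases ha : a = i
    · subst ha
      simp [h, h2, hik, hi.symm, swapPerm_left, Ne.symm h, Ne.symm h2]
      field_simp
      ring
    · by_cases ha' : a = k
      · subst ha'
        simp [h, h2, hik, hik.symm, hi.symm, hk.symm, Ne.symm h2, swapPerm_right, h0]
      · by_cases ha2 : a = k.rev
        · subst ha2
          simp [h, h2, hk, hik'.symm, swapPerm_right, swapPerm_rev]
          field_simp
          try ring
        · by_cases ha3 : a = i.rev
          · subst ha3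
            simp [h, h2, hi, hik', hik'.symm, hc0, hk, swapPerm_left, swapPerm_rev]
            try field_simp
            try ring
          · simp [ha, ha', ha2, ha3, swapPerm_of_ne ha ha' ha3 ha2]

end Root

end

section

open Matrix

variable {F E : Type*} [NontriviallyNormedField F] [IsUltrametricDist F] [LocallyCompactSpace F]
  [NontriviallyNormedField E] [NormedAlgebra F E] [Algebra.IsQuadraticExtension F E]
variable {c : E ≃ₐ[F] E} {r : ℕ}

/-! ### Simple roots and invariance of the Satake transform under simple reflections. -/

section SimpleRoot

variable {i k : Fin (2 * r)} (hik : i ≠ k)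

/-- The root subgroup of the elements `rootElt hik hx`. -/
def rootSubgroup (c : E ≃ₐ[F] E) (hik : i ≠ k) : Subgroup (unitaryGp c r) where
  carrier := {g | ∃ (x : E) (hx : RootParam c i k x), g = rootElt hik hx}
  mul_mem' := by
    rintro _ _ ⟨x, hx, rfl⟩ ⟨y, hy, rfl⟩
    exact ⟨x + y, hx.add hy, (rootElt_add hik hx hy).symm⟩
  one_mem' := ⟨0, RootParam.zero, (rootElt_zero hik).symm⟩
  inv_mem' := by
    rintro _ ⟨x, hx, rfl⟩
    exact ⟨-x, hx.neg, (rootElt_neg hik hx).symm⟩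

theorem rootElt_mem_rootSubgroup {x : E} (hx : RootParam c i k x) :
    rootElt hik hx ∈ rootSubgroup c hik := ⟨x, hx, rfl⟩

/-- The parameter is read off from the entry at `(i, k)`, and all the other entries are continuous
functions of it. -/
theorem isClosed_rootSubgroup : IsClosed (rootSubgroup c hik : Set (unitaryGp c r)) := by
  have h : (rootSubgroup c hik : Set (unitaryGp c r)) =
      {g | RootParam c i k (mat g i k)} ∩ ⋂ (a) (b),
        {g | mat g a b = eichlerMatrix c k (Pi.single i (mat g i k)) a b} := by
    ext g
    simp only [Set.mem_inter_iff, Set.mem_iInter]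
    constructor
    · rintro ⟨x, hx, rfl⟩
      have h1 := rootElt_apply_self hik hx
      refine ⟨?_, fun a b => ?_⟩
      · change RootParam c i k _
        rwa [h1]
      · change _ = eichlerMatrix c k (Pi.single i (mat (rootElt hik hx) i k)) a b
        rw [h1]
        rfl
    · rintro ⟨h1, h2⟩
      exact ⟨_, h1, mat_injective (by ext a b; exact h2 a b)⟩
  rw [h]
  have hc := continuous_conj c
  have hm := fun a b => continuous_mat_apply (c := c) (r := r) a b
  refine IsClosed.inter ?_ (isClosed_iInter fun a => isClosed_iInter fun b => isClosed_eq (hm a b) ?_)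
  · by_cases h : k.rev = i
    · have : {g : unitaryGp c r | RootParam c i k (mat g i k)} =
          {g | mat g i k + c (mat g i k) = 0} := by
        ext g
        exact ⟨fun h' => h' h, fun h' _ => h'⟩
      rw [this]
      exact isClosed_eq ((hm i k).add (hc.comp (hm i k))) continuous_const
    · have : {g : unitaryGp c r | RootParam c i k (mat g i k)} = Set.univ :=
        Set.eq_univ_of_forall fun g h' => absurd h' h
      rw [this]
      exact isClosed_univ
  · simp only [eichlerMatrix, of_apply]
    have hs : ∀ a, Continuous fun g : unitaryGp c r => (Pi.single i (mat g i k) : Fin (2 * r) → E) a := by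
      intro a
      simp only [Pi.single_apply]
      split_ifs
      · exact hm i k
      · exact continuous_const
    refine (continuous_const.add ?_).sub ?_
    · split_ifs
      · exact hs a
      · exact continuous_const
    · split_ifs
      · exact continuous_const
      · exact hc.comp (hs _)
      · exact continuous_const

end SimpleRoot

section SimpleRoot

variable {i k : Fin (2 * r)} (hk : k.1 = i.1 + 1)

-- No index lies strictly between `i` and `k = i + 1`, so only two terms of the matrix product
-- survive.
include hk in
theorem unipotent_mul_apply {g h : unitaryGp c r} (hg : g ∈ unipotentRadical c r)
    (hh : h ∈ unipotentRadical c r) : mat (g * h) i k = mat g i k + mat h i k := by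
  have hik : i ≠ k := fun h => by rw [h] at hk; omega
  rw [mat_mul, mul_apply, ← Finset.sum_subset (Finset.subset_univ {i, k}), Finset.sum_pair hik,
    hg.2, hh.2, one_mul, mul_one, add_comm]
  intro a _ ha
  simp only [Finset.mem_insert, Finset.mem_singleton, not_or] at ha
  by_cases h : a < i
  · rw [hg.1 h, zero_mul]
  · have : k < a := by
      rw [Fin.lt_def] at h ⊢
      have h1 := fun h' => ha.1 (Fin.ext h')
      have h2 := fun h' => ha.2 (Fin.ext h')
      omega
    rw [hh.1 this, mul_zero]

-- The `(i, k)` entry of `g⁻¹` is minus that of `g` by additivity, and it is also the conjugate of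
-- the entry of `g` at `(k.rev, i.rev)`.
include hk in
theorem unipotent_apply_rev {g : unitaryGp c r} (hg : g ∈ unipotentRadical c r) :
    mat g k.rev i.rev = -c (mat g i k) := by
  have h := unipotent_mul_apply hk hg (inv_mem hg)
  have hik : i ≠ k := fun h => by rw [h] at hk; omega
  rw [mul_inv_cancel, mat_one, one_apply_ne hik, mat_inv_apply] at h
  have h2 := congrArg c (eq_neg_of_add_eq_zero_right h.symm)
  rwa [conj_conj_apply, map_neg] at h2

include hk in
theorem rootParam_of_unipotent {g : unitaryGp c r} (hg : g ∈ unipotentRadical c r) :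
    RootParam c i k (mat g i k) := by
  intro h
  have h1 := unipotent_apply_rev hk hg
  rw [rev_eq_comm.1 h, h] at h1
  nth_rw 1 [h1]
  simp

theorem ne_of_val_eq_succ (hk : k.1 = i.1 + 1) : i ≠ k := fun h => by rw [h] at hk; omega

variable (c) in
/-- The elements of `N` whose entry at `(i, i+1)` vanishes. -/
def rootComplement : Subgroup (unitaryGp c r) where
  carrier := {g | g ∈ unipotentRadical c r ∧ mat g i k = 0}
  mul_mem' := fun ha hb => ⟨mul_mem ha.1 hb.1, by
    rw [unipotent_mul_apply hk ha.1 hb.1, ha.2, hb.2, add_zero]⟩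
  one_mem' := ⟨one_mem _, by rw [mat_one, one_apply_ne (ne_of_val_eq_succ hk)]⟩
  inv_mem' := fun {a} ha => ⟨inv_mem ha.1, by
    have h := unipotent_mul_apply hk ha.1 (inv_mem ha.1)
    rwa [mul_inv_cancel, mat_one, one_apply_ne (ne_of_val_eq_succ hk), ha.2, zero_add,
      eq_comm] at h⟩

theorem isClosed_rootComplement : IsClosed (rootComplement c hk : Set (unitaryGp c r)) := by
  have : (rootComplement c hk : Set (unitaryGp c r)) =
      (unipotentRadical c r : Set (unitaryGp c r)) ∩ {g | mat g i k = 0} := rfl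
  rw [this]
  exact (isClosed_unipotentRadical c r).inter (isClosed_eq (continuous_mat_apply i k) continuous_const)

include hk in
theorem rootSubgroup_le (hik : i ≠ k) : rootSubgroup c hik ≤ unipotentRadical c r := by
  rintro _ ⟨x, hx, rfl⟩
  have h0 : i < k := Fin.lt_def.2 (by omega)
  have h0' : k.rev < i.rev := Fin.rev_lt_rev.2 h0
  refine ⟨fun a b hab => ?_, fun a => ?_⟩
  · change b < a at hab
    rw [mat_rootElt, if_neg hab.ne', if_neg, if_neg]
    · simp
    · rintro ⟨rfl, rfl, -⟩
      exact lt_asymm hab h0'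
    · rintro ⟨rfl, rfl⟩
      exact lt_asymm hab h0
  · rw [mat_rootElt, if_pos rfl, if_neg, if_neg]
    · simp
    · rintro ⟨h1, h2, -⟩
      exact h0'.ne (h1.symm.trans h2)
    · rintro ⟨h1, h2⟩
      exact h0.ne (h1.symm.trans h2)

theorem continuous_rootElt_comp (hik : i ≠ k) {X : Type*} [TopologicalSpace X] {f : X → E} (hf : Continuous f)
    (h : ∀ x, RootParam c i k (f x)) : Continuous fun x => rootElt hik (h x) := by
  have hc := continuous_conj c
  refine continuous_unitary fun a b => ?_
  simp only [mat_rootElt]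
  refine (continuous_const.add ?_).sub ?_
  · split_ifs
    · exact hf
    · exact continuous_const
  · split_ifs
    · exact hc.comp hf
    · exact continuous_const

theorem rootElt_eq_rootElt {hik : i ≠ k} {x y : E} (hx : RootParam c i k x)
    (hy : RootParam c i k y) (h : x = y) : rootElt hik hx = rootElt hik hy := by
  subst h
  rfl

variable (c) in
/-- The projection of `N` to the root subgroup of a simple root. -/
def rootProj (hik : i ≠ k) : unipotentRadical c r →* rootSubgroup c hik where
  toFun n := ⟨rootElt hik (rootParam_of_unipotent hk n.2), rootElt_mem_rootSubgroup hik _⟩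
  map_one' := Subtype.ext ((rootElt_eq_rootElt (rootParam_of_unipotent hk (one_mem _))
    RootParam.zero (by rw [mat_one, one_apply_ne hik])).trans (rootElt_zero hik))
  map_mul' a b := Subtype.ext ((rootElt_eq_rootElt
    (rootParam_of_unipotent hk (mul_mem a.2 b.2))
    ((rootParam_of_unipotent hk a.2).add (rootParam_of_unipotent hk b.2))
    (unipotent_mul_apply hk a.2 b.2)).trans (rootElt_add hik (rootParam_of_unipotent hk a.2)
      (rootParam_of_unipotent hk b.2)))

theorem coe_rootProj (hik : i ≠ k) (n : unipotentRadical c r) :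
    (rootProj c hk hik n).1 = rootElt hik (rootParam_of_unipotent hk n.2) := rfl

variable (c) in
/-- The decomposition of `N` attached to a simple root. -/
def rootSemidirect (hik : i ≠ k) :
    Semidirect (latticeSubgroup c r) (rootSubgroup c hik) (rootComplement c hk)
      (unipotentRadical c r) where
  leA := rootSubgroup_le hk hik
  leN _ h := h.1
  proj := rootProj c hk hik
  continuous_proj := Continuous.subtype_mk (continuous_rootElt_comp hik
    ((continuous_mat_apply i k).comp continuous_subtype_val) fun n : unipotentRadical c r =>
      rootParam_of_unipotent hk n.2) _
  proj_left := by
    rintro ⟨_, x, hx, rfl⟩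
    exact Subtype.ext (rootElt_eq_rootElt (hik := hik) (rootParam_of_unipotent hk
      (rootSubgroup_le hk hik (rootElt_mem_rootSubgroup hik hx))) hx (rootElt_apply_self hik hx))
  proj_right n := Subtype.ext
    ((rootElt_eq_rootElt (rootParam_of_unipotent hk n.2.1) RootParam.zero n.2.2).trans (rootElt_zero hik))
  mem_of_proj h hh := ⟨h.2, by
    have h1 := congrArg (fun u : rootSubgroup c hik => mat u.1 i k) hh
    change mat (rootProj c hk hik h).1 i k = mat 1 i k at h1
    rwa [coe_rootProj, rootElt_apply_self, mat_one, one_apply_ne hik] at h1⟩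
  proj_mem h hh := rootElt_mem hik (rootParam_of_unipotent hk h.2) ((mem_latticeSubgroup_iff _).1 hh i k)

/-- The element of `L` that represents the simple reflection exchanging `i` and `k`. -/
abbrev reflElt (c : E ≃ₐ[F] E) (i k : Fin (2 * r)) : unitaryGp c r :=
  permElt c (swapPerm i k) (swapPerm_rev i k)

theorem reflElt_mem : reflElt c i k ∈ latticeSubgroup c r := permElt_mem _ _

theorem reflElt_inv : (reflElt c i k)⁻¹ = reflElt c i k := by
  rw [permElt_inv]
  congr 1

theorem reflElt_conj_apply (g : unitaryGp c r) (a b : Fin (2 * r)) :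
    mat (reflElt c i k * g * (reflElt c i k)⁻¹) a b = mat g (swapPerm i k a) (swapPerm i k b) := by
  rw [mat_permElt_conj_apply, swapPerm_symm]

theorem permElt_mem_normalizer_torus (π : Equiv.Perm (Fin (2 * r)))
    (hπ : ∀ i, π i.rev = (π i).rev) :
    permElt c π hπ ∈ Subgroup.normalizer (torus c r : Set (unitaryGp c r)) := by
  rw [Subgroup.mem_normalizer_iff]
  refine fun t => ⟨fun ht a b hab => ?_, fun ht a b hab => ?_⟩
  · change mat _ a b = 0
    rw [mat_permElt_conj_apply]
    exact ht fun h => hab (π.symm.injective h)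
  · have h1 := ht (fun h => hab (π.injective h) : π a ≠ π b)
    change mat _ _ _ = 0 at h1
    rwa [mat_permElt_conj_apply, Equiv.symm_apply_apply, Equiv.symm_apply_apply] at h1

-- A simple reflection reverses the order of no pair except `i < k` and its mirror image `k.rev <
-- i.rev`.
include hk in
theorem swapPerm_lt (hi : i.1 < r) {a b : Fin (2 * r)} (hab : b < a) :
    swapPerm i k b < swapPerm i k a ∨ (a = k ∧ b = i) ∨ (a = i.rev ∧ b = k.rev) := by
  simp only [swapPerm_apply]
  simp only [Fin.ext_iff, Fin.lt_def, Fin.val_rev] at *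
  split_ifs <;> (try simp only [Fin.val_rev]) <;> omega

/-- The only entries that the reflection moves below the diagonal sit at `(i, k)` and `(k.rev,
i.rev)`, and both vanish on the complement. -/
theorem reflElt_mem_normalizer (hi : i.1 < r) :
    reflElt c i k ∈ Subgroup.normalizer (rootComplement c hk : Set (unitaryGp c r)) := by
  have hik : i ≠ k := fun h => by rw [h] at hk; omega
  have key : ∀ n ∈ rootComplement c hk,
      reflElt c i k * n * (reflElt c i k)⁻¹ ∈ rootComplement c hk := by
    rintro n ⟨hn, hn0⟩
    refine ⟨⟨fun a b hab => ?_, fun a => ?_⟩, ?_⟩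
    · change b < a at hab
      rw [reflElt_conj_apply]
      rcases swapPerm_lt hk hi hab with h | ⟨rfl, rfl⟩ | ⟨rfl, rfl⟩
      · exact hn.1 h
      · rw [swapPerm_left, swapPerm_right, hn0]
      · rw [swapPerm_rev, swapPerm_rev, swapPerm_left, swapPerm_right, unipotent_apply_rev hk hn,
          hn0]
        simp
    · rw [reflElt_conj_apply, hn.2]
    · rw [reflElt_conj_apply, swapPerm_left, swapPerm_right]
      exact hn.1 (Fin.lt_def.2 (by omega) : i < k)
  rw [Subgroup.mem_normalizer_iff]
  refine fun n => ⟨key n, fun hn => ?_⟩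
  have h1 := key _ hn
  have h2 : reflElt c i k * (reflElt c i k * n * (reflElt c i k)⁻¹) * (reflElt c i k)⁻¹ = n := by
    calc _ = reflElt c i k * (reflElt c i k * n * (reflElt c i k)⁻¹) * reflElt c i k := by
          rw [reflElt_inv]
      _ = (reflElt c i k)⁻¹ * (reflElt c i k * n * (reflElt c i k)⁻¹) * reflElt c i k := by
          rw [reflElt_inv]
      _ = n := by group
  rwa [h2] at h1

theorem torus_mem_normalizer_rootComplement (t : torus c r) :
    t.1 ∈ Subgroup.normalizer (rootComplement c hk : Set (unitaryGp c r)) := by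
  have key : ∀ t : torus c r, ∀ n ∈ rootComplement c hk, t.1 * n * t.1⁻¹ ∈ rootComplement c hk := by
    rintro t n ⟨hn, hn0⟩
    refine ⟨conj_mem_of_mem_normalizer (torus_mem_normalizer t) hn, ?_⟩
    rw [mat_torus_conj, hn0, mul_zero, zero_mul]
  rw [Subgroup.mem_normalizer_iff]
  refine fun n => ⟨key t n, fun hn => ?_⟩
  have h1 := key t⁻¹ _ hn
  have h2 : (t⁻¹ : torus c r).1 * (t.1 * n * t.1⁻¹) * (t⁻¹ : torus c r).1⁻¹ = n := by
    change t.1⁻¹ * (t.1 * n * t.1⁻¹) * t.1⁻¹⁻¹ = n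
    group
  rwa [h2] at h1

theorem torus_mem_normalizer_rootSubgroup (hik : i ≠ k) (t : torus c r) :
    t.1 ∈ Subgroup.normalizer (rootSubgroup c hik : Set (unitaryGp c r)) := by
  have key : ∀ t : torus c r, ∀ n ∈ rootSubgroup c hik, t.1 * n * t.1⁻¹ ∈ rootSubgroup c hik := by
    rintro t _ ⟨x, hx, rfl⟩
    exact ⟨_, hx.torus t, torus_conj_rootElt hik hx t⟩
  rw [Subgroup.mem_normalizer_iff]
  refine fun n => ⟨key t n, fun hn => ?_⟩
  have h1 := key t⁻¹ _ hn
  have h2 : (t⁻¹ : torus c r).1 * (t.1 * n * t.1⁻¹) * (t⁻¹ : torus c r).1⁻¹ = n := by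
    change t.1⁻¹ * (t.1 * n * t.1⁻¹) * t.1⁻¹⁻¹ = n
    group
  rwa [h2] at h1

/-- The conjugate of an element of the torus under a simple reflection. -/
def reflTorus (i k : Fin (2 * r)) (t : torus c r) : torus c r :=
  ⟨reflElt c i k * t.1 * (reflElt c i k)⁻¹,
    conj_mem_of_mem_normalizer (permElt_mem_normalizer_torus _ _) t.2⟩

theorem reflTorus_apply (t : torus c r) (a : Fin (2 * r)) :
    mat (reflTorus i k t).1 a a = mat t.1 (swapPerm i k a) (swapPerm i k a) :=
  reflElt_conj_apply _ _ _

/-- `(t')⁻¹ u t' = t u t⁻¹` for `u` in the root subgroup, where `t'` is the reflection of `t`. -/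
theorem reflTorus_conj_rootElt (hik : i ≠ k) {x : E} (hx : RootParam c i k x) (t : torus c r) :
    (reflTorus i k t).1⁻¹ * rootElt hik hx * (reflTorus i k t).1 =
      t.1 * rootElt hik hx * t.1⁻¹ := by
  have h1 := torus_conj_rootElt hik hx (reflTorus i k t)⁻¹
  have h2 : ((reflTorus i k t)⁻¹ : torus c r).1⁻¹ = (reflTorus i k t).1 := inv_inv _
  rw [h2] at h1
  refine h1.trans ((rootElt_congr hik _ ?_).trans (torus_conj_rootElt hik hx t).symm)
  rw [torus_inv_apply, torus_inv_apply, inv_inv, reflTorus_apply, reflTorus_apply, swapPerm_left,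
    swapPerm_right]
  ring

/-- The elements `u t'` and `t u` lie in the same double coset. -/
theorem exists_reflTorus_eq (hik : i ≠ k) (hi : i.1 < r) {u : unitaryGp c r} (hu : u ∈ rootSubgroup c hik)
    (t : torus c r) : ∃ k₁ ∈ latticeSubgroup c r, ∃ k₂ ∈ latticeSubgroup c r,
      k₂ ∈ Subgroup.normalizer (rootComplement c hk : Set (unitaryGp c r)) ∧
      u * (reflTorus i k t).1 = k₁ * (t.1 * u) * k₂ := by
  obtain ⟨x, hx, rfl⟩ := hu
  set t' := (reflTorus i k t).1 with ht'def
  set w := reflElt c i k with hw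
  have ht' : t' = w * t.1 * w⁻¹ := rfl
  have hwK : w ∈ latticeSubgroup c r := reflElt_mem
  have hwn : w ∈ Subgroup.normalizer (rootComplement c hk : Set (unitaryGp c r)) :=
    reflElt_mem_normalizer hk hi
  have hUn : ∀ u ∈ rootSubgroup c hik,
      u ∈ Subgroup.normalizer (rootComplement c hk : Set (unitaryGp c r)) :=
    fun u hu => (rootSemidirect c hk hik).le_normalizer (rootSubgroup_le hk hik hu)
  have hww : w⁻¹ = w := reflElt_inv
  -- If `u` is integral, `u t' = (u w)(t u)(u⁻¹ w⁻¹)`.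
  by_cases h1 : ‖x‖ ≤ 1
  · have huK := rootElt_mem hik hx h1
    refine ⟨rootElt hik hx * w, mul_mem huK hwK, (rootElt hik hx)⁻¹ * w⁻¹,
      mul_mem (inv_mem huK) (inv_mem hwK),
      mul_mem (inv_mem (hUn _ (rootElt_mem_rootSubgroup hik hx))) (inv_mem hwn), ?_⟩
    rw [ht']
    group
  · set y := mat t.1 i i * x * (mat t.1 k k)⁻¹ with hy
    have hconj := torus_conj_rootElt hik hx t
    have hconj' := reflTorus_conj_rootElt hik hx t
    -- If `t u t⁻¹`, whose parameter is `y`, is integral, `u` is moved across `t'` by `t'⁻¹ u t' = t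
    -- u t⁻¹`.
    by_cases h2 : ‖y‖ ≤ 1
    · have huK := rootElt_mem hik (hx.torus t) h2
      refine ⟨w * (rootElt hik (hx.torus t))⁻¹, mul_mem hwK (inv_mem huK),
        w⁻¹ * rootElt hik (hx.torus t), mul_mem (inv_mem hwK) huK,
        mul_mem (inv_mem hwn) (hUn _ (rootElt_mem_rootSubgroup hik _)), ?_⟩
      calc rootElt hik hx * t' = t' * (t'⁻¹ * rootElt hik hx * t') := by group
        _ = t' * rootElt hik (hx.torus t) := by rw [hconj', hconj]
        _ = w * (t.1 * rootElt hik hx * t.1⁻¹)⁻¹ * (t.1 * rootElt hik hx) *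
            (w⁻¹ * rootElt hik (hx.torus t)) := by rw [ht']; group
        _ = _ := by rw [hconj]
    · have hx0 : x ≠ 0 := by
        rintro rfl
        exact h1 (by simp)
      -- Otherwise `x⁻¹` and `y⁻¹` are integral. Writing `u = v a w v` with `v` in the opposite root
      -- subgroup, both `v` and `v' = t v t⁻¹` lie in `L`, and `u t' = (v v'⁻¹)(t u)(v⁻¹ v')`.
      obtain ⟨a, ha⟩ := exists_rootElt_eq hik hx0 hx
      set v := rootElt hik.symm hx.inv with hv
      have hvK : v ∈ latticeSubgroup c r := by
        refine rootElt_mem _ _ ?_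
        rw [norm_inv]
        exact inv_le_one_of_one_le₀ (not_le.1 h1).le
      set v' := t.1 * v * t.1⁻¹ with hv'
      have hv'K : v' ∈ latticeSubgroup c r := by
        rw [hv', hv, torus_conj_rootElt]
        refine rootElt_mem _ _ ?_
        have : mat t.1 k k * x⁻¹ * (mat t.1 i i)⁻¹ = y⁻¹ := by
          rw [hy, mul_inv, mul_inv, inv_inv]
          ring
        rw [this, norm_inv]
        exact inv_le_one_of_one_le₀ (not_le.1 h2).le
      have hv'' : t'⁻¹ * v * t' = v' := by
        have h3 := torus_conj_rootElt hik.symm hx.inv (reflTorus i k t)⁻¹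
        have h4 : ((reflTorus i k t)⁻¹ : torus c r).1⁻¹ = t' := inv_inv _
        rw [h4] at h3
        refine h3.trans ((rootElt_congr hik.symm _ ?_).trans
          (torus_conj_rootElt hik.symm hx.inv t).symm)
        rw [torus_inv_apply, torus_inv_apply, inv_inv, reflTorus_apply, reflTorus_apply,
          swapPerm_left, swapPerm_right]
        ring
      -- The opposite root subgroup is the conjugate of the root subgroup by `w`, and both `w` and
      -- the root subgroup normalise the complement.
      have hvn : ∀ {z : E} (hz : RootParam c k i z), rootElt hik.symm hz ∈
          Subgroup.normalizer (rootComplement c hk : Set (unitaryGp c r)) := by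
        intro z hz
        have h5 : rootElt hik.symm hz = w * rootElt hik hz.swap * w⁻¹ :=
          (swapPerm_conj_rootElt hik hz.swap).symm
        rw [h5]
        exact mul_mem (mul_mem hwn (hUn _ (rootElt_mem_rootSubgroup hik _))) (inv_mem hwn)
      have hv'n : v' ∈ Subgroup.normalizer (rootComplement c hk : Set (unitaryGp c r)) := by
        rw [hv', hv, torus_conj_rootElt]
        exact hvn _
      have hcomm : a.1 * t.1 = t.1 * a.1 := congrArg Subtype.val (torus_comm c r a t)
      refine ⟨v * v'⁻¹, mul_mem hvK (inv_mem hv'K), v⁻¹ * v', mul_mem (inv_mem hvK) hv'K,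
        mul_mem (inv_mem (hvn _)) hv'n, ?_⟩
      have e1 : rootElt hik hx = v * a.1 * w * v := ha
      calc rootElt hik hx * t' = v * a.1 * w * t' * (t'⁻¹ * v * t') := by rw [e1]; group
        _ = v * a.1 * w * (w⁻¹ * t.1 * w) * v' := by
            rw [hv'', ht']
            congr 2
            rw [hww]
        _ = v * (a.1 * t.1) * w * v' := by group
        _ = v * (t.1 * a.1) * w * v' := by rw [hcomm]
        _ = v * (t.1 * v * t.1⁻¹)⁻¹ * (t.1 * (v * a.1 * w * v)) * (v⁻¹ * v') := by group
        _ = _ := by rw [e1]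

include hk in
theorem satakeTransform_reflTorus (hik : i ≠ k) (hi : i.1 < r)
    (f : HeckeAlgebra (latticeSubgroup c r)) (t : torus c r) :
    satakeTransform c r f (reflTorus i k t) = satakeTransform c r f t := by
  have := locallyCompactSpace_of_isClosed (isClosed_rootSubgroup (c := c) hik)
  have := compactSpace_interOpen (isClosed_rootSubgroup (c := c) hik)
  have := locallyCompactSpace_of_isClosed (isClosed_rootComplement (c := c) hk)
  have := compactSpace_interOpen (isClosed_rootComplement (c := c) hk)
  rw [satakeTransform_eq, satakeTransform_eq]
  refine (sqrt_conjChar_mul_orbitIntegral (rootSemidirect c hk hik) (isClosed_unipotentRadical c r) f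
    (t := t.1) (t' := (reflTorus i k t).1) (w := reflElt c i k) rfl reflElt_mem
    (reflElt_mem_normalizer hk hi) (torus_mem_normalizer t)
    (torus_mem_normalizer_rootSubgroup hik t) (torus_mem_normalizer_rootComplement hk t)
    (torus_mem_normalizer _) (torus_mem_normalizer_rootSubgroup hik _) ?_ ?_).symm
  · rintro _ ⟨x, hx, rfl⟩
    have h1 := reflTorus_conj_rootElt hik hx t⁻¹
    have h2 : (reflTorus i k t⁻¹).1⁻¹ = (reflTorus i k t).1 := by
      change (reflElt c i k * t.1⁻¹ * (reflElt c i k)⁻¹)⁻¹ = reflElt c i k * t.1 * (reflElt c i k)⁻¹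
      group
    have h3 : (reflTorus i k t⁻¹).1 = (reflTorus i k t).1⁻¹ := by rw [← h2, inv_inv]
    have h4 : (t⁻¹ : torus c r).1⁻¹ = t.1 := inv_inv _
    rw [h2, h3, h4] at h1
    exact h1
  · intro u hu
    exact exists_reflTorus_eq hk hik hi hu t

end SimpleRoot

end

section

open Matrix

variable {F E : Type*} [NontriviallyNormedField F] [IsUltrametricDist F] [LocallyCompactSpace F]
  [NontriviallyNormedField E] [NormedAlgebra F E] [Algebra.IsQuadraticExtension F E]
variable {c : E ≃ₐ[F] E} {r : ℕ}

/-! ### Indices, valuations and the identification of `Λ` with `ℤ^r`. -/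

section HalfIndex

/-- The inclusion of the first half of the indices. -/
def half (i : Fin r) : Fin (2 * r) := ⟨i.1, by omega⟩

theorem half_injective : Function.Injective (half : Fin r → Fin (2 * r)) :=
  fun _ _ h => Fin.ext (congrArg (fun a : Fin (2 * r) => a.1) h)

theorem half_lt_rev (i j : Fin r) : half i < (half j).rev := by
  rw [Fin.lt_def, Fin.val_rev]
  simp only [half]
  omega

theorem half_le_half {i j : Fin r} : half i ≤ half j ↔ i ≤ j := Iff.rfl

theorem half_ne_rev (i j : Fin r) : half i ≠ (half j).rev := (half_lt_rev i j).ne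

theorem exists_half (a : Fin (2 * r)) : ∃ i : Fin r, a = half i ∨ a = (half i).rev := by
  by_cases h : a.1 < r
  · exact ⟨⟨a.1, h⟩, Or.inl rfl⟩
  · refine ⟨⟨a.rev.1, by rw [Fin.val_rev]; omega⟩, Or.inr ?_⟩
    rw [Fin.ext_iff, Fin.val_rev]
    simp only [half, Fin.val_rev]
    omega

end HalfIndex

section Valuation

/-- Powers of `‖ϖ‖` bracket `‖x‖`, and a norm strictly between two consecutive powers would, after
rescaling, give an element of norm strictly between `‖ϖ‖` and 1. -/
theorem exists_norm_eq_zpow {ϖ : Eˣ} (hϖ : IsUniformizer ϖ) {x : E} (hx : x ≠ 0) :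
    ∃ n : ℤ, ‖x‖ = ‖(ϖ : E)‖ ^ n := by
  have hq : 0 < ‖(ϖ : E)‖ := norm_pos_iff.2 ϖ.ne_zero
  obtain ⟨n, hn1, hn2⟩ := exists_mem_Ico_zpow (norm_pos_iff.2 hx)
    (one_lt_inv_iff₀.2 ⟨hq, hϖ.1⟩ : 1 < ‖(ϖ : E)‖⁻¹)
  refine ⟨-n, ?_⟩
  rw [_root_.inv_zpow'] at hn1 hn2
  refine le_antisymm ?_ hn1
  by_contra! h
  have h1 : ‖(ϖ : E) ^ (-n) * x⁻¹‖ < 1 := by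
    rw [norm_mul, norm_zpow, norm_inv, ← div_eq_mul_inv, div_lt_one (norm_pos_iff.2 hx)]
    exact h
  have h2 := hϖ.2 _ h1
  rw [norm_mul, norm_zpow, norm_inv, ← div_eq_mul_inv, div_le_iff₀ (norm_pos_iff.2 hx)] at h2
  have h3 : ‖(ϖ : E)‖ ^ (-n) = ‖(ϖ : E)‖ * ‖(ϖ : E)‖ ^ (-(n + 1)) := by
    rw [← zpow_one_add₀ hq.ne']
    congr 1
    ring
  rw [h3] at h2
  exact absurd (le_of_mul_le_mul_left h2 hq) (not_le.2 hn2)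

theorem zpow_norm_injective {ϖ : Eˣ} (hϖ : IsUniformizer ϖ) {m n : ℤ}
    (h : ‖(ϖ : E)‖ ^ m = ‖(ϖ : E)‖ ^ n) : m = n :=
  zpow_right_injective₀ (norm_pos_iff.2 ϖ.ne_zero) hϖ.1.ne h

end Valuation

section Cochar

theorem mat_cochar_half (ϖ : Eˣ) (l : Fin r → ℤ) (i : Fin r) :
    mat (cochar c r ϖ l).1 (half i) (half i) = (ϖ : E) ^ l i := by
  change diagonal _ _ _ = _
  rw [diagonal_apply_eq]
  simp [torusEntry, half]

theorem norm_cochar_half (ϖ : Eˣ) (l : Fin r → ℤ) (i : Fin r) :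
    ‖mat (cochar c r ϖ l).1 (half i) (half i)‖ = ‖(ϖ : E)‖ ^ l i := by
  rw [mat_cochar_half, norm_zpow]

theorem norm_cochar_rev (ϖ : Eˣ) (l : Fin r → ℤ) (i : Fin r) :
    ‖mat (cochar c r ϖ l).1 (half i).rev (half i).rev‖ = ‖(ϖ : E)‖ ^ (-l i) := by
  rw [norm_torus_rev, norm_cochar_half, _root_.zpow_neg]

theorem torus_eq_iff_half {s t : torus c r} :
    s = t ↔ ∀ i, mat s.1 (half i) (half i) = mat t.1 (half i) (half i) := by
  refine ⟨fun h _ => by rw [h], fun h => torus_ext fun a => ?_⟩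
  obtain ⟨i, rfl | rfl⟩ := exists_half a
  · exact h i
  · have h1 := torus_apply_mul s (half i).rev
    have h2 := torus_apply_mul t (half i).rev
    rw [Fin.rev_rev] at h1 h2
    rw [eq_inv_of_mul_eq_one_left h1, eq_inv_of_mul_eq_one_left h2, h i]

theorem cochar_add (ϖ : Eˣ) (l m : Fin r → ℤ) :
    cochar c r ϖ (l + m) = cochar c r ϖ l * cochar c r ϖ m := by
  rw [torus_eq_iff_half]
  intro i
  rw [torus_mul_apply, mat_cochar_half, mat_cochar_half, mat_cochar_half, Pi.add_apply,
    zpow_add₀ ϖ.ne_zero]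

theorem mk_eq_mk_iff {s t : torus c r} :
    (QuotientGroup.mk s : cocharLattice c r) = QuotientGroup.mk t ↔
      ∀ i, ‖mat s.1 (half i) (half i)‖ = ‖mat t.1 (half i) (half i)‖ := by
  have key : ∀ i, ‖mat (s⁻¹ * t).1 i i‖ = ‖mat s.1 i i‖⁻¹ * ‖mat t.1 i i‖ := by
    intro i
    rw [torus_mul_apply, torus_inv_apply, norm_mul, norm_inv]
  have h1 : ∀ i, ‖mat (s⁻¹ * t).1 i i‖ = 1 ↔ ‖mat s.1 i i‖ = ‖mat t.1 i i‖ := by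
    intro i
    rw [key, inv_mul_eq_one₀ (norm_ne_zero_iff.2 (torus_apply_ne_zero s i))]
  rw [QuotientGroup.eq]
  change s⁻¹ * t ∈ torusCompact c r ↔ _
  rw [torus_mem_iff_eq]
  refine ⟨fun h i => (h1 _).1 (h _), fun h a => ?_⟩
  rw [h1]
  obtain ⟨i, rfl | rfl⟩ := exists_half a
  · exact h i
  · rw [norm_torus_rev, norm_torus_rev, h i]

theorem mk_eq_mk_cochar_iff {ϖ : Eˣ} {t : torus c r} {l : Fin r → ℤ} :
    (QuotientGroup.mk t : cocharLattice c r) = QuotientGroup.mk (cochar c r ϖ l) ↔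
      ∀ i, ‖mat t.1 (half i) (half i)‖ = ‖(ϖ : E)‖ ^ l i := by
  simp only [mk_eq_mk_iff, norm_cochar_half]

theorem exists_mk_eq_cochar {ϖ : Eˣ} (hϖ : IsUniformizer ϖ) (t : torus c r) :
    ∃ l, (QuotientGroup.mk t : cocharLattice c r) = QuotientGroup.mk (cochar c r ϖ l) := by
  choose l hl using fun i => exists_norm_eq_zpow hϖ (torus_apply_ne_zero t (half i))
  exact ⟨l, mk_eq_mk_cochar_iff.2 hl⟩

theorem mk_cochar_injective {ϖ : Eˣ} (hϖ : IsUniformizer ϖ) {l m : Fin r → ℤ}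
    (h : (QuotientGroup.mk (cochar c r ϖ l) : cocharLattice c r) =
      QuotientGroup.mk (cochar c r ϖ m)) : l = m := by
  rw [mk_eq_mk_cochar_iff] at h
  funext i
  have := h i
  rw [norm_cochar_half] at this
  exact zpow_norm_injective hϖ this

/-- `Λ` is isomorphic to `ℤ^r`, the class of `ϖ^l` corresponding to `l`. -/
def cocharEquiv {ϖ : Eˣ} (hϖ : IsUniformizer ϖ) :
    Multiplicative (Fin r → ℤ) ≃* cocharLattice c r :=
  MulEquiv.ofBijective
    (MonoidHom.mk' (fun l => QuotientGroup.mk (cochar c r ϖ l.toAdd)) fun l m => by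
      rw [toAdd_mul, cochar_add]
      rfl)
    ⟨fun _ _ h => mk_cochar_injective hϖ h, fun x => by
      obtain ⟨t, rfl⟩ := QuotientGroup.mk_surjective x
      obtain ⟨l, hl⟩ := exists_mk_eq_cochar hϖ t
      exact ⟨Multiplicative.ofAdd l, hl.symm⟩⟩

end Cochar

/-! ### Bounds for minors, invariant under `L` on both sides. -/

section Minors

variable {ι : Type*} [Fintype ι] [DecidableEq ι]

/-- All minors indexed by `ι` are bounded by `C`. -/
def MinorBound (ι : Type*) [Fintype ι] [DecidableEq ι] (g : unitaryGp c r) (C : ℝ) : Prop :=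
  ∀ f h : ι → Fin (2 * r), ‖((mat g).submatrix f h).det‖ ≤ C

theorem MinorBound.nonneg {g : unitaryGp c r} {C : ℝ} (f : ι → Fin (2 * r)) (h : MinorBound ι g C) :
    0 ≤ C := (norm_nonneg _).trans (h f f)

theorem MinorBound.transpose {g : unitaryGp c r} {C : ℝ} (h : MinorBound ι g C) :
    MinorBound ι (transposeElt g) C := fun f k => by
  rw [mat_transposeElt, ← transpose_submatrix, det_transpose]
  exact h k f

theorem norm_prod_le_one {f : ι → E} (h : ∀ i, ‖f i‖ ≤ 1) : ‖∏ i, f i‖ ≤ 1 := by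
  rw [norm_prod]
  exact Finset.prod_le_one (fun i _ => norm_nonneg _) fun i _ => h i

/-- Multilinearity in the rows suffices: `s` runs over all maps, not only increasing ones as in the
Cauchy–Binet formula, and the ultrametric inequality does not mind the extra terms. -/
theorem det_mul_submatrix (M N : Matrix (Fin (2 * r)) (Fin (2 * r)) E) (f h : ι → Fin (2 * r)) :
    ((M * N).submatrix f h).det =
      ∑ s : ι → Fin (2 * r), (∏ a, M (f a) (s a)) * (N.submatrix s h).det := by
  have h1 : (M * N).submatrix f h = fun a => ∑ p, M (f a) p • fun b => N p (h b) := by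
    ext a b
    simp [mul_apply, Finset.sum_apply]
  rw [h1]
  refine (MultilinearMap.map_sum (detRowAlternating (R := E) (n := ι)).toMultilinearMap _).trans ?_
  refine Finset.sum_congr rfl fun s _ => ?_
  exact (MultilinearMap.map_smul_univ (detRowAlternating (R := E) (n := ι)).toMultilinearMap
    (fun a => M (f a) (s a)) fun a b => N (s a) (h b))

theorem MinorBound.mul_left {g x : unitaryGp c r} {C : ℝ} (hg : g ∈ latticeSubgroup c r)
    (hx : MinorBound ι x C) : MinorBound ι (g * x) C := by
  have : IsUltrametricDist E := IsUltrametricDist.of_normedAlgebra F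
  intro f h
  rw [mat_mul, det_mul_submatrix]
  refine IsUltrametricDist.norm_sum_le_of_forall_le_of_nonneg (hx.nonneg f) fun s _ => ?_
  rw [norm_mul]
  calc _ ≤ 1 * C := mul_le_mul (norm_prod_le_one fun a => (mem_latticeSubgroup_iff g).1 hg _ _)
        (hx s h) (norm_nonneg _) zero_le_one
    _ = C := one_mul C

theorem MinorBound.mul_right {g x : unitaryGp c r} {C : ℝ} (hg : g ∈ latticeSubgroup c r)
    (hx : MinorBound ι x C) : MinorBound ι (x * g) C := by
  have h := (hx.transpose.mul_left (transposeElt_mem hg)).transpose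
  rwa [← transposeElt_mul, transposeElt_transposeElt] at h

theorem norm_det_le_one {M : Matrix ι ι E} (hM : ∀ i j, ‖M i j‖ ≤ 1) [IsUltrametricDist E] :
    ‖M.det‖ ≤ 1 := by
  rw [det_apply]
  refine IsUltrametricDist.norm_sum_le_of_forall_le_of_nonneg zero_le_one fun σ _ => ?_
  rcases Int.units_eq_one_or (Equiv.Perm.sign σ) with h | h <;> rw [h]
  · rw [one_smul]
    exact norm_prod_le_one fun i => hM _ _
  · rw [Units.neg_smul, one_smul, norm_neg]
    exact norm_prod_le_one fun i => hM _ _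

/-- Each row is a diagonal entry of `t` times a row of a submatrix of the identity, whose
determinant is integral. -/
theorem norm_det_torus_submatrix_le (t : torus c r) (f h : ι → Fin (2 * r)) :
    ‖((mat t.1).submatrix f h).det‖ ≤ ∏ a, ‖mat t.1 (f a) (f a)‖ := by
  have : IsUltrametricDist E := IsUltrametricDist.of_normedAlgebra F
  have h1 : (mat t.1).submatrix f h = of fun a b => mat t.1 (f a) (f a) *
      ((1 : Matrix (Fin (2 * r)) (Fin (2 * r)) E).submatrix f h) a b := by
    ext a b
    rw [mat_torus t]
    simp only [submatrix_apply, of_apply, diagonal_apply_eq]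
    by_cases hab : f a = h b
    · rw [hab, diagonal_apply_eq, one_apply_eq, mul_one]
    · rw [diagonal_apply_ne _ hab, one_apply_ne hab, mul_zero]
  rw [h1, det_mul_column, norm_mul, norm_prod]
  refine mul_le_of_le_one_right (Finset.prod_nonneg fun _ _ => norm_nonneg _)
    (norm_det_le_one fun a b => ?_)
  rw [submatrix_apply, one_apply]
  split_ifs <;> simp

/-- The common factors over `s ∩ t` cancel, and the remaining ones, equally many on both sides, are
compared through `m`. -/
theorem prod_le_prod_of_threshold {α : Type*} [DecidableEq α] {s t : Finset α} (hst : s.card = t.card)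
    {φ : α → ℝ} (h0 : ∀ a, 0 ≤ φ a) {m : ℝ} (hm : 0 ≤ m) (hs : ∀ a ∈ s \ t, φ a ≤ m)
    (ht : ∀ a ∈ t \ s, m ≤ φ a) : ∏ a ∈ s, φ a ≤ ∏ a ∈ t, φ a := by
  rw [← Finset.prod_inter_mul_prod_sdiff s t, ← Finset.prod_inter_mul_prod_sdiff t s, Finset.inter_comm]
  refine mul_le_mul_of_nonneg_left ?_ (Finset.prod_nonneg fun a _ => h0 a)
  calc _ ≤ m ^ (s \ t).card := by
        rw [← Finset.prod_const]
        exact Finset.prod_le_prod (fun a _ => h0 a) hs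
    _ = m ^ (t \ s).card := by rw [Finset.card_sdiff_comm hst]
    _ ≤ _ := by
        rw [← Finset.prod_const]
        exact Finset.prod_le_prod (fun a _ => hm) ht

end Minors

/-! ### The dominance order and double cosets. -/

section Dominance

/-- The sum of the first coordinates up to `j`. -/
def partialSum (l : Fin r → ℤ) (j : Fin r) : ℤ := ∑ i ∈ Finset.Iic j, l i

/-- Dominant exponents decrease along the diagonal and `‖ϖ‖ < 1`, so the last diagonal entries are
the largest. -/
theorem norm_cochar_monotone {ϖ : Eˣ} (hϖ : IsUniformizer ϖ) {l : Fin r → ℤ} (hl : l ∈ dominant r) :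
    Monotone fun a => ‖mat (cochar c r ϖ l).1 a a‖ := by
  have hq : 0 < ‖(ϖ : E)‖ := norm_pos_iff.2 ϖ.ne_zero
  have key : ∀ {m n : ℤ}, n ≤ m → ‖(ϖ : E)‖ ^ m ≤ ‖(ϖ : E)‖ ^ n :=
    fun h => zpow_le_zpow_right_of_le_one₀ hq hϖ.1.le h
  intro a b hab
  obtain ⟨i, rfl | rfl⟩ := exists_half a <;> obtain ⟨j, rfl | rfl⟩ := exists_half b
  · simp only [norm_cochar_half]
    exact key (hl.1 hab)
  · simp only [norm_cochar_half, norm_cochar_rev]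
    exact key (by linarith [hl.2 i, hl.2 j])
  · exact absurd hab (not_le.2 (half_lt_rev j i))
  · simp only [norm_cochar_rev]
    exact key (neg_le_neg (hl.1 (half_le_half.1 (Fin.rev_le_rev.1 hab))))

theorem prod_norm_cochar (ϖ : Eˣ) (l : Fin r → ℤ) (j : Fin r) :
    ∏ i : Finset.Iic j, ‖mat (cochar c r ϖ l).1 (half i.1).rev (half i.1).rev‖ =
      ‖(ϖ : E)‖ ^ (-partialSum l j) := by
  simp only [norm_cochar_rev]
  rw [Finset.prod_coe_sort (Finset.Iic j) (fun i => ‖(ϖ : E)‖ ^ (-l i)), partialSum,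
    ← Finset.sum_neg_distrib]
  generalize Finset.Iic j = s
  classical
  induction s using Finset.induction_on with
  | empty => simp
  | insert a s ha ih =>
    rw [Finset.prod_insert ha, Finset.sum_insert ha, ih, zpow_add₀ (norm_ne_zero_iff.2 ϖ.ne_zero)]

/-- A minor with distinct rows is bounded by the product of the corresponding diagonal norms, which
is largest for the last rows; a minor with a repeated row is 0. -/
theorem minorBound_cochar {ϖ : Eˣ} (hϖ : IsUniformizer ϖ) {l : Fin r → ℤ} (hl : l ∈ dominant r)
    (j : Fin r) : MinorBound (Finset.Iic j) (cochar c r ϖ l).1 (‖(ϖ : E)‖ ^ (-partialSum l j)) := by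
  intro f h
  by_cases hf : Function.Injective f
  · refine (norm_det_torus_submatrix_le _ f h).trans ?_
    rw [← prod_norm_cochar (c := c)]
    set φ : Fin (2 * r) → ℝ := fun a => ‖mat (cochar c r ϖ l).1 a a‖ with hφ
    have hφm : Monotone φ := norm_cochar_monotone hϖ hl
    have hinj : Function.Injective fun i : Finset.Iic j => (half i.1).rev :=
      Fin.rev_injective.comp (half_injective.comp Subtype.val_injective)
    have e1 := Finset.prod_map Finset.univ (⟨f, hf⟩ : Finset.Iic j ↪ Fin (2 * r)) φ
    have e2 := Finset.prod_map Finset.univ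
      (⟨fun i => (half i.1).rev, hinj⟩ : Finset.Iic j ↪ Fin (2 * r)) φ
    refine e1.symm.trans_le (le_trans ?_ e2.le)
    refine prod_le_prod_of_threshold (by rw [Finset.card_map, Finset.card_map])
      (fun a => norm_nonneg _) (m := φ (half j).rev) (norm_nonneg _) ?_ ?_
    · intro a ha
      rw [Finset.mem_sdiff] at ha
      apply hφm
      by_contra! h1
      apply ha.2
      rw [Finset.mem_map]
      obtain ⟨i, rfl | rfl⟩ := exists_half a
      · exact absurd h1 (half_lt_rev _ _).asymm
      · exact ⟨⟨i, Finset.mem_Iic.2 (half_le_half.1 (Fin.rev_lt_rev.1 h1).le)⟩, Finset.mem_univ _, rfl⟩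
    · intro a ha
      rw [Finset.mem_sdiff, Finset.mem_map] at ha
      obtain ⟨⟨i, _, rfl⟩, _⟩ := ha
      exact hφm (Fin.rev_le_rev.2 (half_le_half.2 (Finset.mem_Iic.1 i.2)))
  · rw [Function.Injective] at hf
    push Not at hf
    obtain ⟨a, b, hab, hne⟩ := hf
    rw [det_zero_of_row_eq hne (by ext k; rw [submatrix_apply, submatrix_apply, hab]), norm_zero]
    exact zpow_nonneg (norm_nonneg _) _

/-- Indexing by `(half i).rev` reverses the order, so the upper triangular lower right corner
appears as a lower triangular matrix. -/
theorem det_torus_mul_unipotent (t : torus c r) {n : unitaryGp c r} (hn : n ∈ unipotentRadical c r)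
    (j : Fin r) :
    ((mat (t.1 * n)).submatrix (fun i : Finset.Iic j => (half i.1).rev)
      fun i : Finset.Iic j => (half i.1).rev).det =
      ∏ i : Finset.Iic j, mat t.1 (half i.1).rev (half i.1).rev := by
  rw [det_of_isLowerTriangular]
  · refine Finset.prod_congr rfl fun i _ => ?_
    rw [submatrix_apply, mat_torus_mul, hn.2, mul_one]
  · intro a b hab
    rw [submatrix_apply, mat_torus_mul, hn.1, mul_zero]
    exact Fin.rev_lt_rev.2 hab

/-- If `ϖ^m n` lies in the double coset of a dominant `ϖ^l`, then `m` is dominated by `l`. -/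
theorem partialSum_le {ϖ : Eˣ} (hϖ : IsUniformizer ϖ) {l m : Fin r → ℤ} (hl : l ∈ dominant r)
    {n k k' : unitaryGp c r} (hn : n ∈ unipotentRadical c r) (hk : k ∈ latticeSubgroup c r)
    (hk' : k' ∈ latticeSubgroup c r)
    (h : (cochar c r ϖ m).1 * n = k * (cochar c r ϖ l).1 * k') (j : Fin r) :
    partialSum m j ≤ partialSum l j := by
  have h1 := ((minorBound_cochar (c := c) hϖ hl j).mul_left hk).mul_right hk'
  rw [← h] at h1
  have h2 := h1 (fun i => (half i.1).rev) (fun i => (half i.1).rev)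
  rw [det_torus_mul_unipotent _ hn, norm_prod, prod_norm_cochar] at h2
  have := (zpow_le_zpow_iff_right_of_lt_one₀ (norm_pos_iff.2 ϖ.ne_zero) hϖ.1).1 h2
  linarith

theorem partialSum_injective {l m : Fin r → ℤ} (h : ∀ j, partialSum l j = partialSum m j) : l = m := by
  have key : ∀ n : ℕ, ∀ j : Fin r, j.1 = n → l j = m j := by
    intro n
    induction n using Nat.strong_induction_on with
    | _ n ih =>
      intro j hj
      have h1 := h j
      rw [partialSum, partialSum, ← Finset.Iio_insert, Finset.sum_insert (by simp),
        Finset.sum_insert (by simp)] at h1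
      have h2 : ∑ i ∈ Finset.Iio j, l i = ∑ i ∈ Finset.Iio j, m i :=
        Finset.sum_congr rfl fun i hi => ih i.1 (hj ▸ Fin.lt_def.1 (Finset.mem_Iio.1 hi)) i rfl
      linarith
  exact funext fun j => key _ j rfl

theorem eq_of_mem_doubleCoset {ϖ : Eˣ} (hϖ : IsUniformizer ϖ) {l m : Fin r → ℤ}
    (hl : l ∈ dominant r) (hm : m ∈ dominant r) {k k' : unitaryGp c r}
    (hk : k ∈ latticeSubgroup c r) (hk' : k' ∈ latticeSubgroup c r)
    (h : (cochar c r ϖ m).1 = k * (cochar c r ϖ l).1 * k') : m = l := by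
  refine partialSum_injective fun j => le_antisymm ?_ ?_
  · exact partialSum_le hϖ hl (one_mem _) hk hk' (by rw [mul_one, h]) j
  · refine partialSum_le hϖ hm (one_mem _) (inv_mem hk) (inv_mem hk') ?_ j
    rw [h]
    group

end Dominance

end

section

open Matrix

/-! ### Signed permutations, their generation by simple reflections, and dominance. -/

section SignedPerm

variable {r : ℕ}

theorem signedPerm_apply (σ : Equiv.Perm (Fin r)) (ε : Fin r → ℤˣ) (l : Fin r → ℤ) (i : Fin r) :
    signedPerm σ ε l i = ε i * l (σ.symm i) := rfl

/-- A signed permutation as a permutation of `ℤ^r`. -/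
def signedEquiv (σ : Equiv.Perm (Fin r)) (ε : Fin r → ℤˣ) : Equiv.Perm (Fin r → ℤ) :=
  (signedPerm σ ε).toEquiv

theorem signedEquiv_mul (σ τ : Equiv.Perm (Fin r)) (ε δ : Fin r → ℤˣ) :
    signedEquiv σ ε * signedEquiv τ δ =
      signedEquiv (σ * τ) fun i => ε i * δ (σ.symm i) := by
  refine Equiv.ext fun l => funext fun i => ?_
  change (ε i : ℤ) * (δ (σ.symm i) * l (τ.symm (σ.symm i))) =
    ((ε i * δ (σ.symm i) : ℤˣ) : ℤ) * l ((σ * τ).symm i)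
  rw [Units.val_mul, mul_assoc]
  rfl

theorem signedEquiv_one : (signedEquiv 1 1 : Equiv.Perm (Fin r → ℤ)) = 1 := by
  refine Equiv.ext fun l => funext fun i => ?_
  change signedPerm 1 1 l i = l i
  simp [signedPerm_apply, ← Equiv.Perm.inv_def]

/-- The simple reflections generate the group of signed permutations. -/
theorem signedPerm_mem_of_simple (H : Subgroup (Equiv.Perm (Fin r → ℤ)))
    (h1 : ∀ i j : Fin r, j.1 = i.1 + 1 → signedEquiv (Equiv.swap i j) 1 ∈ H)
    (h2 : ∀ i : Fin r, i.1 + 1 = r → signedEquiv 1 (Pi.mulSingle i (-1)) ∈ H)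
    (σ : Equiv.Perm (Fin r)) (ε : Fin r → ℤˣ) : signedEquiv σ ε ∈ H := by
  have hσ : ∀ σ : Equiv.Perm (Fin r), signedEquiv σ 1 ∈ H := by
    intro σ
    cases r with
    | zero =>
      rw [Subsingleton.elim σ 1, signedEquiv_one]
      exact one_mem _
    | succ n =>
      have hσ : σ ∈ Submonoid.closure
          (Set.range fun i : Fin n => Equiv.swap i.castSucc i.succ) := by
        rw [Equiv.Perm.mclosure_swap_castSucc_succ]
        trivial
      induction hσ using Submonoid.closure_induction with
      | mem _ h =>
        obtain ⟨i, rfl⟩ := h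
        exact h1 _ _ (by simp)
      | one =>
        rw [signedEquiv_one]
        exact one_mem _
      | mul σ τ _ _ hσ hτ =>
        have := mul_mem hσ hτ
        rw [signedEquiv_mul] at this
        simpa [Pi.one_def] using this
  -- Every sign change is conjugate to that of the last coordinate by a transposition.
  have hflip : ∀ i, signedEquiv 1 (Pi.mulSingle i (-1)) ∈ H := by
    intro i
    have hr : r - 1 < r := by have := i.2; omega
    set m : Fin r := ⟨r - 1, hr⟩
    have h := mul_mem (mul_mem (hσ (Equiv.swap i m)) (h2 m (by simp only [m]; omega)))
      (hσ (Equiv.swap i m))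
    rw [signedEquiv_mul, signedEquiv_mul] at h
    have e1 : Equiv.swap i m * 1 * Equiv.swap i m = 1 := by simp
    rw [e1] at h
    convert h using 2
    funext a
    simp only [Pi.one_apply, one_mul, mul_one, Equiv.symm_swap, Pi.mulSingle_apply]
    refine if_congr ?_ rfl rfl
    rw [Equiv.swap_apply_eq_iff, Equiv.swap_apply_right]
  have hε : signedEquiv 1 ε ∈ H := by
    let φ : (Fin r → ℤˣ) →* Equiv.Perm (Fin r → ℤ) :=
      { toFun := signedEquiv 1
        map_one' := signedEquiv_one
        map_mul' := fun ε δ => by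
          rw [signedEquiv_mul]
          rfl }
    have h : ε ∈ H.comap φ := by
      rw [← Finset.univ_prod_mulSingle ε]
      refine prod_mem fun i _ => ?_
      rcases Int.units_eq_one_or (ε i) with h | h <;> rw [h]
      · rw [Pi.mulSingle_one]
        exact one_mem _
      · exact hflip i
    exact h
  have h := mul_mem hε (hσ σ)
  rw [signedEquiv_mul] at h
  simpa using h

/-- Sort the coordinates by decreasing absolute value and make them nonnegative. -/
theorem exists_signedPerm_dominant (l : Fin r → ℤ) : ∃ σ ε, signedPerm σ ε l ∈ dominant r := by
  set σ := Tuple.sort fun i => -|l i| with hσ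
  have h := Tuple.monotone_sort fun i => -|l i|
  have habs : ∀ x : ℤ, ∃ e : ℤˣ, (e : ℤ) * x = |x| := by
    intro x
    rcases abs_choice x with h | h
    · exact ⟨1, by simp [h]⟩
    · exact ⟨-1, by simp [h]⟩
  choose e he using habs
  have key : ∀ i, signedPerm σ.symm (fun i => e (l (σ i))) l i = |l (σ i)| := fun i => he _
  refine ⟨σ.symm, fun i => e (l (σ i)), fun i j hij => ?_, fun i => ?_⟩
  · rw [key, key]
    exact neg_le_neg_iff.1 (h hij)
  · rw [key]
    exact abs_nonneg _

end SignedPerm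

variable {F E : Type*} [NontriviallyNormedField F] [IsUltrametricDist F] [LocallyCompactSpace F]
  [NontriviallyNormedField E] [NormedAlgebra F E] [Algebra.IsQuadraticExtension F E]
variable {c : E ≃ₐ[F] E} {r : ℕ}

/-! ### Simple reflections acting on `Λ`. -/

section SimpleReflections

variable {ϖ : Eˣ}

theorem mk_reflTorus_swap {i j : Fin r} (hij : i ≠ j) (l : Fin r → ℤ) :
    (QuotientGroup.mk (reflTorus (half i) (half j) (cochar c r ϖ l)) : cocharLattice c r) =
      QuotientGroup.mk (cochar c r ϖ (signedPerm (Equiv.swap i j) 1 l)) := by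
  rw [mk_eq_mk_cochar_iff]
  intro a
  rw [reflTorus_apply, signedPerm_apply, Equiv.symm_swap]
  by_cases h1 : a = i
  · subst h1
    rw [swapPerm_left, norm_cochar_half]
    simp
  by_cases h2 : a = j
  · subst h2
    rw [swapPerm_right, norm_cochar_half]
    simp
  rw [swapPerm_of_ne (half_injective.ne h1) (half_injective.ne h2) (half_ne_rev _ _)
    (half_ne_rev _ _), norm_cochar_half, Equiv.swap_apply_of_ne_of_ne h1 h2]
  simp

theorem mk_reflTorus_flip (i : Fin r) (l : Fin r → ℤ) :
    (QuotientGroup.mk (reflTorus (half i) (half i).rev (cochar c r ϖ l)) : cocharLattice c r) =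
      QuotientGroup.mk (cochar c r ϖ (signedPerm 1 (Pi.mulSingle i (-1)) l)) := by
  rw [mk_eq_mk_cochar_iff]
  intro a
  rw [reflTorus_apply, signedPerm_apply]
  by_cases h1 : a = i
  · subst h1
    rw [swapPerm_left, norm_cochar_rev]
    simp [← Equiv.Perm.inv_def]
  rw [swapPerm_of_ne (half_injective.ne h1) (half_ne_rev _ _) (half_ne_rev _ _)
    (by rw [Fin.rev_rev]; exact half_injective.ne h1), norm_cochar_half, Pi.mulSingle_eq_of_ne h1]
  simp [← Equiv.Perm.inv_def]

/-- A function on `Λ` invariant under the simple reflections is invariant under the signed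
permutations. -/
theorem signedPerm_invariant {α : Type*} {f : cocharLattice c r → α}
    (h : ∀ i k : Fin (2 * r), k.1 = i.1 + 1 → i.1 < r → ∀ t : torus c r,
      f (QuotientGroup.mk (reflTorus i k t)) = f (QuotientGroup.mk t))
    (ϖ : Eˣ) (σ : Equiv.Perm (Fin r)) (ε : Fin r → ℤˣ) (l : Fin r → ℤ) :
    f (QuotientGroup.mk (cochar c r ϖ (signedPerm σ ε l))) =
      f (QuotientGroup.mk (cochar c r ϖ l)) := by
  let φ : (Fin r → ℤ) → α := fun l => f (QuotientGroup.mk (cochar c r ϖ l))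
  let H : Subgroup (Equiv.Perm (Fin r → ℤ)) :=
    { carrier := {u | ∀ l, φ (u l) = φ l}
      mul_mem' := fun {u v} hu hv l => (hu (v l)).trans (hv l)
      one_mem' := fun _ => rfl
      inv_mem' := fun {u} hu l => by
        have h1 := hu (u.symm l)
        rw [Equiv.apply_symm_apply] at h1
        exact h1.symm }
  refine signedPerm_mem_of_simple H (fun i j hij l => ?_) (fun i hi l => ?_) σ ε l
  · change f (QuotientGroup.mk (cochar c r ϖ (signedPerm _ _ l))) = f _
    rw [← mk_reflTorus_swap (fun h => by rw [h] at hij; omega), h _ _ hij i.2]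
  -- For the last `i` the index `(half i).rev` is the successor of `half i`, so this sign change is
  -- again a simple reflection.
  · change f (QuotientGroup.mk (cochar c r ϖ (signedPerm _ _ l))) = f _
    rw [← mk_reflTorus_flip, h _ _ _ i.2]
    rw [Fin.val_rev]
    simp only [half]
    omega

theorem weylLattice_mk (w : weylGroup c r) (t : torus c r) :
    weylLattice c r w (QuotientGroup.mk t) = QuotientGroup.mk (weylAction c r w t) := rfl

theorem exists_weylAction_eq_reflTorus (i k : Fin (2 * r)) :
    ∃ w : weylGroup c r, ∀ t, weylAction c r w t = reflTorus i k t :=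
  ⟨QuotientGroup.mk ⟨reflElt c i k, permElt_mem_normalizer_torus _ _⟩, fun _ => rfl⟩

/-- Every signed permutation is the action of an element of the Weyl group. -/
theorem exists_weylLattice_eq (ϖ : Eˣ) (σ : Equiv.Perm (Fin r)) (ε : Fin r → ℤˣ) :
    ∃ w : weylGroup c r, ∀ l : Fin r → ℤ, weylLattice c r w (QuotientGroup.mk (cochar c r ϖ l)) =
      QuotientGroup.mk (cochar c r ϖ (signedPerm σ ε l)) := by
  let H : Subgroup (Equiv.Perm (Fin r → ℤ)) :=
    { carrier := {u | ∃ w : weylGroup c r, ∀ l : Fin r → ℤ,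
        weylLattice c r w (QuotientGroup.mk (cochar c r ϖ l)) = QuotientGroup.mk (cochar c r ϖ (u l))}
      mul_mem' := by
        rintro u v ⟨w, hw⟩ ⟨x, hx⟩
        refine ⟨w * x, fun l => ?_⟩
        have h1 := hx l
        have h2 := hw (v l)
        rw [weylLattice_mk, map_mul, MulAut.mul_apply, ← weylLattice_mk, ← weylLattice_mk, h1, h2]
        rfl
      one_mem' := ⟨1, fun l => by
        rw [weylLattice_mk, map_one]
        rfl⟩
      inv_mem' := by
        rintro u ⟨w, hw⟩
        refine ⟨w⁻¹, fun l => ?_⟩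
        have h1 := hw (u.symm l)
        rw [Equiv.apply_symm_apply] at h1
        rw [← h1, weylLattice_mk, weylLattice_mk, map_inv, MulAut.inv_apply_self]
        rfl }
  refine signedPerm_mem_of_simple H (fun i j hij => ?_) (fun i hi => ?_) σ ε
  · obtain ⟨w, hw⟩ := exists_weylAction_eq_reflTorus (c := c) (half i) (half j)
    refine ⟨w, fun l => ?_⟩
    change _ = QuotientGroup.mk (cochar c r ϖ (signedPerm _ _ l))
    rw [weylLattice_mk, hw, mk_reflTorus_swap (fun h => by rw [h] at hij; omega)]
  · obtain ⟨w, hw⟩ := exists_weylAction_eq_reflTorus (c := c) (half i) (half i).rev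
    refine ⟨w, fun l => ?_⟩
    change _ = QuotientGroup.mk (cochar c r ϖ (signedPerm _ _ l))
    rw [weylLattice_mk, hw, mk_reflTorus_flip]

end SimpleReflections

/-! ### The Weyl group acts on `Λ` by signed permutations. -/

section WeylGroup

/-- The exponents `r, …, 1` and their negatives are `2r` distinct integers, so the diagonal entries
have distinct norms. -/
theorem exists_regular {ϖ : Eˣ} (hϖ : IsUniformizer ϖ) :
    ∃ t : torus c r, Function.Injective fun a => mat t.1 a a := by
  refine ⟨cochar c r ϖ fun i => r - i.1, fun a b hab => ?_⟩
  have h := congrArg norm hab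
  obtain ⟨i, rfl | rfl⟩ := exists_half a <;> obtain ⟨j, rfl | rfl⟩ := exists_half b <;>
    simp only [norm_cochar_half, norm_cochar_rev] at h <;> have h1 := zpow_norm_injective hϖ h <;>
    have h2 := i.2 <;> have h3 := j.2
  · congr 1
    rw [Fin.ext_iff]
    omega
  · omega
  · omega
  · congr 2
    rw [Fin.ext_iff]
    omega

/-- An element of the normalizer of the torus acts on it by a permutation of the diagonal entries
that commutes with `i ↦ 2r + 1 - i`. -/
theorem exists_perm_of_mem_normalizer {ϖ : Eˣ} (hϖ : IsUniformizer ϖ) {n : unitaryGp c r}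
    (hn : n ∈ Subgroup.normalizer (torus c r : Set (unitaryGp c r))) :
    ∃ π : Equiv.Perm (Fin (2 * r)), (∀ a, π a.rev = (π a).rev) ∧ ∀ (t : torus c r) (a),
      mat (n * t.1 * n⁻¹) a a = mat t.1 (π a) (π a) := by
  -- Compare the `(a, b)` entries of `(n t n⁻¹) n = n t`, where `n t n⁻¹` is diagonal.
  have key : ∀ (t : torus c r) (a b : Fin (2 * r)), mat n a b ≠ 0 →
      mat (n * t.1 * n⁻¹) a a = mat t.1 b b := by
    intro t a b hab
    have h1 : (⟨n * t.1 * n⁻¹, conj_mem_of_mem_normalizer hn t.2⟩ : torus c r).1 * n = n * t.1 := by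
      group
    have h2 : mat (n * t.1 * n⁻¹) a a * mat n a b = mat n a b * mat t.1 b b :=
      (mat_torus_mul ⟨n * t.1 * n⁻¹, conj_mem_of_mem_normalizer hn t.2⟩ n a b).symm.trans
        ((congrArg (fun g => mat g a b) h1).trans (mat_mul_torus t n a b))
    rw [mul_comm] at h2
    exact mul_left_cancel₀ hab h2
  obtain ⟨t₀, ht₀⟩ := exists_regular (c := c) (r := r) hϖ
  -- A torus element with distinct diagonal entries forces each row of `n` to have a single nonzero
  -- entry.
  have huniq : ∀ a b b', mat n a b ≠ 0 → mat n a b' ≠ 0 → b = b' := fun a b b' h h' =>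
    ht₀ ((key t₀ a b h).symm.trans (key t₀ a b' h'))
  have hex : ∀ a, ∃ b, mat n a b ≠ 0 := by
    intro a
    by_contra! h
    have h1 := congrFun (congrFun (mat_mul_inv n) a) a
    rw [mul_apply, one_apply_eq] at h1
    simp [h] at h1
  choose p hp using hex
  have hinv : ∀ a, mat n⁻¹ (p a) a ≠ 0 := by
    intro a h
    have h1 := congrFun (congrFun (mat_mul_inv n) a) a
    rw [mul_apply, one_apply_eq, Finset.sum_eq_single (p a), h, mul_zero] at h1
    · exact zero_ne_one h1
    · intro b _ hb
      have : mat n a b = 0 := by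
        by_contra h'
        exact hb (huniq a b (p a) h' (hp a))
      rw [this, zero_mul]
    · simp
  have hrev : ∀ a, p a.rev = (p a).rev := by
    intro a
    have h1 := hinv a
    rw [mat_inv_apply] at h1
    exact huniq a.rev _ _ (hp _) fun h => h1 (by rw [h, map_zero])
  have hsurj : Function.Surjective p := by
    intro b
    have h1 := congrFun (congrFun (mat_inv_mul n) b) b
    rw [mul_apply, one_apply_eq] at h1
    obtain ⟨a, -, ha⟩ := Finset.exists_ne_zero_of_sum_ne_zero (h1.trans_ne one_ne_zero)
    exact ⟨a, huniq a _ _ (hp a) (right_ne_zero_of_mul ha)⟩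
  exact ⟨Equiv.ofBijective p (Finite.injective_iff_bijective.1 (Finite.injective_iff_surjective.2 hsurj)),
    hrev, fun t a => key t a _ (hp a)⟩

/-- Every element of the Weyl group acts on `Λ` by a signed permutation. -/
theorem exists_signedPerm_eq {ϖ : Eˣ} (hϖ : IsUniformizer ϖ) (w : weylGroup c r) :
    ∃ σ ε, ∀ l : Fin r → ℤ, weylLattice c r w (QuotientGroup.mk (cochar c r ϖ l)) =
      QuotientGroup.mk (cochar c r ϖ (signedPerm σ ε l)) := by
  obtain ⟨n, rfl⟩ := QuotientGroup.mk_surjective w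
  obtain ⟨π, hπ, hn⟩ := exists_perm_of_mem_normalizer hϖ n.2
  have h1 : ∀ i : Fin r, ∃ (j : Fin r) (e : ℤˣ), (π (half i) = half j ∨ π (half i) = (half j).rev) ∧
      ∀ l : Fin r → ℤ, ‖mat (cochar c r ϖ l).1 (π (half i)) (π (half i))‖ =
        ‖(ϖ : E)‖ ^ ((e : ℤ) * l j) := by
    intro i
    obtain ⟨j, hj | hj⟩ := exists_half (π (half i))
    · exact ⟨j, 1, Or.inl hj, fun l => by rw [hj, norm_cochar_half]; simp⟩
    · exact ⟨j, -1, Or.inr hj, fun l => by rw [hj, norm_cochar_rev]; simp⟩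
  choose τ ε hτ hε using h1
  -- If `τ i = τ j`, then `half i` equals `half j` or its mirror image, and the latter lies in the
  -- other half.
  have hinj : Function.Injective τ := by
    intro i j hij
    have h2 : π (half i) = π (half j) ∨ π (half i) = π (half j).rev := by
      rw [hπ]
      rcases hτ i with h | h <;> rcases hτ j with h' | h' <;> rw [h, h', hij] <;> simp
    rcases h2 with h | h
    · exact half_injective (π.injective h)
    · exact absurd (π.injective h) (half_ne_rev i j)
  -- The inverse is taken because `signedPerm σ ε` evaluates its argument at `σ.symm i`.
  refine ⟨(Equiv.ofBijective τ (Finite.injective_iff_bijective.1 hinj)).symm, ε, fun l => ?_⟩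
  rw [weylLattice_mk, mk_eq_mk_cochar_iff]
  intro i
  change ‖mat (n.1 * (cochar c r ϖ l).1 * n.1⁻¹) _ _‖ = _
  rw [hn, hε]
  rfl

end WeylGroup

/-! ### The Cartan decomposition. -/

section Cartan

theorem doubleCoset_eq_of_mk_eq {s t : torus c r}
    (h : (QuotientGroup.mk s : cocharLattice c r) = QuotientGroup.mk t) :
    DoubleCoset.doubleCoset s.1 (latticeSubgroup c r : Set (unitaryGp c r)) (latticeSubgroup c r) =
      DoubleCoset.doubleCoset t.1 (latticeSubgroup c r : Set (unitaryGp c r))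
        (latticeSubgroup c r) := by
  rw [QuotientGroup.eq] at h
  symm
  refine DoubleCoset.doubleCoset_eq_of_mem (H := (latticeSubgroup c r).toSubgroup)
    (K := (latticeSubgroup c r).toSubgroup) ?_
  rw [DoubleCoset.mem_doubleCoset]
  exact ⟨1, one_mem _, (s⁻¹ * t).1, h, by
    change t.1 = 1 * s.1 * (s.1⁻¹ * t.1)
    group⟩

/-- From `G = L T L` one reduces modulo `T°` to some `ϖ^m`. The simple reflections are represented
in `L`, so signed permutations of `m` do not change the double coset and `m` may be made dominant.
-/
theorem exists_mem_doubleCoset {ϖ : Eˣ} (hϖ : IsUniformizer ϖ) (g : unitaryGp c r) :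
    ∃ l ∈ dominant r, g ∈ DoubleCoset.doubleCoset (cochar c r ϖ l).1
      (latticeSubgroup c r : Set (unitaryGp c r)) (latticeSubgroup c r) := by
  obtain ⟨k, hk, t, k', hk', rfl⟩ := exists_mul_torus_mul g
  obtain ⟨m, hm⟩ := exists_mk_eq_cochar hϖ t
  obtain ⟨σ, ε, hd⟩ := exists_signedPerm_dominant m
  refine ⟨_, hd, ?_⟩
  have h1 : ∀ l : Fin r → ℤ, DoubleCoset.doubleCoset (cochar c r ϖ (signedPerm σ ε l)).1
      (latticeSubgroup c r : Set (unitaryGp c r)) (latticeSubgroup c r) =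
      DoubleCoset.doubleCoset (cochar c r ϖ l).1
      (latticeSubgroup c r : Set (unitaryGp c r)) (latticeSubgroup c r) := by
    let f : cocharLattice c r → Set (unitaryGp c r) :=
      Quotient.lift (fun t : torus c r => DoubleCoset.doubleCoset t.1
        (latticeSubgroup c r : Set (unitaryGp c r)) (latticeSubgroup c r))
        fun s t h => doubleCoset_eq_of_mk_eq (Quotient.sound h)
    refine signedPerm_invariant (f := f) (fun i k _ _ t => ?_) ϖ σ ε
    change DoubleCoset.doubleCoset _ _ _ = DoubleCoset.doubleCoset _ _ _
    refine DoubleCoset.doubleCoset_eq_of_mem (H := (latticeSubgroup c r).toSubgroup)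
      (K := (latticeSubgroup c r).toSubgroup) ?_
    rw [DoubleCoset.mem_doubleCoset]
    exact ⟨_, reflElt_mem, _, inv_mem reflElt_mem, rfl⟩
  rw [h1, ← doubleCoset_eq_of_mk_eq hm, DoubleCoset.mem_doubleCoset]
  exact ⟨k, hk, k', hk', rfl⟩

theorem cartan_union {ϖ : Eˣ} (hϖ : IsUniformizer ϖ) :
    (⋃ l ∈ dominant r, DoubleCoset.doubleCoset (cochar c r ϖ l : unitaryGp c r)
      (latticeSubgroup c r) (latticeSubgroup c r)) = Set.univ := by
  refine Set.eq_univ_of_forall fun g => ?_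
  obtain ⟨l, hl, hg⟩ := exists_mem_doubleCoset hϖ g
  exact Set.mem_biUnion hl hg

theorem cartan_disjoint {ϖ : Eˣ} (hϖ : IsUniformizer ϖ) :
    (dominant r).PairwiseDisjoint fun l =>
      DoubleCoset.doubleCoset (cochar c r ϖ l : unitaryGp c r)
        (latticeSubgroup c r : Set (unitaryGp c r)) (latticeSubgroup c r) := by
  intro l hl m hm hlm
  rw [Function.onFun, Set.disjoint_left]
  intro g hg hg'
  obtain ⟨k, hk, k', hk', rfl⟩ := DoubleCoset.mem_doubleCoset.1 hg
  obtain ⟨u, hu, u', hu', h⟩ := DoubleCoset.mem_doubleCoset.1 hg'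
  refine hlm (eq_of_mem_doubleCoset (c := c) hϖ hm hl (mul_mem (inv_mem hk) hu)
    (mul_mem hu' (inv_mem hk')) ?_)
  calc _ = k⁻¹ * (k * (cochar c r ϖ l).1 * k') * k'⁻¹ := by group
    _ = _ := by rw [h]; group

end Cartan

end

section

open Matrix

/-! ### Hecke functions on cosets and double cosets. -/

section Quotients

variable {G : Type*} [Group G] [TopologicalSpace G] {K : OpenSubgroup G}

theorem HeckeAlgebra.apply_eq_of_mk_eq (f : HeckeAlgebra K) {x y : G}
    (h : (QuotientGroup.mk x : G ⧸ K.toSubgroup) = QuotientGroup.mk y) : f x = f y := by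
  have h1 := f.right_invariant (QuotientGroup.eq.1 h : x⁻¹ * y ∈ K) x
  rw [← h1, mul_inv_cancel_left]

theorem finite_apply_ne_zero [IsTopologicalGroup G] [CompactSpace K] [MeasurableSpace G] [BorelSpace G] {ι : Type*} (f : HeckeAlgebra K) {g : ι → G}
    (hg : Function.Injective fun i => (QuotientGroup.mk (g i) : G ⧸ K.toSubgroup)) :
    {i | f (g i) ≠ 0}.Finite := by
  refine ((finite_support_quotient K f.hasCompactSupport).preimage hg.injOn).subset ?_
  intro i hi
  rw [Set.mem_preimage, Function.mem_support]
  exact fun h => hi ((f.apply_eq_of_mk_eq (QuotientGroup.out_eq' _)).symm.trans h)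

open scoped Classical in
/-- The characteristic function of the double coset of `x`. -/
def charDoubleCoset [IsTopologicalGroup G] [CompactSpace K] (x : G) : HeckeAlgebra K :=
  ⟨fun y => if y ∈ DoubleCoset.doubleCoset x (K : Set G) K then 1 else 0, by
    have h : ∀ k ∈ K, ∀ k' ∈ K, ∀ y, y ∈ DoubleCoset.doubleCoset x (K : Set G) K →
        k * y * k' ∈ DoubleCoset.doubleCoset x (K : Set G) K := by
      intro k hk k' hk' y hy
      obtain ⟨a, ha, b, hb, rfl⟩ := DoubleCoset.mem_doubleCoset.1 hy
      exact DoubleCoset.mem_doubleCoset.2 ⟨k * a, mul_mem hk ha, b * k', mul_mem hb hk', by group⟩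
    refine ⟨fun k hk y => if_congr ⟨fun hy => ?_, fun hy => ?_⟩ rfl rfl,
      fun k hk y => if_congr ⟨fun hy => ?_, fun hy => ?_⟩ rfl rfl, ?_⟩
    · have := h _ (inv_mem hk) 1 (one_mem _) _ hy
      rwa [mul_one, inv_mul_cancel_left] at this
    · have := h _ hk 1 (one_mem _) _ hy
      rwa [mul_one] at this
    · have := h 1 (one_mem _) _ (inv_mem hk) _ hy
      rwa [one_mul, mul_inv_cancel_right] at this
    · have := h 1 (one_mem _) _ hk _ hy
      rwa [one_mul] at this
    · have hK : IsCompact (K : Set G) := HeckeAlgebra.isCompact_K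
      exact HasCompactSupport.intro ((hK.mul isCompact_singleton).mul hK) fun y hy => if_neg hy⟩

open scoped Classical in
theorem charDoubleCoset_apply [IsTopologicalGroup G] [CompactSpace K] (x y : G) :
    charDoubleCoset (K := K) x y = if y ∈ DoubleCoset.doubleCoset x (K : Set G) K then 1 else 0 :=
  rfl

theorem HeckeAlgebra.apply_eq_of_mem_doubleCoset (f : HeckeAlgebra K) {x y : G}
    (h : y ∈ DoubleCoset.doubleCoset x (K : Set G) K) : f y = f x := by
  obtain ⟨a, ha, b, hb, rfl⟩ := DoubleCoset.mem_doubleCoset.1 h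
  rw [f.right_invariant hb, f.left_invariant ha]

end Quotients

variable {F E : Type*} [NontriviallyNormedField F] [IsUltrametricDist F] [LocallyCompactSpace F]
  [NontriviallyNormedField E] [NormedAlgebra F E] [Algebra.IsQuadraticExtension F E]
variable {c : E ≃ₐ[F] E} {r : ℕ} {ϖ : Eˣ}

/-! ### The Satake transform as a homomorphism into the Weyl invariants. -/

section Satake

theorem satakeTransform_eq_zero {f : HeckeAlgebra (latticeSubgroup c r)} {t : torus c r}
    (h : ∀ n ∈ unipotentRadical c r, f (t.1 * n) = 0) : satakeTransform c r f t = 0 := by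
  rw [satakeTransform_eq, orbitIntegral]
  simp [h]

/-- The diagonal part of `t n` is `t`, so the support lies in the image of the compact set `B ∩
tsupport f` under the projection to `T`. -/
theorem hasCompactSupport_satakeTransform (f : HeckeAlgebra (latticeSubgroup c r)) :
    HasCompactSupport (satakeTransform c r f) := by
  have h1 : IsCompact ((↑) ⁻¹' tsupport f : Set (borelSubgroup c r)) :=
    (isClosed_borelSubgroup c r).isClosedEmbedding_subtypeVal.isCompact_preimage
      f.hasCompactSupport.isCompact
  refine HasCompactSupport.intro (h1.image continuous_borelProj) fun t ht => ?_
  refine satakeTransform_eq_zero fun n hn => ?_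
  by_contra h
  refine ht ⟨⟨t.1 * n, mul_mem (torus_le_borelSubgroup c r t.2) (unipotentRadical_le hn)⟩,
    subset_tsupport _ h, torus_ext fun i => ?_⟩
  rw [borelProj_apply]
  change mat (t.1 * n) i i = _
  rw [mat_torus_mul, hn.2, mul_one]

theorem satakeTransform_mul_right (f : HeckeAlgebra (latticeSubgroup c r)) {k : torus c r}
    (hk : k ∈ torusCompact c r) (t : torus c r) :
    satakeTransform c r f (t * k) = satakeTransform c r f t := by
  rw [satakeTransform_eq, satakeTransform_eq, sqrtModular_mul, sqrtModular_of_mem hk, mul_one]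
  congr 1
  exact orbitIntegral_mul_right f hk (torus_mem_normalizer k) t.1

/-- The Satake transform of `f`, as an element of the Hecke algebra of the torus. -/
def satakeHecke (f : HeckeAlgebra (latticeSubgroup c r)) : HeckeAlgebra (torusCompact c r) :=
  ⟨satakeTransform c r f,
    fun k hk t => by rw [torus_comm, satakeTransform_mul_right f hk],
    fun k hk t => satakeTransform_mul_right f hk t, hasCompactSupport_satakeTransform f⟩

theorem satakeHecke_apply (f : HeckeAlgebra (latticeSubgroup c r)) (t : torus c r) :
    satakeHecke f t = satakeTransform c r f t := rfl

theorem integrable_satake (f : HeckeAlgebra (latticeSubgroup c r)) (x : unitaryGp c r) :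
    Integrable (fun n : unipotentRadical c r => f (x * n))
      (haarOf (interOpen (latticeSubgroup c r) (unipotentRadical c r))) :=
  (continuous_orbitIntegral_integrand f x).integrable_of_hasCompactSupport
    (hasCompactSupport_restrict (isClosed_unipotentRadical c r) f.hasCompactSupport x)

theorem satakeHecke_add (f g : HeckeAlgebra (latticeSubgroup c r)) :
    satakeHecke (f + g) = satakeHecke f + satakeHecke g := by
  refine DFunLike.ext _ _ fun t => ?_
  rw [HeckeAlgebra.add_apply, satakeHecke_apply, satakeHecke_apply, satakeHecke_apply,
    satakeTransform_eq, satakeTransform_eq, satakeTransform_eq, ← mul_add]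
  congr 1
  exact integral_add (integrable_satake f t.1) (integrable_satake g t.1)

theorem satakeHecke_smul (a : ℂ) (f : HeckeAlgebra (latticeSubgroup c r)) :
    satakeHecke (a • f) = a • satakeHecke f := by
  refine DFunLike.ext _ _ fun t => ?_
  rw [HeckeAlgebra.smul_apply, satakeHecke_apply, satakeHecke_apply,
    satakeTransform_eq, satakeTransform_eq, mul_left_comm]
  congr 1
  exact integral_const_mul a fun n : unipotentRadical c r => f (t.1 * n.1)

/-- An element `t n` can lie in `L` only if its diagonal part `t` lies in `T°`; then `n` must lie in
`N ∩ L`, which has volume 1. -/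
theorem satakeHecke_one : satakeHecke (1 : HeckeAlgebra (latticeSubgroup c r)) = 1 := by
  refine DFunLike.ext _ _ fun t => ?_
  rw [satakeHecke_apply]
  by_cases ht : t ∈ torusCompact c r
  · refine Eq.trans ?_ (HeckeAlgebra.one'_of_mem ht).symm
    rw [satakeTransform_eq, sqrtModular_of_mem ht, one_mul, orbitIntegral]
    have : (fun n : unipotentRadical c r => (1 : HeckeAlgebra (latticeSubgroup c r)) (t.1 * n.1)) =
        (interOpen (latticeSubgroup c r) (unipotentRadical c r) : Set _).indicator fun _ => 1 := by
      ext n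
      have h1 : t.1 * n.1 ∈ latticeSubgroup c r ↔ n.1 ∈ latticeSubgroup c r :=
        mul_mem_cancel_left (ht : t.1 ∈ latticeSubgroup c r)
      by_cases hn : n.1 ∈ latticeSubgroup c r
      · rw [Set.indicator_of_mem (show n ∈ _ from hn)]
        exact HeckeAlgebra.one'_of_mem (h1.2 hn)
      · rw [Set.indicator_of_notMem (show n ∉ _ from hn)]
        exact HeckeAlgebra.one'_of_notMem fun h => hn (h1.1 h)
    rw [this, integral_indicator_const _ (interOpen _ _).isOpen.measurableSet, Measure.real,
      HeckeAlgebra.haarOf_self]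
    simp
  · refine Eq.trans ?_ (HeckeAlgebra.one'_of_notMem ht).symm
    refine satakeTransform_eq_zero fun n hn => HeckeAlgebra.one'_of_notMem fun h => ht ?_
    have h1 := (mem_latticeSubgroup_iff _).1 h
    refine (torus_mem_iff t).2 fun i => ?_
    have h2 := h1 i i
    rwa [mat_torus_mul, hn.2, mul_one] at h2

/-- The integral over `N` carries convolution to convolution by `orbitIntegral_mul`, and multiplying
both sides by a character of `T` preserves this. -/
theorem satakeHecke_mul (f g : HeckeAlgebra (latticeSubgroup c r)) :
    satakeHecke (f * g) = satakeHecke f * satakeHecke g := by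
  refine DFunLike.ext _ _ fun t => ?_
  rw [HeckeAlgebra.mul_apply, satakeHecke_apply, satakeTransform_eq,
    orbitIntegral_mul (borelSemidirect c r) (isClosed_borelSubgroup c r)
      (isClosed_unipotentRadical c r) iwasawa]
  rw [← integral_const_mul]
  refine integral_congr_ae (Filter.Eventually.of_forall fun s => ?_)
  simp only [satakeHecke_apply]
  rw [satakeTransform_eq, satakeTransform_eq]
  have h : sqrtModular t = sqrtModular s * sqrtModular (s⁻¹ * t) := by
    rw [← sqrtModular_mul, mul_inv_cancel_left]
  rw [h]
  ring

theorem mem_heckeInvariants_iff (hϖ : IsUniformizer ϖ) (f : HeckeAlgebra (torusCompact c r)) :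
    f ∈ heckeInvariants c r ↔ ∀ σ ε (l : Fin r → ℤ),
      f (cochar c r ϖ (signedPerm σ ε l)) = f (cochar c r ϖ l) := by
  constructor
  · intro hf σ ε l
    obtain ⟨w, hw⟩ := exists_weylLattice_eq (c := c) ϖ σ ε
    have h1 := hw l
    rw [weylLattice_mk] at h1
    rw [← f.apply_eq_of_mk_eq h1]
    exact hf w _
  · intro hf w t
    obtain ⟨σ, ε, h⟩ := exists_signedPerm_eq (c := c) hϖ w
    obtain ⟨l, hl⟩ := exists_mk_eq_cochar hϖ t
    have h1 := h l
    rw [← hl, weylLattice_mk] at h1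
    rw [f.apply_eq_of_mk_eq h1, f.apply_eq_of_mk_eq hl, hf]

/-- Invariance under simple reflections, `satakeTransform_reflTorus`, suffices since they generate
the signed permutations. -/
theorem satakeHecke_mem (hϖ : IsUniformizer ϖ) (f : HeckeAlgebra (latticeSubgroup c r)) :
    satakeHecke f ∈ heckeInvariants c r := by
  rw [mem_heckeInvariants_iff hϖ]
  let φ : cocharLattice c r → ℂ :=
    Quotient.lift (satakeHecke f) fun s t h => (satakeHecke f).apply_eq_of_mk_eq (Quotient.sound h)
  exact fun σ ε l => signedPerm_invariant (f := φ) (fun i k hk hi t =>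
    satakeTransform_reflTorus hk (ne_of_val_eq_succ hk) hi f t) ϖ σ ε l

/-- The Satake transform as a homomorphism of algebras. -/
def satakeHom (hϖ : IsUniformizer ϖ) :
    HeckeAlgebra (latticeSubgroup c r) →ₐ[ℂ] heckeInvariants c r :=
  AlgHom.ofLinearMap
    { toFun := fun f => ⟨satakeHecke f, satakeHecke_mem hϖ f⟩
      map_add' := fun f g => Subtype.ext (satakeHecke_add f g)
      map_smul' := fun a f => Subtype.ext (satakeHecke_smul a f) }
    (Subtype.ext satakeHecke_one) fun f g => Subtype.ext (satakeHecke_mul f g)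

theorem satakeHom_apply (hϖ : IsUniformizer ϖ) (f : HeckeAlgebra (latticeSubgroup c r))
    (t : torus c r) : (satakeHom hϖ f).1 t = satakeTransform c r f t := rfl

end Satake

/-! ### Triangularity for the dominance order, and bijectivity. -/

section Triangularity

/-- The sum of all partial sums. -/
def height (l : Fin r → ℤ) : ℤ := ∑ j, partialSum l j

theorem height_le {l m : Fin r → ℤ} (h : ∀ j, partialSum l j ≤ partialSum m j) :
    height l ≤ height m := Finset.sum_le_sum fun j _ => h j

/-- The height is strictly increasing for the dominance order, so a partial order argument becomes
one by integer height. -/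
theorem eq_of_height_le {l m : Fin r → ℤ} (h : ∀ j, partialSum l j ≤ partialSum m j)
    (hh : height m ≤ height l) : l = m :=
  partialSum_injective fun j => (Finset.sum_eq_sum_iff_of_le fun j _ => h j).1
    (le_antisymm (height_le h) hh) j (Finset.mem_univ j)

theorem height_nonneg {l : Fin r → ℤ} (hl : l ∈ dominant r) : 0 ≤ height l :=
  Finset.sum_nonneg fun _ _ => Finset.sum_nonneg fun i _ => hl.2 i

theorem partialSum_le_of_apply_ne_zero (hϖ : IsUniformizer ϖ) {l m : Fin r → ℤ} (hl : l ∈ dominant r)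
    {n : unitaryGp c r} (hn : n ∈ unipotentRadical c r)
    (h : (cochar c r ϖ m).1 * n ∈ DoubleCoset.doubleCoset (cochar c r ϖ l).1
      (latticeSubgroup c r : Set (unitaryGp c r)) (latticeSubgroup c r)) (j : Fin r) :
    partialSum m j ≤ partialSum l j := by
  obtain ⟨k, hk, k', hk', h⟩ := DoubleCoset.mem_doubleCoset.1 h
  exact partialSum_le hϖ hl hn hk hk' h j

/-- The characteristic function of the double coset of `ϖ^l`. -/
abbrev charFn (c : E ≃ₐ[F] E) (r : ℕ) (ϖ : Eˣ) (l : Fin r → ℤ) : HeckeAlgebra (latticeSubgroup c r) :=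
  charDoubleCoset (cochar c r ϖ l).1

theorem partialSum_le_of_satakeTransform_charFn (hϖ : IsUniformizer ϖ) {l m : Fin r → ℤ}
    (hl : l ∈ dominant r) (h : satakeTransform c r (charFn c r ϖ l) (cochar c r ϖ m) ≠ 0)
    (j : Fin r) : partialSum m j ≤ partialSum l j := by
  by_contra h1
  refine h (satakeTransform_eq_zero fun n hn => ?_)
  rw [charDoubleCoset_apply, if_neg]
  exact fun h2 => h1 (partialSum_le_of_apply_ne_zero hϖ hl hn h2 j)

/-- The integrand is continuous, nonnegative and equal to 1 at `n = 1`, so its integral is positive.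
-/
theorem satakeTransform_charFn_self (l : Fin r → ℤ) :
    satakeTransform c r (charFn c r ϖ l) (cochar c r ϖ l) ≠ 0 := by
  classical
  rw [satakeTransform_eq]
  refine mul_ne_zero (sqrtModular_ne_zero _) ?_
  set f := charFn c r ϖ l with hf
  have h1 : ∀ x, f x = ((f x).re : ℂ) := by
    intro x
    rw [hf, charDoubleCoset_apply]
    split_ifs <;> simp
  have h2 : orbitIntegral (latticeSubgroup c r) (unipotentRadical c r) f (cochar c r ϖ l).1 =
      ((∫ n : unipotentRadical c r, (f ((cochar c r ϖ l).1 * n.1)).re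
        ∂(haarOf (interOpen (latticeSubgroup c r) (unipotentRadical c r))) : ℝ) : ℂ) := by
    refine Eq.trans ?_ integral_ofReal
    exact integral_congr_ae (Filter.Eventually.of_forall fun n => h1 _)
  rw [h2, Complex.ofReal_ne_zero]
  refine (Continuous.integral_pos_of_hasCompactSupport_nonneg_nonzero (x := 1) ?_ ?_ ?_ ?_).ne'
  · exact Complex.continuous_re.comp (continuous_orbitIntegral_integrand f _)
  · exact (hasCompactSupport_restrict (isClosed_unipotentRadical c r) f.hasCompactSupport
      (cochar c r ϖ l).1).comp_left Complex.zero_re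
  · intro n
    change 0 ≤ (f _).re
    rw [hf, charDoubleCoset_apply]
    split_ifs <;> simp
  · rw [Subgroup.coe_one, mul_one, hf, charDoubleCoset_apply, if_pos]
    · simp
    · exact DoubleCoset.mem_doubleCoset.2 ⟨1, one_mem _, 1, one_mem _, by group⟩

theorem mk_cochar_injective_lattice (hϖ : IsUniformizer ϖ) : Function.Injective fun l : Fin r → ℤ =>
    (QuotientGroup.mk (cochar c r ϖ l).1 : unitaryGp c r ⧸ (latticeSubgroup c r).toSubgroup) := by
  intro l m h
  have h1 : (cochar c r ϖ l).1⁻¹ * (cochar c r ϖ m).1 ∈ latticeSubgroup c r := QuotientGroup.eq.1 h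
  exact mk_cochar_injective (c := c) hϖ (QuotientGroup.eq.2 h1)

/-- Among the dominant `l` with `f(ϖ^l) ≠ 0` take one of maximal height. At `ϖ^l` only the double
coset of `ϖ^l` itself contributes, so the transform there is a nonzero multiple of the diagonal
coefficient. -/
theorem satakeHom_injective (hϖ : IsUniformizer ϖ) :
    Function.Injective (satakeHom hϖ : HeckeAlgebra (latticeSubgroup c r) →ₐ[ℂ] _) := by
  rw [injective_iff_map_eq_zero]
  intro f hf
  by_contra hf0
  have hfin : {l | f (cochar c r ϖ l).1 ≠ 0}.Finite :=
    finite_apply_ne_zero f (mk_cochar_injective_lattice hϖ)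
  have hfin' := hfin.subset (Set.inter_subset_left (t := dominant r))
  have hne : ({l | f (cochar c r ϖ l).1 ≠ 0} ∩ dominant r).Nonempty := by
    by_contra hemp
    rw [Set.not_nonempty_iff_eq_empty, Set.eq_empty_iff_forall_notMem] at hemp
    refine hf0 (DFunLike.ext _ _ fun g => ?_)
    obtain ⟨l, hl, hg⟩ := exists_mem_doubleCoset hϖ g
    rw [f.apply_eq_of_mem_doubleCoset hg]
    by_contra h
    exact hemp l ⟨h, hl⟩
  obtain ⟨l, ⟨hl0, hl⟩, hmax⟩ := Set.exists_max_image _ height hfin' hne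
  have key : ∀ n : unipotentRadical c r, f ((cochar c r ϖ l).1 * n.1) =
      f (cochar c r ϖ l).1 * charFn c r ϖ l ((cochar c r ϖ l).1 * n.1) := by
    intro n
    obtain ⟨m, hm, hg⟩ := exists_mem_doubleCoset hϖ ((cochar c r ϖ l).1 * n.1)
    rw [charDoubleCoset_apply]
    split_ifs with h
    · rw [f.apply_eq_of_mem_doubleCoset h, mul_one]
    · rw [mul_zero, f.apply_eq_of_mem_doubleCoset hg]
      by_contra h0
      -- Any other double coset meeting `ϖ^l N` belongs to an `m` that dominates `l`; maximality of
      -- the height then forces `m = l`.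
      have h1 := partialSum_le_of_apply_ne_zero hϖ hm n.2 hg
      have h2 := eq_of_height_le h1 (hmax m ⟨h0, hm⟩)
      subst h2
      exact h hg
  have h1 : satakeTransform c r f (cochar c r ϖ l) =
      f (cochar c r ϖ l).1 * satakeTransform c r (charFn c r ϖ l) (cochar c r ϖ l) := by
    rw [satakeTransform_eq, satakeTransform_eq, mul_left_comm]
    congr 1
    refine Eq.trans ?_ (integral_const_mul _ _)
    exact integral_congr_ae (Filter.Eventually.of_forall key)
  have h2 : satakeTransform c r f (cochar c r ϖ l) = 0 := by
    rw [← satakeHom_apply hϖ, hf]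
    rfl
  rw [h2] at h1
  exact mul_ne_zero hl0 (satakeTransform_charFn_self l) h1.symm

theorem heckeInvariants_eq_zero (hϖ : IsUniformizer ϖ) (f : heckeInvariants c r)
    (h : ∀ l ∈ dominant r, f.1 (cochar c r ϖ l) = 0) : f = 0 := by
  refine Subtype.ext (DFunLike.ext _ _ fun t => ?_)
  obtain ⟨l, hl⟩ := exists_mk_eq_cochar hϖ t
  obtain ⟨σ, ε, hd⟩ := exists_signedPerm_dominant l
  rw [f.1.apply_eq_of_mk_eq hl, ← (mem_heckeInvariants_iff hϖ f.1).1 f.2 σ ε, h _ hd]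
  rfl

/-- Induction on a strict bound for the heights of the dominant support: a combination of transforms
of characteristic functions removes the top layer. -/
theorem mem_range_satakeHom (hϖ : IsUniformizer ϖ) (n : ℕ) : ∀ f : heckeInvariants c r,
    (∀ l ∈ dominant r, f.1 (cochar c r ϖ l) ≠ 0 → height l < n) → f ∈ (satakeHom hϖ).range := by
  induction n with
  | zero =>
    intro f hf
    rw [heckeInvariants_eq_zero hϖ f]
    · exact zero_mem _
    · intro l hl
      by_contra h
      have := hf l hl h
      have := height_nonneg hl
      push_cast at *
      omega
  | succ n ih =>
    intro f hf
    have hfin : {l | f.1 (cochar c r ϖ l) ≠ 0}.Finite :=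
      finite_apply_ne_zero f.1 fun _ _ h => mk_cochar_injective (c := c) hϖ h
    have hfin' : ({l | f.1 (cochar c r ϖ l) ≠ 0} ∩ {l | l ∈ dominant r ∧ height l = n}).Finite :=
      hfin.subset Set.inter_subset_left
    set A := hfin'.toFinset with hA
    have hmem : ∀ l, l ∈ A ↔ f.1 (cochar c r ϖ l) ≠ 0 ∧ l ∈ dominant r ∧ height l = n := by
      intro l
      rw [hA, Set.Finite.mem_toFinset]
      rfl
    -- The value of `f` at `ϖ^l` divided by the diagonal coefficient.
    let a : (Fin r → ℤ) → ℂ := fun l =>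
      f.1 (cochar c r ϖ l) * (satakeTransform c r (charFn c r ϖ l) (cochar c r ϖ l))⁻¹
    let u : HeckeAlgebra (latticeSubgroup c r) := ∑ l ∈ A, a l • charFn c r ϖ l
    let ev : ∀ m : Fin r → ℤ, heckeInvariants c r →ₗ[ℂ] ℂ := fun m =>
      { toFun := fun f => f.1 (cochar c r ϖ m)
        map_add' := fun _ _ => rfl
        map_smul' := fun _ _ => rfl }
    have hu : ∀ m, (satakeHom hϖ u).1 (cochar c r ϖ m) =
        ∑ l ∈ A, a l * satakeTransform c r (charFn c r ϖ l) (cochar c r ϖ m) := by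
      intro m
      change ev m (satakeHom hϖ u) = _
      rw [map_sum, map_sum]
      refine Finset.sum_congr rfl fun l _ => ?_
      rw [map_smul, map_smul]
      rfl
    have hsub : f - satakeHom hϖ u ∈ (satakeHom hϖ).range := by
      refine ih _ fun m hm h => ?_
      have h0 : (f - satakeHom hϖ u).1 (cochar c r ϖ m) =
          f.1 (cochar c r ϖ m) - (satakeHom hϖ u).1 (cochar c r ϖ m) := map_sub (ev m) _ _
      rw [h0, hu] at h
      by_contra hlt
      rw [not_lt] at hlt
      -- At height `n` or above, a function attached to `l ∈ A` contributes only at `m = l`, since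
      -- `m` would be dominated by `l` without having smaller height.
      have hz : ∀ l ∈ A, l ≠ m → a l * satakeTransform c r (charFn c r ϖ l) (cochar c r ϖ m) = 0 := by
        intro l hl hlm
        by_contra hne
        have h1 := partialSum_le_of_satakeTransform_charFn hϖ ((hmem l).1 hl).2.1
          (right_ne_zero_of_mul hne)
        exact hlm (eq_of_height_le h1 (by rw [((hmem l).1 hl).2.2]; exact hlt)).symm
      by_cases hmA : m ∈ A
      · rw [Finset.sum_eq_single_of_mem m hmA hz] at h
        refine h ?_
        simp only [a]
        rw [inv_mul_cancel_right₀ (satakeTransform_charFn_self m), sub_self]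
      · rw [Finset.sum_eq_zero fun l hl => hz l hl fun h => hmA (h ▸ hl), sub_zero] at h
        have h1 := hf m hm h
        push_cast at h1
        exact hmA ((hmem m).2 ⟨h, hm, by omega⟩)
    have := add_mem hsub (AlgHom.mem_range_self (satakeHom hϖ) u)
    rwa [sub_add_cancel] at this

theorem satakeHom_surjective (hϖ : IsUniformizer ϖ) :
    Function.Surjective (satakeHom hϖ : HeckeAlgebra (latticeSubgroup c r) →ₐ[ℂ] _) := by
  intro f
  have hfin : {l | f.1 (cochar c r ϖ l) ≠ 0}.Finite :=
    finite_apply_ne_zero f.1 fun _ _ h => mk_cochar_injective (c := c) hϖ h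
  obtain ⟨M, hM⟩ := (hfin.image height).bddAbove
  refine mem_range_satakeHom hϖ (M + 1).toNat f fun l _ h => ?_
  have h1 : height l ≤ M := hM ⟨l, h, rfl⟩
  have h2 := Int.self_le_toNat (M + 1)
  omega

end Triangularity

end

section

open Matrix

/-! ### Hecke algebras of normal subgroups, group algebras and Laurent polynomials. -/

section GroupAlgebra

variable {G : Type*} [Group G] [TopologicalSpace G] [IsTopologicalGroup G] [MeasurableSpace G]
  [BorelSpace G] {K : OpenSubgroup G} [CompactSpace K] [K.toSubgroup.Normal]

/-- The element of the group algebra of `G / K` with coefficients the values of `f`. -/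
def heckeCoeff (f : HeckeAlgebra K) : MonoidAlgebra ℂ (G ⧸ K.toSubgroup) :=
  .ofCoeff (Finsupp.ofSupportFinite (fun x : G ⧸ K.toSubgroup => f x.out)
    (finite_support_quotient K f.hasCompactSupport))

theorem coeff_heckeCoeff (f : HeckeAlgebra K) (g : G) :
    (heckeCoeff f).coeff (QuotientGroup.mk g) = f g :=
  f.apply_eq_of_mk_eq (QuotientGroup.out_eq' _)

theorem heckeCoeff_ext {a b : MonoidAlgebra ℂ (G ⧸ K.toSubgroup)}
    (h : ∀ g : G, a.coeff (QuotientGroup.mk g) = b.coeff (QuotientGroup.mk g)) : a = b := by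
  refine MonoidAlgebra.coeff_injective (Finsupp.ext fun x => ?_)
  obtain ⟨g, rfl⟩ := QuotientGroup.mk_surjective x
  exact h g

theorem heckeCoeff_one : heckeCoeff (1 : HeckeAlgebra K) = 1 := by
  classical
  refine heckeCoeff_ext fun g => ?_
  rw [coeff_heckeCoeff, MonoidAlgebra.one_def, MonoidAlgebra.coeff_single, Finsupp.single_apply]
  have h1 : (1 : G ⧸ K.toSubgroup) = QuotientGroup.mk g ↔ g ∈ K := by
    rw [eq_comm, QuotientGroup.eq_one_iff]
    rfl
  rw [if_congr h1 rfl rfl]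
  split_ifs with h
  · exact HeckeAlgebra.one'_of_mem h
  · exact HeckeAlgebra.one'_of_notMem h

/-- The convolution integral is a sum over cosets of `K`, each of volume 1, and this sum is the
product formula in the group algebra. -/
theorem heckeCoeff_mul (f g : HeckeAlgebra K) :
    heckeCoeff (f * g) = heckeCoeff f * heckeCoeff g := by
  refine heckeCoeff_ext fun t => ?_
  rw [coeff_heckeCoeff, MonoidAlgebra.coeff_mul_apply_left, HeckeAlgebra.mul_apply,
    integral_eq_finsum K ?_ (HeckeAlgebra.hasCompactSupport_integrand f g t), Finsupp.sum,
    finsum_eq_sum_of_support_subset (s := (heckeCoeff f).coeff.support)]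
  · refine Finset.sum_congr rfl fun x _ => ?_
    have h1 : x⁻¹ * QuotientGroup.mk t = (QuotientGroup.mk (x.out⁻¹ * t) : G ⧸ K.toSubgroup) := by
      conv_lhs => rw [← QuotientGroup.out_eq' x]
      rfl
    rw [h1, coeff_heckeCoeff]
    rfl
  · intro x hx
    rw [Finset.mem_coe, Finsupp.mem_support_iff]
    exact left_ne_zero_of_mul hx
  · intro k hk s
    rw [f.right_invariant hk, _root_.mul_inv_rev, mul_assoc, g.left_invariant (inv_mem hk)]

theorem heckeCoeff_bijective :
    Function.Bijective (heckeCoeff : HeckeAlgebra K → MonoidAlgebra ℂ (G ⧸ K.toSubgroup)) := by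
  constructor
  · intro f g h
    refine DFunLike.ext _ _ fun x => ?_
    rw [← coeff_heckeCoeff f, ← coeff_heckeCoeff g, h]
  · intro a
    have hr : ∀ k ∈ K, ∀ x : G, (QuotientGroup.mk (x * k) : G ⧸ K.toSubgroup) =
        QuotientGroup.mk x := fun k hk x => QuotientGroup.mk_mul_of_mem x hk
    have hl : ∀ k ∈ K, ∀ x : G, (QuotientGroup.mk (k * x) : G ⧸ K.toSubgroup) =
        QuotientGroup.mk x := by
      intro k hk x
      have h1 : (QuotientGroup.mk k : G ⧸ K.toSubgroup) = 1 := (QuotientGroup.eq_one_iff k).2 hk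
      rw [QuotientGroup.mk_mul, h1, one_mul]
    have hK : IsCompact (K : Set G) := HeckeAlgebra.isCompact_K
    let f : HeckeAlgebra K := ⟨fun g => a.coeff (QuotientGroup.mk g),
      fun k hk x => congrArg a.coeff (hl k hk x), fun k hk x => congrArg a.coeff (hr k hk x),
      HasCompactSupport.intro (K := ⋃ x ∈ a.coeff.support, x.out • (K : Set G))
        (a.coeff.support.isCompact_biUnion fun x _ => hK.smul x.out) fun g hg => by
          by_contra h
          refine hg (Set.mem_biUnion (Finsupp.mem_support_iff.2 h) ?_)
          rw [Set.mem_smul_set_iff_inv_smul_mem, smul_eq_mul]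
          exact QuotientGroup.eq.1 (QuotientGroup.out_eq' (QuotientGroup.mk g))⟩
    exact ⟨f, heckeCoeff_ext fun g => coeff_heckeCoeff f g⟩

/-- The Hecke algebra of a normal compact open subgroup is the group algebra of the quotient. -/
def heckeEquivGroupAlgebra : HeckeAlgebra K ≃ₐ[ℂ] MonoidAlgebra ℂ (G ⧸ K.toSubgroup) :=
  AlgEquiv.ofBijective
    (AlgHom.ofLinearMap
      { toFun := heckeCoeff
        map_add' := fun f g => heckeCoeff_ext fun x => by
          rw [MonoidAlgebra.coeff_add, Finsupp.add_apply, coeff_heckeCoeff, coeff_heckeCoeff,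
            coeff_heckeCoeff, HeckeAlgebra.add_apply]
        map_smul' := fun a f => heckeCoeff_ext fun x => by
          rw [MonoidAlgebra.coeff_smul_apply, coeff_heckeCoeff, coeff_heckeCoeff,
            HeckeAlgebra.smul_apply]
          rfl }
      heckeCoeff_one heckeCoeff_mul) heckeCoeff_bijective

theorem coeff_heckeEquivGroupAlgebra (f : HeckeAlgebra K) (g : G) :
    (heckeEquivGroupAlgebra f).coeff (QuotientGroup.mk g) = f g := coeff_heckeCoeff f g

end GroupAlgebra

/-- The restriction of an isomorphism of algebras to corresponding subalgebras. -/
def subalgebraEquiv {R A B : Type*} [CommSemiring R] [Semiring A] [Semiring B] [Algebra R A]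
    [Algebra R B] (e : A ≃ₐ[R] B) {S : Subalgebra R A} {T : Subalgebra R B}
    (h : ∀ a, a ∈ S ↔ e a ∈ T) : S ≃ₐ[R] T :=
  AlgEquiv.ofBijective
    ((e.toAlgHom.comp S.val).codRestrict T fun a => (h a.1).1 a.2)
    ⟨fun _ _ hab => Subtype.ext (e.injective (congrArg Subtype.val hab)), fun b =>
      ⟨⟨e.symm b.1, (h _).2 (by rw [AlgEquiv.apply_symm_apply]; exact b.2)⟩,
        Subtype.ext (e.apply_symm_apply b.1)⟩⟩

variable {F E : Type*} [NontriviallyNormedField F] [IsUltrametricDist F] [LocallyCompactSpace F]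
  [NontriviallyNormedField E] [NormedAlgebra F E] [Algebra.IsQuadraticExtension F E]
variable {c : E ≃ₐ[F] E} {r : ℕ} {ϖ : Eˣ}

theorem mem_latticeInvariants_iff (a : MonoidAlgebra ℂ (cocharLattice c r)) :
    a ∈ latticeInvariants c r ↔ ∀ w x, a.coeff (weylLattice c r w x) = a.coeff x := by
  rw [latticeInvariants, Algebra.mem_iInf]
  refine forall_congr' fun w => ?_
  rw [AlgHom.mem_equalizer]
  constructor
  · intro h x
    have h1 := congrArg (fun b : MonoidAlgebra ℂ (cocharLattice c r) =>
      b.coeff (weylLattice c r w x)) h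
    have h2 := MonoidAlgebra.coeff_domCongr (R := ℂ) (weylLattice c r w) a (weylLattice c r w x)
    rw [MulEquiv.symm_apply_apply] at h2
    exact h1.symm.trans h2
  · intro h
    refine MonoidAlgebra.coeff_injective (Finsupp.ext fun x => ?_)
    refine (MonoidAlgebra.coeff_domCongr (R := ℂ) (weylLattice c r w) a x).trans ?_
    rw [← h, MulEquiv.apply_symm_apply]
    rfl

theorem mem_laurentInvariants_iff (a : AddMonoidAlgebra ℂ (Fin r → ℤ)) :
    a ∈ laurentInvariants r ↔ ∀ σ ε l, a.coeff (signedPerm σ ε l) = a.coeff l := by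
  rw [laurentInvariants, Algebra.mem_iInf]
  refine forall_congr' fun σ => ?_
  rw [Algebra.mem_iInf]
  refine forall_congr' fun ε => ?_
  rw [AlgHom.mem_equalizer]
  constructor
  · intro h x
    have h1 := congrArg (fun b : AddMonoidAlgebra ℂ (Fin r → ℤ) => b.coeff (signedPerm σ ε x)) h
    have h2 := AddMonoidAlgebra.coeff_domCongr (R := ℂ) (signedPerm σ ε) a (signedPerm σ ε x)
    rw [AddEquiv.symm_apply_apply] at h2
    exact h1.symm.trans h2
  · intro h
    refine AddMonoidAlgebra.coeff_injective (Finsupp.ext fun x => ?_)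
    refine (AddMonoidAlgebra.coeff_domCongr (R := ℂ) (signedPerm σ ε) a x).trans ?_
    rw [← h, AddEquiv.apply_symm_apply]
    rfl

/-- `H(T, T°)^W` is isomorphic to `ℂ[Λ]^W`. -/
def heckeLatticeEquiv (c : E ≃ₐ[F] E) (r : ℕ) : heckeInvariants c r ≃ₐ[ℂ] latticeInvariants c r :=
  subalgebraEquiv (heckeEquivGroupAlgebra (K := torusCompact c r)) fun f => by
    rw [mem_latticeInvariants_iff]
    refine forall_congr' fun w => ⟨fun h x => ?_, fun h t => ?_⟩
    · obtain ⟨t, rfl⟩ := QuotientGroup.mk_surjective x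
      rw [weylLattice_mk, coeff_heckeEquivGroupAlgebra, coeff_heckeEquivGroupAlgebra, h]
    · have h1 := h (QuotientGroup.mk t)
      rwa [weylLattice_mk, coeff_heckeEquivGroupAlgebra, coeff_heckeEquivGroupAlgebra] at h1

/-- The group algebra of `Λ` is the algebra of Laurent polynomials. -/
def latticeLaurentEquivAux (c : E ≃ₐ[F] E) (r : ℕ) (hϖ : IsUniformizer ϖ) :
    MonoidAlgebra ℂ (cocharLattice c r) ≃ₐ[ℂ] AddMonoidAlgebra ℂ (Fin r → ℤ) :=
  (MonoidAlgebra.domCongr ℂ ℂ (cocharEquiv (c := c) (r := r) hϖ).symm).trans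
    (AddMonoidAlgebra.toMultiplicativeAlgEquiv ℂ ℂ (Fin r → ℤ)).symm

theorem coeff_toMultiplicativeAlgEquiv {M : Type*} [AddMonoid M] (a : AddMonoidAlgebra ℂ M) (m : M) :
    (AddMonoidAlgebra.toMultiplicativeAlgEquiv ℂ ℂ M a).coeff (Multiplicative.ofAdd m) = a.coeff m :=
  Finsupp.mapDomain_apply Multiplicative.ofAdd.injective a.coeff m

theorem coeff_latticeLaurentEquivAux (hϖ : IsUniformizer ϖ)
    (a : MonoidAlgebra ℂ (cocharLattice c r)) (l : Fin r → ℤ) :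
    (latticeLaurentEquivAux c r hϖ a).coeff l = a.coeff (QuotientGroup.mk (cochar c r ϖ l)) := by
  refine Eq.trans ?_ (MonoidAlgebra.coeff_domCongr (R := ℂ) (cocharEquiv (c := c) (r := r) hϖ).symm
    a (Multiplicative.ofAdd l))
  rw [← coeff_toMultiplicativeAlgEquiv]
  congr 2
  exact AlgEquiv.apply_symm_apply _ _

/-- `ℂ[Λ]^W` is isomorphic to the algebra of invariant Laurent polynomials. -/
def latticeLaurentEquiv (c : E ≃ₐ[F] E) (r : ℕ) (hϖ : IsUniformizer ϖ) :
    latticeInvariants c r ≃ₐ[ℂ] laurentInvariants r :=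
  subalgebraEquiv (latticeLaurentEquivAux c r hϖ) fun a => by
    rw [mem_latticeInvariants_iff, mem_laurentInvariants_iff]
    simp only [coeff_latticeLaurentEquivAux]
    -- The two invariance conditions agree because every signed permutation comes from the Weyl
    -- group and every Weyl element acts as a signed permutation.
    constructor
    · intro h σ ε l
      obtain ⟨w, hw⟩ := exists_weylLattice_eq (c := c) ϖ σ ε
      rw [← hw, h]
    · intro h w x
      obtain ⟨t, rfl⟩ := QuotientGroup.mk_surjective x
      obtain ⟨l, hl⟩ := exists_mk_eq_cochar hϖ t
      obtain ⟨σ, ε, hw⟩ := exists_signedPerm_eq (c := c) hϖ w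
      rw [hl, hw, h]

end

end LocalHecke

end

open LocalHecke
theorem mainTheorem10 {F E : Type*}
    [NontriviallyNormedField F] [IsUltrametricDist F] [LocallyCompactSpace F] [CharZero F]
    [NontriviallyNormedField E] [NormedAlgebra F E] [Algebra.IsQuadraticExtension F E]
    (hodd : ‖(2 : F)‖ = 1) (hram : IsRamified F E)
    (c : E ≃ₐ[F] E) (hc : c ≠ AlgEquiv.refl)
    (ϖ : Eˣ) (hϖ : IsUniformizer ϖ) (r : ℕ) :
    ((⋃ l ∈ dominant r, DoubleCoset.doubleCoset (cochar c r ϖ l : unitaryGp c r)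
          (latticeSubgroup c r) (latticeSubgroup c r)) = Set.univ ∧
      (dominant r).PairwiseDisjoint fun l =>
        DoubleCoset.doubleCoset (cochar c r ϖ l : unitaryGp c r)
          (latticeSubgroup c r : Set (unitaryGp c r)) (latticeSubgroup c r)) ∧
    ∃ (S : HeckeAlgebra (latticeSubgroup c r) ≃ₐ[ℂ] heckeInvariants c r)
      (Φ : heckeInvariants c r ≃ₐ[ℂ] latticeInvariants c r)
      (Ψ : latticeInvariants c r ≃ₐ[ℂ] laurentInvariants r),
      (∀ f t, (S f).1 t = satakeTransform c r f t) ∧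
      (∀ f t, (Φ f).1.coeff (QuotientGroup.mk t) = f.1 t) ∧
      (∀ a l, (Ψ a).1.coeff l = a.1.coeff (QuotientGroup.mk (cochar c r ϖ l))) :=
  ⟨⟨cartan_union hϖ, cartan_disjoint hϖ⟩,
    AlgEquiv.ofBijective (satakeHom hϖ) ⟨satakeHom_injective hϖ, satakeHom_surjective hϖ⟩,
    heckeLatticeEquiv c r, latticeLaurentEquiv c r hϖ, fun f t => satakeHom_apply hϖ f t,
    fun f t => coeff_heckeEquivGroupAlgebra f.1 t, fun a l => coeff_latticeLaurentEquivAux hϖ a.1 l⟩
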